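/- **Setting.** Let $\mathcal P\subset\mathbb R^s$ be compact, $\mathcal V=\prod_{k=1}^s[\underline\nu_k,\bar\nu_k]$, and let all plant matrices below be continuous functions of $\rho\in\mathcal P$. Consider the input-delayed LPV plant $$\dot x_p=A_p(\rho)x_p+B_{p1}(\rho)d+B_{p2}(\rho)v,\quad e=C_{p1}(\rho)x_p+D_{p11}(\rho)d+D_{p12}(\rho)v,\quad y=C_{p2}(\rho)x_p+D_{p21}(\rho)d,$$ with $v(t)=u(t-\tau(t))$ (and $u=0$ before time $0$), for all delays $\tau:[0,\infty)\to[0,\bar\tau]$ with $|\dot\tau|\le r$ and all locally absolutely continuous trajectories $\rho(t)\in\mathcal P$ with rate $\dot\rho(t)\in\mathcal V$. Put $w=\mathcal S(u)=u-u(\cdot-\tau(\cdot))$. Let $n_u$ be the dimension of $u$, and for $k=1,\dots,N$ let the filters $\Psi_k$ have the joint realization $$\dot x_\psi=A_\psi x_\psi+B_{\psi1}u+B_{\psi2}w,\ x_\psi(0)=0,\qquad z_{1,k}=C_{\psi,k}x_\psi+D_{\psi1,k}u+D_{\psi2,k}w,\qquad z_{2,k}=w .$$ Let $C_\psi,D_{\psi1},D_{\psi2}$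 be the matrices $C_{\psi,k},D_{\psi1,k},D_{\psi2,k}$ stacked over $k$, and let $$A_{aug}=\begin{bmatrix}A_p&0\\0&A_\psi\end{bmatrix},\ B_{aug0}=\begin{bmatrix}-B_{p2}\\B_{\psi2}\end{bmatrix},\ B_{aug1}=\begin{bmatrix}B_{p1}\\0\end{bmatrix},\ B_{aug2}=\begin{bmatrix}B_{p2}\\B_{\psi1}\end{bmatrix},\ C_{aug0}=[\,0\ \ C_\psi\,],\ C_{aug1}=[\,C_{p1}\ \ 0\,],\ C_{aug2}=[\,C_{p2}\ \ 0\,],$$ $n_{aug}=\dim x_p+\dim x_\psi$, and $\mathrm{He}\,A=A+A^T$. **Synthesis conditions.** For functions $R,S$ with values in the symmetric $n_{aug}\times n_{aug}$ matrices, continuously differentiable near $\mathcal P$, continuous functions $X_k$ ($1\le k\le N$) and $X$ on $\mathcal P$ with values in $\mathbb R^{n_u\times n_u}$, and $\gamma>0$, they require for every $\rho\in\mathcal P$ that $R(\rho)$, $S(\rho)$ and all $X_k(\rho)$ be symmetric positive definite and that, for every vertex $\nu$ of $\mathcal V$ (chosen separately in the first two inequalities), with $\Lambda=\mathrm{diag}(X_1,\dots,X_N)$,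 $$\mathcal N_R^T\begin{bmatrix}\mathrm{He}(A_{aug}R)-\sum_k\nu_k\frac{\partial R}{\partial\rho_k}&\star&\star&\star&\star\\ X^TB_{aug0}^T&-\sum_{k}(X+X^T-X_k)&\star&\star&\star\\ B_{aug1}^T&0&-\gamma I&\star&\star\\ C_{aug0}R&D_{\psi2}X&0&-\Lambda&\star\\ C_{aug1}R&-D_{p12}X&D_{p11}&0&-\gamma I\end{bmatrix}\mathcal N_R<0,$$ $$\mathcal N_S^T\begin{bmatrix}\mathrm{He}(SA_{aug})+\sum_k\nu_k\frac{\partial S}{\partial\rho_k}&\star&\star&\star\\ C_{aug0}&-\Lambda&\star&\star\\ C_{aug1}&0&-\gamma I&\star\\ B_{aug1}^TS&0&D_{p11}^T&-\gamma I\end{bmatrix}\mathcal N_S<0,\qquad \begin{bmatrix}R&I\\I&S\end{bmatrix}>0,$$ where the columns of $\mathcal N_R$ and $\mathcal N_S$ are bases of the kernels of $[\,B_{aug2}^T\ 0\ 0\ D_{\psi1}^T\ D_{p12}^T\,]$ and $[\,C_{aug2}\ 0\ 0\ D_{p21}\,]$. **Theorem.** (i) The set of all $(R,S,X_1,\dots,X_N,X,\gamma)$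 that satisfy the synthesis conditions, which involve no controller gains, is convex. (ii) Let $(R,S,X_1,\dots,X_N,X,\gamma)$ satisfy the synthesis conditions, and suppose that for each $k$, each admissible delay and each admissible trajectory $\rho$, the delay operator $\mathcal S$ satisfies the hard IQC with factorization $(\Psi_k,\mathrm{diag}(X_k^{-1},-X_k^{-1}))$, that is, $$\int_0^T\bigl(z_{1,k}^TX_k(\rho(t))^{-1}z_{1,k}-z_{2,k}^TX_k(\rho(t))^{-1}z_{2,k}\bigr)\,dt\ge0\quad\text{for all }T\ge0\text{ and all }u\in L_{2e+}\text{ with }w=\mathcal S(u)\in L_{2e+}.$$ Then there is an exact-memory LPV output-feedback controller of order $n_{aug}$ with internal delay loop, $$\dot x_c=A_c(\rho,\dot\rho)x_c+B_{c1}(\rho)y+B_{c2}(\rho)\mathcal S(u),\qquad u=C_c(\rho)x_c+D_{c1}(\rho)y+D_{c2}(\rho)\mathcal S(u),$$ with gains continuous on $\mathcal P$ (on $\mathcal P\times\mathcal V$ for $A_c$), such that for all admissible delays and trajectories the loop equation is solvable for the current control value ($I-D_{c2}(\rho(t))$ is invertible whenever $\tau(t)>0$), and the closed loop with state $(x_p,x_\psi,x_c)$,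 $x_\psi(0)=0$, is asymptotically stable for $d=0$ (Lyapunov stable, uniformly in $\tau$ and $\rho$, with all solutions converging to $0$) and has $L_2$ gain from $d$ to $e$ less than $\gamma$: there is $\gamma'<\gamma$, independent of $\tau$ and $\rho$, with $\int_0^T|e|^2dt\le\gamma'^2\int_0^T|d|^2dt$ for all $T\ge0$ and $d\in L_{2e+}$, from zero initial state. Here solutions are those with $u,\mathcal S(u)\in L_{2e+}$. -/

import Mathlib

open MeasureTheory Set Filter Topology
open scoped Matrix

namespace DelayLPV

noncomputable section

/-! ## Signals -/

/-- `v` is a signal of the extended space `L_{2e+}`: measurable on `[0, ∞)` and square integrable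
on every `[0, T]`. Only the values at times `t ≥ 0` matter. -/
def L2e {n : ℕ} (v : ℝ → Fin n → ℝ) : Prop :=
  AEStronglyMeasurable v (volume.restrict (Ici 0)) ∧
    ∀ T : ℝ, 0 ≤ T → IntervalIntegrable (fun t => v t ⬝ᵥ v t) volume 0 T

/-- `x` is locally absolutely continuous on `[0, ∞)` and `ẋ = f` almost everywhere there. -/
def HasRate {ι : Type} [Fintype ι] (x f : ℝ → ι → ℝ) : Prop :=
  ∀ t : ℝ, 0 ≤ t → IntervalIntegrable f volume 0 t ∧ x t = x 0 + ∫ σ in (0 : ℝ)..t, f σ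

/-- The delay class: `τ : [0, ∞) → [0, τmax]` with `|τ̇| ≤ r`, that is, `τ` is `r`-Lipschitz. -/
def AdmissibleDelay (τmax r : ℝ) (τ : ℝ → ℝ) : Prop :=
  (∀ t, 0 ≤ t → 0 ≤ τ t ∧ τ t ≤ τmax) ∧
    ∀ t₁ t₂, 0 ≤ t₁ → 0 ≤ t₂ → |τ t₁ - τ t₂| ≤ r * |t₁ - t₂|

/-- The delayed signal `u(t - τ(t))`, where `u` vanishes before time `0`. -/
def delayed {n : ℕ} (τ : ℝ → ℝ) (u : ℝ → Fin n → ℝ) (t : ℝ) : Fin n → ℝ :=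
  if 0 ≤ t - τ t then u (t - τ t) else 0

/-- The operator `𝒮(u) = u - u(t - τ(t))`. -/
def delayDiff {n : ℕ} (τ : ℝ → ℝ) (u : ℝ → Fin n → ℝ) (t : ℝ) : Fin n → ℝ :=
  u t - delayed τ u t

/-- Scheduling trajectories: `ρ(t) ∈ 𝒫`, with rate `ρ'(t) = ρ̇(t)` in the box `[νlo, νhi]`. -/
def AdmissibleTraj {s : ℕ} (P : Set (Fin s → ℝ)) (νlo νhi : Fin s → ℝ)
    (ρ ρ' : ℝ → Fin s → ℝ) : Prop :=
  (∀ t, 0 ≤ t → ρ t ∈ P) ∧ (∀ t, 0 ≤ t → ρ' t ∈ Icc νlo νhi) ∧ HasRate ρ ρ'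

/-! ## Plant, filters of the multipliers, controller -/

/-- State-space matrices of the LPV plant
`ẋp = Ap xp + Bp1 d + Bp2 v`, `e = Cp1 xp + Dp11 d + Dp12 v`, `y = Cp2 xp + Dp21 d`,
with delayed input `v(t) = u(t - τ(t))`, as functions of the scheduling parameter. -/
structure Plant (s np nu nd ne ny : ℕ) where
  Ap : (Fin s → ℝ) → Matrix (Fin np) (Fin np) ℝ
  Bp1 : (Fin s → ℝ) → Matrix (Fin np) (Fin nd) ℝ
  Bp2 : (Fin s → ℝ) → Matrix (Fin np) (Fin nu) ℝ
  Cp1 : (Fin s → ℝ) → Matrix (Fin ne) (Fin np) ℝ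
  Dp11 : (Fin s → ℝ) → Matrix (Fin ne) (Fin nd) ℝ
  Dp12 : (Fin s → ℝ) → Matrix (Fin ne) (Fin nu) ℝ
  Cp2 : (Fin s → ℝ) → Matrix (Fin ny) (Fin np) ℝ
  Dp21 : (Fin s → ℝ) → Matrix (Fin ny) (Fin nd) ℝ

/-- All plant matrices are continuous on the parameter set. -/
def Plant.IsContinuousOn {s np nu nd ne ny : ℕ} (G : Plant s np nu nd ne ny)
    (P : Set (Fin s → ℝ)) : Prop :=
  ContinuousOn G.Ap P ∧ ContinuousOn G.Bp1 P ∧ ContinuousOn G.Bp2 P ∧ ContinuousOn G.Cp1 P ∧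
    ContinuousOn G.Dp11 P ∧ ContinuousOn G.Dp12 P ∧ ContinuousOn G.Cp2 P ∧ ContinuousOn G.Dp21 P

/-- Joint realization of the filters `Ψ_k = [Ψ_{11,k} Ψ_{12,k}; 0 I]`, `k < N`, driven by `(u, w)`:
`ẋψ = Aψ xψ + Bψ1 u + Bψ2 w`, `z_{1,k} = Cψ_k xψ + Dψ1_k u + Dψ2_k w`, `z_{2,k} = w`. -/
structure IQCFilter (N nψ nu : ℕ) where
  Aψ : Matrix (Fin nψ) (Fin nψ) ℝ
  Bψ1 : Matrix (Fin nψ) (Fin nu) ℝ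
  Bψ2 : Matrix (Fin nψ) (Fin nu) ℝ
  Cψ : Fin N → Matrix (Fin nu) (Fin nψ) ℝ
  Dψ1 : Fin N → Matrix (Fin nu) (Fin nu) ℝ
  Dψ2 : Fin N → Matrix (Fin nu) (Fin nu) ℝ

namespace IQCFilter

variable {N nψ nu : ℕ}

/-- `xψ` is the response of the common filter state to `(u, w)` from zero initial state. -/
def IsResponse (F : IQCFilter N nψ nu) (u w : ℝ → Fin nu → ℝ) (xψ : ℝ → Fin nψ → ℝ) : Prop :=
  xψ 0 = 0 ∧ HasRate xψ (fun t => F.Aψ *ᵥ xψ t + F.Bψ1 *ᵥ u t + F.Bψ2 *ᵥ w t)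

/-- The output `z_{1,k}`. -/
def z1 (F : IQCFilter N nψ nu) (k : Fin N) (u w : ℝ → Fin nu → ℝ) (xψ : ℝ → Fin nψ → ℝ)
    (t : ℝ) : Fin nu → ℝ :=
  F.Cψ k *ᵥ xψ t + F.Dψ1 k *ᵥ u t + F.Dψ2 k *ᵥ w t

/-- The operator `w = 𝒮(u)` for the delay `τ` satisfies the hard IQC with factorization
`(Ψ_k, diag(W, -W))`: `∫₀ᵀ (z_{1,k}ᵀ W z_{1,k} - z_{2,k}ᵀ W z_{2,k}) dt ≥ 0` for all `T ≥ 0`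
and all `u ∈ L_{2e+}` with `w ∈ L_{2e+}`. The weight may vary with time. -/
def SatisfiesHardIQC (F : IQCFilter N nψ nu) (k : Fin N)
    (W : ℝ → Matrix (Fin nu) (Fin nu) ℝ) (τ : ℝ → ℝ) : Prop :=
  ∀ u : ℝ → Fin nu → ℝ, L2e u → L2e (delayDiff τ u) →
    ∀ xψ : ℝ → Fin nψ → ℝ, F.IsResponse u (delayDiff τ u) xψ →
      ∀ T : ℝ, 0 ≤ T →
        0 ≤ ∫ t in (0 : ℝ)..T,
          (F.z1 k u (delayDiff τ u) xψ t ⬝ᵥ (W t *ᵥ F.z1 k u (delayDiff τ u) xψ t)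
            - delayDiff τ u t ⬝ᵥ (W t *ᵥ delayDiff τ u t))

/-- `C_{aug0}`: the rows `[0 Cψ_k]` stacked over `k`. -/
def Caug0 (F : IQCFilter N nψ nu) (np : ℕ) :
    Matrix (Fin nu × Fin N) (Fin np ⊕ Fin nψ) ℝ :=
  Matrix.fromCols 0 (Matrix.of fun ik j => F.Cψ ik.2 ik.1 j)

/-- `Dψ1`: the matrices `Dψ1_k` stacked over `k`. -/
def Dψ1s (F : IQCFilter N nψ nu) : Matrix (Fin nu × Fin N) (Fin nu) ℝ :=
  Matrix.of fun ik j => F.Dψ1 ik.2 ik.1 j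

/-- `Dψ2`: the matrices `Dψ2_k` stacked over `k`. -/
def Dψ2s (F : IQCFilter N nψ nu) : Matrix (Fin nu × Fin N) (Fin nu) ℝ :=
  Matrix.of fun ik j => F.Dψ2 ik.2 ik.1 j

end IQCFilter

/-- Gains of an exact-memory LPV output-feedback controller with state index type `κ`:
`ẋc = Ac xc + Bc1 y + Bc2 𝒮(u)`, `u = Cc xc + Dc1 y + Dc2 𝒮(u)`.
The matrix `Ac` may depend on `(ρ, ρ̇)`, the other gains depend on `ρ`. -/
structure Controller (s nu ny : ℕ) (κ : Type) where
  Ac : (Fin s → ℝ) → (Fin s → ℝ) → Matrix κ κ ℝ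
  Bc1 : (Fin s → ℝ) → Matrix κ (Fin ny) ℝ
  Bc2 : (Fin s → ℝ) → Matrix κ (Fin nu) ℝ
  Cc : (Fin s → ℝ) → Matrix (Fin nu) κ ℝ
  Dc1 : (Fin s → ℝ) → Matrix (Fin nu) (Fin ny) ℝ
  Dc2 : (Fin s → ℝ) → Matrix (Fin nu) (Fin nu) ℝ

/-- All gains are continuous on the parameter set (and on the rate box, for `Ac`). -/
def Controller.IsContinuousOn {s nu ny : ℕ} {κ : Type} (K : Controller s nu ny κ)
    (P V : Set (Fin s → ℝ)) : Prop :=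
  ContinuousOn (fun p : (Fin s → ℝ) × (Fin s → ℝ) => K.Ac p.1 p.2) (P ×ˢ V) ∧
    ContinuousOn K.Bc1 P ∧ ContinuousOn K.Bc2 P ∧ ContinuousOn K.Cc P ∧
    ContinuousOn K.Dc1 P ∧ ContinuousOn K.Dc2 P

/-! ## Closed loop -/

/-- The signals `(xp, xψ, xc, u, y, e)` solve the interconnection of the plant, the controller with
its internal delay loop, and the filters, for disturbance `d`, delay `τ` and scheduling `ρ`. -/
structure ClosedLoop {s np nu nd ne ny N nψ : ℕ} {κ : Type} [Fintype κ]
    (G : Plant s np nu nd ne ny) (F : IQCFilter N nψ nu) (K : Controller s nu ny κ)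
    (τ : ℝ → ℝ) (ρ ρ' : ℝ → Fin s → ℝ) (d : ℝ → Fin nd → ℝ)
    (xp : ℝ → Fin np → ℝ) (xψ : ℝ → Fin nψ → ℝ) (xc : ℝ → κ → ℝ)
    (u : ℝ → Fin nu → ℝ) (y : ℝ → Fin ny → ℝ) (e : ℝ → Fin ne → ℝ) : Prop where
  d_mem : L2e d
  u_mem : L2e u
  w_mem : L2e (delayDiff τ u)
  plant_state : HasRate xp (fun t =>
    G.Ap (ρ t) *ᵥ xp t + G.Bp1 (ρ t) *ᵥ d t + G.Bp2 (ρ t) *ᵥ delayed τ u t)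
  plant_e : ∀ᵐ t ∂volume.restrict (Ici (0 : ℝ)),
    e t = G.Cp1 (ρ t) *ᵥ xp t + G.Dp11 (ρ t) *ᵥ d t + G.Dp12 (ρ t) *ᵥ delayed τ u t
  plant_y : ∀ᵐ t ∂volume.restrict (Ici (0 : ℝ)),
    y t = G.Cp2 (ρ t) *ᵥ xp t + G.Dp21 (ρ t) *ᵥ d t
  filter_state : F.IsResponse u (delayDiff τ u) xψ
  ctrl_state : HasRate xc (fun t =>
    K.Ac (ρ t) (ρ' t) *ᵥ xc t + K.Bc1 (ρ t) *ᵥ y t + K.Bc2 (ρ t) *ᵥ delayDiff τ u t)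
  ctrl_u : ∀ᵐ t ∂volume.restrict (Ici (0 : ℝ)),
    u t = K.Cc (ρ t) *ᵥ xc t + K.Dc1 (ρ t) *ᵥ y t + K.Dc2 (ρ t) *ᵥ delayDiff τ u t

/-- Asymptotic stability for all admissible delays and scheduling trajectories, with `d = 0`:
the state `x_cl = (xp, xψ, xc)` (where `xψ(0) = 0`) is Lyapunov stable, uniformly in the delay and
the scheduling trajectory, and every solution converges to `0`. -/
def AsymptoticallyStable {s np nu nd ne ny N nψ : ℕ} {κ : Type} [Fintype κ]
    (G : Plant s np nu nd ne ny) (F : IQCFilter N nψ nu) (K : Controller s nu ny κ)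
    (P : Set (Fin s → ℝ)) (νlo νhi : Fin s → ℝ) (τmax r : ℝ) : Prop :=
  (∀ ε : ℝ, 0 < ε → ∃ δ : ℝ, 0 < δ ∧
    ∀ τ, AdmissibleDelay τmax r τ → ∀ ρ ρ', AdmissibleTraj P νlo νhi ρ ρ' →
      ∀ xp xψ xc u y e, ClosedLoop G F K τ ρ ρ' (fun _ => 0) xp xψ xc u y e →
        ‖xp 0‖ < δ → ‖xc 0‖ < δ →
          ∀ t : ℝ, 0 ≤ t → ‖xp t‖ < ε ∧ ‖xψ t‖ < ε ∧ ‖xc t‖ < ε) ∧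
  (∀ τ, AdmissibleDelay τmax r τ → ∀ ρ ρ', AdmissibleTraj P νlo νhi ρ ρ' →
    ∀ xp xψ xc u y e, ClosedLoop G F K τ ρ ρ' (fun _ => 0) xp xψ xc u y e →
      Tendsto xp atTop (𝓝 0) ∧ Tendsto xψ atTop (𝓝 0) ∧ Tendsto xc atTop (𝓝 0))

/-- The `L₂` gain from `d` to `e` is less than `γ` for all admissible delays and scheduling
trajectories: for some `γ' < γ`, from zero initial state `‖e_T‖₂ ≤ γ' ‖d_T‖₂` for all `T ≥ 0`. -/
def L2GainLT {s np nu nd ne ny N nψ : ℕ} {κ : Type} [Fintype κ]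
    (G : Plant s np nu nd ne ny) (F : IQCFilter N nψ nu) (K : Controller s nu ny κ)
    (P : Set (Fin s → ℝ)) (νlo νhi : Fin s → ℝ) (τmax r γ : ℝ) : Prop :=
  ∃ γ' : ℝ, 0 ≤ γ' ∧ γ' < γ ∧
    ∀ τ, AdmissibleDelay τmax r τ → ∀ ρ ρ', AdmissibleTraj P νlo νhi ρ ρ' →
      ∀ d xp xψ xc u y e, ClosedLoop G F K τ ρ ρ' d xp xψ xc u y e →
        xp 0 = 0 → xc 0 = 0 →
          L2e e ∧ ∀ T : ℝ, 0 ≤ T →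
            ∫ t in (0 : ℝ)..T, e t ⬝ᵥ e t ≤ γ' ^ 2 * ∫ t in (0 : ℝ)..T, d t ⬝ᵥ d t

/-- Solvability of the loop equation `(I - Dc2) u(t) = Cc xc + Dc1 y - Dc2 u(t - τ(t))` for the
current control value, at all times with a nonzero delay (for `τ(t) = 0` it reads
`u(t) = Cc xc + Dc1 y`). -/
def LoopSolvable {s nu ny : ℕ} {κ : Type} (K : Controller s nu ny κ)
    (P : Set (Fin s → ℝ)) (νlo νhi : Fin s → ℝ) (τmax r : ℝ) : Prop :=
  ∀ τ, AdmissibleDelay τmax r τ → ∀ ρ ρ', AdmissibleTraj P νlo νhi ρ ρ' →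
    ∀ t : ℝ, 0 ≤ t → 0 < τ t → IsUnit (1 - K.Dc2 (ρ t))

/-! ## Synthesis conditions -/

/-- The symmetric block matrix `[A ⋆; B D]`. -/
def symBlock {m n : Type} (A : Matrix m m ℝ) (B : Matrix n m ℝ) (D : Matrix n n ℝ) :
    Matrix (m ⊕ n) (m ⊕ n) ℝ :=
  Matrix.fromBlocks A Bᵀ B D

/-- `He A = A + Aᵀ`. -/
def He {m : Type} (A : Matrix m m ℝ) : Matrix m m ℝ := A + Aᵀ

/-- `𝒩ᵀ M 𝒩 < 0` for `𝒩 = Ker L`, a matrix whose columns are a basis of the kernel of `L`: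
the quadratic form of `M` is negative definite on that kernel. -/
def NegDefOnKer {m n : Type} [Fintype n] (M : Matrix n n ℝ) (L : Matrix m n ℝ) : Prop :=
  ∀ ξ : n → ℝ, L *ᵥ ξ = 0 → ξ ≠ 0 → ξ ⬝ᵥ (M *ᵥ ξ) < 0

/-- `M` is continuously differentiable on a neighbourhood of the set `P`. -/
def IsC1Near {s : ℕ} {m n : Type} (P : Set (Fin s → ℝ)) (M : (Fin s → ℝ) → Matrix m n ℝ) :
    Prop :=
  ∃ U : Set (Fin s → ℝ), IsOpen U ∧ P ⊆ U ∧
    ∀ i j, ContDiffOn ℝ 1 (fun ρ => M ρ i j) U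

/-- `∂M/∂ρ_k`. -/
def partialDeriv {s : ℕ} {m n : Type} (M : (Fin s → ℝ) → Matrix m n ℝ) (k : Fin s)
    (ρ : Fin s → ℝ) : Matrix m n ℝ :=
  Matrix.of fun i j => fderiv ℝ (fun ρ => M ρ i j) ρ (Pi.single k 1)

/-- `∑_k ν_k ∂M/∂ρ_k`. -/
def rateTerm {s : ℕ} {m n : Type} (M : (Fin s → ℝ) → Matrix m n ℝ) (ν ρ : Fin s → ℝ) :
    Matrix m n ℝ :=
  ∑ k, ν k • partialDeriv M k ρ

/-- The vertices of the rate box `[νlo, νhi]`. -/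
def IsVertex {s : ℕ} (νlo νhi ν : Fin s → ℝ) : Prop :=
  ∀ k, ν k = νlo k ∨ ν k = νhi k

section Augmented

variable {s np nu nd ne ny N nψ : ℕ} (G : Plant s np nu nd ne ny) (F : IQCFilter N nψ nu)

def Aaug (ρ : Fin s → ℝ) : Matrix (Fin np ⊕ Fin nψ) (Fin np ⊕ Fin nψ) ℝ :=
  Matrix.fromBlocks (G.Ap ρ) 0 0 F.Aψ

def Baug0 (ρ : Fin s → ℝ) : Matrix (Fin np ⊕ Fin nψ) (Fin nu) ℝ :=
  Matrix.fromRows (-G.Bp2 ρ) F.Bψ2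

def Baug1 (nψ : ℕ) (ρ : Fin s → ℝ) : Matrix (Fin np ⊕ Fin nψ) (Fin nd) ℝ :=
  Matrix.fromRows (G.Bp1 ρ) 0

def Baug2 (ρ : Fin s → ℝ) : Matrix (Fin np ⊕ Fin nψ) (Fin nu) ℝ :=
  Matrix.fromRows (G.Bp2 ρ) F.Bψ1

def Caug1 (nψ : ℕ) (ρ : Fin s → ℝ) : Matrix (Fin ne) (Fin np ⊕ Fin nψ) ℝ :=
  Matrix.fromCols (G.Cp1 ρ) 0

def Caug2 (nψ : ℕ) (ρ : Fin s → ℝ) : Matrix (Fin ny) (Fin np ⊕ Fin nψ) ℝ :=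
  Matrix.fromCols (G.Cp2 ρ) 0

/-- The 5 × 5 block matrix of the first projected LMI, at parameter `ρ` and rate `ν`; block order
`(x_aug, w, d, z₁, e)`. -/
def lmiR (R : (Fin s → ℝ) → Matrix (Fin np ⊕ Fin nψ) (Fin np ⊕ Fin nψ) ℝ)
    (Xs : Fin N → (Fin s → ℝ) → Matrix (Fin nu) (Fin nu) ℝ)
    (X : (Fin s → ℝ) → Matrix (Fin nu) (Fin nu) ℝ) (γ : ℝ) (ν ρ : Fin s → ℝ) :
    Matrix ((Fin np ⊕ Fin nψ) ⊕ Fin nu ⊕ Fin nd ⊕ (Fin nu × Fin N) ⊕ Fin ne)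
      ((Fin np ⊕ Fin nψ) ⊕ Fin nu ⊕ Fin nd ⊕ (Fin nu × Fin N) ⊕ Fin ne) ℝ :=
  symBlock (He (Aaug G F ρ * R ρ) - rateTerm R ν ρ)
    (Matrix.fromRows ((X ρ)ᵀ * (Baug0 G F ρ)ᵀ)
      (Matrix.fromRows (Baug1 G nψ ρ)ᵀ
        (Matrix.fromRows (F.Caug0 np * R ρ) (Caug1 G nψ ρ * R ρ))))
    (symBlock (-∑ k, (X ρ + (X ρ)ᵀ - Xs k ρ))
      (Matrix.fromRows 0 (Matrix.fromRows (F.Dψ2s * X ρ) (-G.Dp12 ρ * X ρ)))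
      (symBlock (-γ • 1)
        (Matrix.fromRows 0 (G.Dp11 ρ))
        (symBlock (-Matrix.blockDiagonal fun k => Xs k ρ) 0 (-γ • 1))))

/-- `[Baug2ᵀ 0 0 Dψ1ᵀ Dp12ᵀ]`, whose kernel is `𝒩_R`. -/
def kerRowR (ρ : Fin s → ℝ) :
    Matrix (Fin nu) ((Fin np ⊕ Fin nψ) ⊕ Fin nu ⊕ Fin nd ⊕ (Fin nu × Fin N) ⊕ Fin ne) ℝ :=
  Matrix.fromCols (Baug2 G F ρ)ᵀ
    (Matrix.fromCols 0 (Matrix.fromCols 0 (Matrix.fromCols F.Dψ1sᵀ (G.Dp12 ρ)ᵀ)))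

/-- The 4 × 4 block matrix of the second projected LMI, at parameter `ρ` and rate `ν`; block order
`(x_aug, z₁, e, d)`. -/
def lmiS (S : (Fin s → ℝ) → Matrix (Fin np ⊕ Fin nψ) (Fin np ⊕ Fin nψ) ℝ)
    (Xs : Fin N → (Fin s → ℝ) → Matrix (Fin nu) (Fin nu) ℝ) (γ : ℝ) (ν ρ : Fin s → ℝ) :
    Matrix ((Fin np ⊕ Fin nψ) ⊕ (Fin nu × Fin N) ⊕ Fin ne ⊕ Fin nd)
      ((Fin np ⊕ Fin nψ) ⊕ (Fin nu × Fin N) ⊕ Fin ne ⊕ Fin nd) ℝ :=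
  symBlock (He (S ρ * Aaug G F ρ) + rateTerm S ν ρ)
    (Matrix.fromRows (F.Caug0 np)
      (Matrix.fromRows (Caug1 G nψ ρ) ((Baug1 G nψ ρ)ᵀ * S ρ)))
    (symBlock (-Matrix.blockDiagonal fun k => Xs k ρ)
      0
      (symBlock (-γ • 1) (G.Dp11 ρ)ᵀ (-γ • 1)))

/-- `[Caug2 0 0 Dp21]`, whose kernel is `𝒩_S`. -/
def kerRowS (N nψ : ℕ) (ρ : Fin s → ℝ) :
    Matrix (Fin ny) ((Fin np ⊕ Fin nψ) ⊕ (Fin nu × Fin N) ⊕ Fin ne ⊕ Fin nd) ℝ :=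
  Matrix.fromCols (Caug2 G nψ ρ) (Matrix.fromCols 0 (Matrix.fromCols 0 (G.Dp21 ρ)))

/-- The decision variables `(R, S, (X_k), X, γ)`. -/
abbrev DecisionVars (s np nψ nu N : ℕ) : Type :=
  ((Fin s → ℝ) → Matrix (Fin np ⊕ Fin nψ) (Fin np ⊕ Fin nψ) ℝ) ×
  ((Fin s → ℝ) → Matrix (Fin np ⊕ Fin nψ) (Fin np ⊕ Fin nψ) ℝ) ×
  (Fin N → (Fin s → ℝ) → Matrix (Fin nu) (Fin nu) ℝ) ×
  ((Fin s → ℝ) → Matrix (Fin nu) (Fin nu) ℝ) × ℝ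

/-- The set of decision variables that satisfy the synthesis conditions on the parameter set `P`,
at all vertices of the rate box. -/
def feasibleSet (P : Set (Fin s → ℝ)) (νlo νhi : Fin s → ℝ) :
    Set (DecisionVars s np nψ nu N) :=
  {v | match v with
    | (R, S, Xs, X, γ) =>
      IsC1Near P R ∧ IsC1Near P S ∧ (∀ k, ContinuousOn (Xs k) P) ∧ ContinuousOn X P ∧ 0 < γ ∧
      ∀ ρ ∈ P,
        (R ρ).PosDef ∧ (S ρ).PosDef ∧ (∀ k, (Xs k ρ).PosDef) ∧
        (∀ ν, IsVertex νlo νhi ν →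
          NegDefOnKer (lmiR G F R Xs X γ ν ρ) (kerRowR G F ρ)) ∧
        (∀ ν, IsVertex νlo νhi ν →
          NegDefOnKer (lmiS G F S Xs γ ν ρ) (kerRowS G N nψ ρ)) ∧
        (Matrix.fromBlocks (R ρ) 1 1 (S ρ)).PosDef}

end Augmented

end

end DelayLPV

open DelayLPV

/-!
The two projected synthesis inequalities are what remains of one closed-loop dissipation inequality
when the controller gains are eliminated. The proof recovers the gains and integrates the
dissipation inequality along trajectories.

*The closed-loop form.* With the storage function
`V = xᵀR⁻¹x + (x - xc)ᵀ(S - R⁻¹)(x - xc)`, where `x = (xp, xψ)`, and the states `ξ = R⁻¹xc`,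
`ε = x - xc`, the derivative of `V` plus the supply rate
`∑ₖ (z₁ₖᵀXₖ⁻¹z₁ₖ - wᵀXₖ⁻¹w) + γ⁻¹|e|² - γ|d|²` is a quadratic form `loopForm` in `(ξ, ε, w, d, z, e)`
that is affine in transformed gains `(Ĉ, B̂, D, Â)` (`storageRate_add_supply`); here `z` and `e`
enter through the multipliers `Xₖ⁻¹z₁ₖ` and `γ⁻¹e`. The original gains are recovered from the
transformed ones, because `S - R⁻¹` is positive definite; the rate of `R` enters only `Ac`.

*Existence of gains.* At `ε = 0` the form is a state-feedback problem and at `ξ = 0` an estimation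
problem in which `w` is measured. The two projected inequalities say that these are solvable
separately: `X` is invertible, and substituting `w = X w'` together with
`XᵀXₖ⁻¹X ≥ X + Xᵀ - Xₖ` removes `X` (`negDefOnKer_dataR`). The projection lemma
(`exists_projection`), applied three times, gives first `D`, then `Ĉ` and `B̂`; it works for finitely
many rates at once since the rate enters only the state blocks. A Schur
complement choice of `Â` makes the cross terms vanish (`exists_completion`). As the form is affine
in the rate, the vertices suffice (`exists_gains_at`). For fixed parameter the admissible gains form
a convex set and remain admissible nearby, so a partition of unity makes them continuous
(`exists_continuous_gains`).

*Conclusions.* By compactness the form is bounded above by `-c` times the squared norm of all signals.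
Integrating along a trajectory and discarding the nonnegative constraint integrals gives
`dissipation`, from which the gain bound and Lyapunov stability follow. Without disturbance the
squared norm is integrable and dominates `V` and its derivative, so `V` tends to zero.

*The loop equation.* If `Dc2 v = v` at a time with positive delay, then the form at
`ξ = ε = d = e = 0`, `w = v`, yields `∑ₖ (Dₖv)ᵀXₖ⁻¹(Dₖv) < ∑ₖ vᵀXₖ⁻¹v` for `Dₖ = Dψ1ₖ + Dψ2ₖ`, unless
`v = 0`. The input that switches from `0` to `v` at that time has `𝒮(u) = u` for a short while, with
filter state near zero, and the hard constraints give the opposite inequality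
(`IsDesign.form_inv_le_of_hardIQC`).

*Convexity.* Every synthesis condition is affine in the decision variables (`convex_feasibleSet`).
-/

namespace DelayLPV

/-! ### Homogeneous forms depending on parameters -/

section Forms

variable {Y E : Type*} [TopologicalSpace Y] [NormedAddCommGroup E] [NormedSpace ℝ E]
  [FiniteDimensional ℝ E]

/-- By compactness and homogeneity, negative definiteness is uniform. -/
theorem exists_forall_form_le_neg [CompactSpace Y] (q : Y → E → ℝ)
    (hq : Continuous fun p : Y × E => q p.1 p.2)
    (hom : ∀ y (c : ℝ) v, q y (c • v) = c ^ 2 * q y v) (neg : ∀ y v, v ≠ 0 → q y v < 0) :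
    ∃ c : ℝ, 0 < c ∧ ∀ y v, q y v ≤ -c * ‖v‖ ^ 2 := by
  have : ProperSpace E := FiniteDimensional.proper ℝ E
  have hK : IsCompact ((univ : Set Y) ×ˢ Metric.sphere (0 : E) 1) :=
    isCompact_univ.prod (isCompact_sphere 0 1)
  obtain ⟨c, hc, hcK⟩ : ∃ c : ℝ, 0 < c ∧ ∀ y, ∀ v ∈ Metric.sphere (0 : E) 1, q y v ≤ -c := by
    rcases ((univ : Set Y) ×ˢ Metric.sphere (0 : E) 1).eq_empty_or_nonempty with h | h
    · refine ⟨1, one_pos, fun y v hv => ?_⟩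
      have : (y, v) ∈ ((univ : Set Y) ×ˢ Metric.sphere (0 : E) 1) := ⟨trivial, hv⟩
      simp [h] at this
    · obtain ⟨p, hp, hmax⟩ := hK.exists_isMaxOn h hq.continuousOn
      have hp0 : p.2 ≠ 0 := by
        intro h0
        have := hp.2
        simp [h0] at this
      refine ⟨-q p.1 p.2, by linarith [neg p.1 p.2 hp0], fun y v hv => ?_⟩
      have : q y v ≤ q p.1 p.2 := hmax (show (y, v) ∈ _ from ⟨trivial, hv⟩)
      linarith
  refine ⟨c, hc, fun y v => ?_⟩
  rcases eq_or_ne v 0 with rfl | hv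
  · have := hom y 0 0
    simp at this
    simp [this]
  · have hn : 0 < ‖v‖ := norm_pos_iff.2 hv
    have h1 := hcK y (‖v‖⁻¹ • v) (by simp [norm_smul, hn.ne'])
    have h2 := hom y ‖v‖ (‖v‖⁻¹ • v)
    rw [smul_smul, mul_inv_cancel₀ hn.ne', one_smul] at h2
    rw [h2]
    nlinarith [sq_nonneg ‖v‖]

theorem exists_forall_abs_form_le [CompactSpace Y] (q : Y → E → ℝ)
    (hq : Continuous fun p : Y × E => q p.1 p.2)
    (hom : ∀ y (c : ℝ) v, q y (c • v) = c ^ 2 * q y v) :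
    ∃ C : ℝ, 0 < C ∧ ∀ y v, |q y v| ≤ C * ‖v‖ ^ 2 := by
  have : ProperSpace E := FiniteDimensional.proper ℝ E
  have hK : IsCompact ((univ : Set Y) ×ˢ Metric.sphere (0 : E) 1) :=
    isCompact_univ.prod (isCompact_sphere 0 1)
  obtain ⟨C, hC⟩ := hK.exists_bound_of_continuousOn hq.continuousOn
  refine ⟨max C 1, by positivity, fun y v => ?_⟩
  rcases eq_or_ne v 0 with rfl | hv
  · have := hom y 0 0
    simp at this
    simp [this]
  · have hn : 0 < ‖v‖ := norm_pos_iff.2 hv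
    have h1 := hC (y, ‖v‖⁻¹ • v) ⟨trivial, by simp [norm_smul, hn.ne']⟩
    have h2 := hom y ‖v‖ (‖v‖⁻¹ • v)
    rw [smul_smul, mul_inv_cancel₀ hn.ne', one_smul] at h2
    rw [h2, abs_mul, abs_of_nonneg (sq_nonneg _), mul_comm]
    rw [Real.norm_eq_abs] at h1
    exact mul_le_mul_of_nonneg_right (h1.trans (le_max_left _ _)) (sq_nonneg _)

/-- Negative definiteness, uniformly over a compact set of rates, is an open condition. -/
theorem eventually_forall_form_neg {Z : Type*} [TopologicalSpace Z] [CompactSpace Z]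
    (q : Y → Z → E → ℝ) (hq : Continuous fun p : Y × Z × E => q p.1 p.2.1 p.2.2)
    (hom : ∀ y z (c : ℝ) v, q y z (c • v) = c ^ 2 * q y z v) (y₀ : Y)
    (neg : ∀ z v, v ≠ 0 → q y₀ z v < 0) :
    ∀ᶠ y in 𝓝 y₀, ∀ z v, v ≠ 0 → q y z v < 0 := by
  have : ProperSpace E := FiniteDimensional.proper ℝ E
  have hK : IsCompact ((univ : Set Z) ×ˢ Metric.sphere (0 : E) 1) :=
    isCompact_univ.prod (isCompact_sphere 0 1)
  have key : ∀ᶠ y in 𝓝 y₀, ∀ p ∈ (univ : Set Z) ×ˢ Metric.sphere (0 : E) 1,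
      q y p.1 p.2 < 0 := by
    refine hK.eventually_forall_of_forall_eventually fun p hp => ?_
    have hp0 : p.2 ≠ 0 := by
      intro h0
      have := hp.2
      simp [h0] at this
    exact hq.continuousAt.eventually (gt_mem_nhds (neg p.1 p.2 hp0))
  filter_upwards [key] with y hy z v hv
  have hn : 0 < ‖v‖ := norm_pos_iff.2 hv
  have h1 := hy (z, ‖v‖⁻¹ • v) ⟨trivial, by simp [norm_smul, hn.ne']⟩
  have h2 := hom y z ‖v‖ (‖v‖⁻¹ • v)
  rw [smul_smul, mul_inv_cancel₀ hn.ne', one_smul] at h2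
  rw [h2]
  exact mul_neg_of_pos_of_neg (by positivity) h1

end Forms

/-! ### The projection lemma -/

section Projection

variable {n p q : Type} [Fintype n] [Fintype q]

theorem dotProduct_self_nonneg_real (v : n → ℝ) : 0 ≤ v ⬝ᵥ v :=
  Finset.sum_nonneg fun i _ => mul_self_nonneg (v i)

/-- Finsler's lemma. -/
theorem exists_forall_lt_mul_of_negDefOnKer [Fintype p] (Ψ : Matrix n n ℝ) (P : Matrix p n ℝ)
    (h : NegDefOnKer Ψ P) :
    ∃ σ₀ : ℝ, ∀ σ, σ₀ ≤ σ → ∀ v : n → ℝ, v ≠ 0 → v ⬝ᵥ (Ψ *ᵥ v) < σ * (P *ᵥ v ⬝ᵥ P *ᵥ v) := by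
  let f : (n → ℝ) → ℝ := fun v => v ⬝ᵥ (Ψ *ᵥ v)
  let g : (n → ℝ) → ℝ := fun v => P *ᵥ v ⬝ᵥ P *ᵥ v
  have hf : Continuous f := by fun_prop
  have hg : Continuous g := by fun_prop
  have hg0 : ∀ v, 0 ≤ g v := fun v => dotProduct_self_nonneg_real _
  have hgP : ∀ v, g v = 0 → P *ᵥ v = 0 := fun v hv => dotProduct_self_eq_zero.1 hv
  -- on the part of the sphere where `f ≥ 0`, the form `g` is bounded away from `0`
  have hK : IsCompact (Metric.sphere (0 : n → ℝ) 1 ∩ {v | 0 ≤ f v}) :=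
    (isCompact_sphere 0 1).inter_right (isClosed_le continuous_const hf)
  obtain ⟨m, hm, hmK⟩ : ∃ m : ℝ, 0 < m ∧
      ∀ v ∈ Metric.sphere (0 : n → ℝ) 1 ∩ {v | 0 ≤ f v}, m ≤ g v := by
    rcases (Metric.sphere (0 : n → ℝ) 1 ∩ {v | 0 ≤ f v}).eq_empty_or_nonempty with h0 | h0
    · exact ⟨1, one_pos, by simp [h0]⟩
    · obtain ⟨w, hw, hmin⟩ := hK.exists_isMinOn h0 hg.continuousOn
      refine ⟨g w, lt_of_le_of_ne (hg0 w) fun h1 => ?_, fun v hv => hmin hv⟩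
      have hw0 : w ≠ 0 := by
        rintro rfl
        simpa using hw.1
      exact absurd (h w (hgP w h1.symm) hw0) (not_lt.2 hw.2)
  obtain ⟨M, hM⟩ := (isCompact_sphere (0 : n → ℝ) 1).exists_bound_of_continuousOn hf.continuousOn
  refine ⟨(|M| + 1) / m, fun σ hσ v hv => ?_⟩
  have hn : 0 < ‖v‖ := norm_pos_iff.2 hv
  have hσ0 : 0 ≤ σ := le_trans (by positivity) hσ
  have hσm : |M| + 1 ≤ σ * m := (div_le_iff₀ hm).1 hσ
  have hu : ‖v‖⁻¹ • v ∈ Metric.sphere (0 : n → ℝ) 1 := by simp [norm_smul, hn.ne']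
  have key : f (‖v‖⁻¹ • v) < σ * g (‖v‖⁻¹ • v) := by
    by_cases hp : 0 ≤ f (‖v‖⁻¹ • v)
    · have h1 := hmK _ ⟨hu, hp⟩
      have h2 := hM _ hu
      rw [Real.norm_eq_abs] at h2
      nlinarith [le_abs_self (f (‖v‖⁻¹ • v)), le_abs_self M, mul_le_mul_of_nonneg_left h1 hσ0]
    · exact lt_of_lt_of_le (not_le.1 hp) (mul_nonneg hσ0 (hg0 _))
  simp only [f, g, Matrix.mulVec_smul, smul_dotProduct, dotProduct_smul, smul_eq_mul] at key
  have h3 : 0 < ‖v‖⁻¹ * ‖v‖⁻¹ := by positivity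
  refine lt_of_mul_lt_mul_left (a := ‖v‖⁻¹ * ‖v‖⁻¹) ?_ h3.le
  linarith

/-- A linear map that vanishes on the kernel of another one factors through it. -/
theorem exists_matrix_factor (Q : Matrix q n ℝ) (K : (n → ℝ) →ₗ[ℝ] (p → ℝ))
    (h : ∀ v, Q *ᵥ v = 0 → K v = 0) : ∃ Θ : Matrix p q ℝ, ∀ v, K v = Θ *ᵥ (Q *ᵥ v) := by
  classical
  let Ql : (n → ℝ) →ₗ[ℝ] (q → ℝ) := Q.mulVecLin
  obtain ⟨s, hs⟩ := LinearMap.exists_rightInverse_of_surjective Ql.rangeRestrict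
    (LinearMap.range_rangeRestrict _)
  obtain ⟨T, hT⟩ := LinearMap.exists_extend (K ∘ₗ s)
  refine ⟨LinearMap.toMatrix' T, fun v => ?_⟩
  rw [LinearMap.toMatrix'_mulVec]
  have h1 : T (Ql v) = K (s (Ql.rangeRestrict v)) := LinearMap.congr_fun hT (Ql.rangeRestrict v)
  have h2 : Ql (s (Ql.rangeRestrict v)) = Ql v :=
    congrArg Subtype.val (LinearMap.congr_fun hs (Ql.rangeRestrict v))
  have h3 : K (s (Ql.rangeRestrict v) - v) = 0 := h _ (by
    change Ql _ = 0
    rw [map_sub, h2, sub_self])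
  rw [map_sub, sub_eq_zero] at h3
  rw [← h3, ← h1]
  rfl

/-- Orthogonal projection, in the inner product of a symmetric positive definite form, onto the
kernel of a matrix. -/
theorem exists_orthogonal_projection_ker {n q : Type} [Fintype n] (Φ : Matrix n n ℝ) (hsymm : Φᵀ = Φ)
    (hpos : ∀ v : n → ℝ, v ≠ 0 → 0 < v ⬝ᵥ (Φ *ᵥ v)) (Q : Matrix q n ℝ) :
    ∃ π : (n → ℝ) →ₗ[ℝ] (n → ℝ), (∀ v, Q *ᵥ π v = 0) ∧ (∀ v, Q *ᵥ v = 0 → π v = v) ∧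
      ∀ v, (v - π v) ⬝ᵥ (Φ *ᵥ π v) = 0 := by
  classical
  let B : LinearMap.BilinForm ℝ (n → ℝ) := Matrix.toBilin' Φ
  have hB : ∀ v w, B v w = v ⬝ᵥ (Φ *ᵥ w) := fun v w => Matrix.toBilin'_apply' Φ v w
  have hBs : ∀ v w, B v w = B w v := fun v w => by
    rw [hB, hB, Matrix.dotProduct_mulVec, ← Matrix.mulVec_transpose, hsymm, dotProduct_comm]
  have hrefl : B.IsRefl := fun v w h => by rw [hBs, h]
  let W : Submodule ℝ (n → ℝ) := LinearMap.ker Q.mulVecLin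
  have hnd : (B.restrict W).Nondegenerate := by
    have hz : ∀ x : W, B x x = 0 → x = 0 := fun x hx => by
      by_contra hne
      have := hpos x (fun h => hne (Subtype.ext h))
      rw [← hB, hx] at this
      exact lt_irrefl _ this
    exact ⟨fun x hx => hz x (hx x), fun x hx => hz x (hx x)⟩
  have hc : IsCompl W (B.orthogonal W) :=
    LinearMap.BilinForm.isCompl_orthogonal_of_restrict_nondegenerate hrefl hnd
  refine ⟨W.projection _ hc, fun v => ?_, fun v hv => ?_, fun v => ?_⟩
  · exact Submodule.projection_apply_mem hc v
  · exact Submodule.projection_apply_left hc ⟨v, hv⟩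
  · rw [← hB, hBs]
    exact Submodule.sub_projection_mem hc v _ (Submodule.projection_apply_mem hc v)

/-- The projection lemma for a finite family of symmetric matrices: if all `Ψ i` are negative
definite on `ker P` and on `ker Q`, and have the same restriction to `(all vectors) × ker Q`, one
matrix `Θ` makes every `Ψ i + PᵀΘQ + QᵀΘᵀP` negative definite. -/
theorem exists_projection [Fintype p] {ι : Type*} [Finite ι] (Ψ : ι → Matrix n n ℝ) (P : Matrix p n ℝ)
    (Q : Matrix q n ℝ) (hsymm : ∀ i, (Ψ i)ᵀ = Ψ i) (hP : ∀ i, NegDefOnKer (Ψ i) P)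
    (hQ : ∀ i, NegDefOnKer (Ψ i) Q)
    (hΨ : ∀ i j v, Q *ᵥ v = 0 → Ψ i *ᵥ v = Ψ j *ᵥ v) :
    ∃ Θ : Matrix p q ℝ, ∀ i (v : n → ℝ), v ≠ 0 →
      v ⬝ᵥ (Ψ i *ᵥ v) + 2 * (P *ᵥ v ⬝ᵥ Θ *ᵥ (Q *ᵥ v)) < 0 := by
  rcases isEmpty_or_nonempty ι with hι | ⟨⟨i₀⟩⟩
  · exact ⟨0, fun i => isEmptyElim i⟩
  choose σ₀ hσ₀ using fun i => exists_forall_lt_mul_of_negDefOnKer (Ψ i) P (hP i)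
  obtain ⟨M, hM⟩ := (Set.finite_range σ₀).bddAbove
  let σ := max M 0
  have hσ : ∀ i (v : n → ℝ), v ≠ 0 → v ⬝ᵥ (Ψ i *ᵥ v) < σ * (P *ᵥ v ⬝ᵥ P *ᵥ v) := fun i =>
    hσ₀ i σ ((hM ⟨i, rfl⟩).trans (le_max_left _ _))
  have hσ0 : 0 ≤ σ := le_max_right _ _
  -- `Φ i` is positive definite by Finsler's lemma; with `π` the projection onto `ker Q` that is
  -- orthogonal for it, the choice `ΘQv = -σP(v - πv)` cancels the cross terms of `πv` and `v - πv`
  let Φ : ι → Matrix n n ℝ := fun i => σ • (Pᵀ * P) - Ψ i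
  have hΦ : ∀ i v w, v ⬝ᵥ (Φ i *ᵥ w) = σ * (P *ᵥ v ⬝ᵥ P *ᵥ w) - v ⬝ᵥ (Ψ i *ᵥ w) := by
    intro i v w
    simp only [Φ, Matrix.sub_mulVec, dotProduct_sub, Matrix.smul_mulVec, dotProduct_smul,
      smul_eq_mul, ← Matrix.mulVec_mulVec]
    rw [Matrix.dotProduct_mulVec v, Matrix.vecMul_transpose]
  have hΦs : ∀ i, (Φ i)ᵀ = Φ i := fun i => by
    simp [Φ, Matrix.transpose_sub, Matrix.transpose_smul, Matrix.transpose_mul, hsymm]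
  obtain ⟨π, hπQ, hπid, hπo⟩ := exists_orthogonal_projection_ker (Φ i₀) (hΦs i₀)
    (fun v hv => by rw [hΦ]; linarith [hσ i₀ v hv]) Q
  let K : (n → ℝ) →ₗ[ℝ] (p → ℝ) := -(σ • (P.mulVecLin ∘ₗ (LinearMap.id - π)))
  have hK : ∀ v, K v = -(σ • (P *ᵥ (v - π v))) := fun v => rfl
  obtain ⟨Θ, hΘ⟩ := exists_matrix_factor Q K (fun v hv => by rw [hK, hπid v hv]; simp)
  refine ⟨Θ, fun i v hv => ?_⟩
  rw [← hΘ, hK]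
  -- all `Φ i` agree on `ker Q`, so one projection is orthogonal for each of them
  have ho : (v - π v) ⬝ᵥ (Φ i *ᵥ π v) = 0 := by
    have h1 := hπo v
    rw [hΦ] at h1 ⊢
    rw [hΨ i i₀ _ (hπQ v), h1]
  have ho' : π v ⬝ᵥ (Φ i *ᵥ (v - π v)) = 0 := by
    rw [Matrix.dotProduct_mulVec, ← Matrix.mulVec_transpose, hΦs, dotProduct_comm, ho]
  have h0 : π v ≠ 0 → π v ⬝ᵥ (Ψ i *ᵥ π v) < 0 := fun h => hQ i _ (hπQ v) h
  have h1 : v - π v ≠ 0 → 0 < (v - π v) ⬝ᵥ (Φ i *ᵥ (v - π v)) := fun h => by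
    rw [hΦ]; linarith [hσ i _ h]
  have hd : v = π v + (v - π v) := by abel
  generalize hx : v - π v = x at *
  generalize π v = z at *
  subst hd
  rw [hΦ] at ho ho' h1
  simp only [Matrix.mulVec_add, dotProduct_add, add_dotProduct, dotProduct_neg, dotProduct_smul,
    smul_eq_mul]
  have hc : P *ᵥ x ⬝ᵥ P *ᵥ z = P *ᵥ z ⬝ᵥ P *ᵥ x := dotProduct_comm _ _
  rw [hc] at ho
  have hxx : 0 ≤ σ * (P *ᵥ x ⬝ᵥ P *ᵥ x) := mul_nonneg hσ0 (dotProduct_self_nonneg_real _)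
  have hz : z ≠ 0 ∨ x ≠ 0 := by
    by_contra! hzx
    exact hv (by rw [hzx.1, hzx.2, add_zero])
  have hz' : z ⬝ᵥ (Ψ i *ᵥ z) ≤ 0 := by
    by_cases hz0 : z = 0
    · simp [hz0]
    · exact (h0 hz0).le
  have hx' : 0 ≤ σ * (P *ᵥ x ⬝ᵥ P *ᵥ x) - x ⬝ᵥ (Ψ i *ᵥ x) := by
    by_cases hx0 : x = 0
    · simp [hx0]
    · exact (h1 hx0).le
  rcases hz with hz | hz
  · have := h0 hz
    linarith
  · have := h1 hz
    linarith

end Projection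

/-! ### Elimination of the controller gains -/

section Elimination

theorem symBlock_transpose {n h : Type} (a : Matrix n n ℝ) (b : Matrix h n ℝ) (N : Matrix h h ℝ)
    (ha : aᵀ = a) (hN : Nᵀ = N) : (symBlock a b N)ᵀ = symBlock a b N := by
  simp [symBlock, Matrix.fromBlocks_transpose, ha, hN]

theorem transpose_He {n : Type} (A : Matrix n n ℝ) : (He A)ᵀ = He A := by
  simp [He, add_comm]

theorem sumElim_ne_zero {n h : Type} {x : n → ℝ} {y : h → ℝ} :
    Sum.elim x y ≠ 0 ↔ x ≠ 0 ∨ y ≠ 0 := by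
  rw [← not_and_or, not_iff_not]
  constructor
  · intro h0
    exact ⟨funext fun i => congrFun h0 (Sum.inl i), funext fun i => congrFun h0 (Sum.inr i)⟩
  · rintro ⟨rfl, rfl⟩
    ext (i | i) <;> rfl

variable {n h p q : Type} [Fintype n] [Fintype h] [Fintype p] [Fintype q]

theorem form_symBlock (a : Matrix n n ℝ) (b : Matrix h n ℝ) (N : Matrix h h ℝ)
    (x : n → ℝ) (y : h → ℝ) :
    Sum.elim x y ⬝ᵥ (symBlock a b N *ᵥ Sum.elim x y) =
      x ⬝ᵥ (a *ᵥ x) + 2 * (y ⬝ᵥ (b *ᵥ x)) + y ⬝ᵥ (N *ᵥ y) := by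
  have h1 : x ⬝ᵥ (bᵀ *ᵥ y) = y ⬝ᵥ (b *ᵥ x) := by
    rw [Matrix.mulVec_transpose, dotProduct_comm, ← Matrix.dotProduct_mulVec]
  rw [symBlock, Matrix.fromBlocks_mulVec, sumElim_dotProduct_sumElim]
  simp only [Sum.elim_comp_inl, Sum.elim_comp_inr, dotProduct_add, h1]
  ring

theorem form_He_transpose_mul_mul (L : Matrix p n ℝ) (D : Matrix p q ℝ) (M : Matrix q n ℝ)
    (v : n → ℝ) :
    v ⬝ᵥ (He (Lᵀ * D * M) *ᵥ v) = 2 * (L *ᵥ v ⬝ᵥ D *ᵥ (M *ᵥ v)) := by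
  have h1 : v ⬝ᵥ ((Lᵀ * D * M) *ᵥ v) = L *ᵥ v ⬝ᵥ D *ᵥ (M *ᵥ v) := by
    rw [← Matrix.mulVec_mulVec, ← Matrix.mulVec_mulVec, Matrix.dotProduct_mulVec v,
      Matrix.vecMul_transpose]
  have h2 : v ⬝ᵥ ((Lᵀ * D * M)ᵀ *ᵥ v) = v ⬝ᵥ ((Lᵀ * D * M) *ᵥ v) := by
    rw [Matrix.mulVec_transpose, dotProduct_comm, ← Matrix.dotProduct_mulVec]
  rw [He, Matrix.add_mulVec, dotProduct_add, h2, h1]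
  ring

/-- A partially specified block matrix is completed to a negative definite one: with the
`(ε, ξ)` block `Â = β'ᵀ N⁻¹ β`, the Schur complement of `N` is block diagonal. -/
theorem exists_completion {ι : Type*} [DecidableEq h] (N : Matrix h h ℝ) (hNs : Nᵀ = N)
    (hN : ∀ y : h → ℝ, y ≠ 0 → y ⬝ᵥ (N *ᵥ y) < 0) (α α' : ι → (n → ℝ) → ℝ) (β β' : Matrix h n ℝ)
    (hα : ∀ i x y, x ≠ 0 → α i x + 2 * (y ⬝ᵥ (β *ᵥ x)) + y ⬝ᵥ (N *ᵥ y) < 0)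
    (hα' : ∀ i x y, x ≠ 0 → α' i x + 2 * (y ⬝ᵥ (β' *ᵥ x)) + y ⬝ᵥ (N *ᵥ y) < 0)
    (h0 : ∀ i, α i 0 = 0) (h0' : ∀ i, α' i 0 = 0) :
    ∃ A : Matrix n n ℝ, ∀ i (x z : n → ℝ) (y : h → ℝ), (x ≠ 0 ∨ z ≠ 0 ∨ y ≠ 0) →
      α i x + α' i z + 2 * (y ⬝ᵥ (β *ᵥ x + β' *ᵥ z)) + y ⬝ᵥ (N *ᵥ y) + 2 * (z ⬝ᵥ (A *ᵥ x)) < 0 := by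
  have hu : IsUnit N.det := by
    rw [isUnit_iff_ne_zero]
    intro hd
    obtain ⟨v, hv, hv'⟩ := Matrix.exists_mulVec_eq_zero_iff.2 hd
    have := hN v hv
    rw [hv', dotProduct_zero] at this
    exact lt_irrefl _ this
  refine ⟨β'ᵀ * N⁻¹ * β, fun i x z y hxyz => ?_⟩
  have hb : N *ᵥ (N⁻¹ *ᵥ (β *ᵥ x)) = β *ᵥ x := by
    rw [Matrix.mulVec_mulVec, Matrix.mul_nonsing_inv _ hu, Matrix.one_mulVec]
  have hb' : N *ᵥ (N⁻¹ *ᵥ (β' *ᵥ z)) = β' *ᵥ z := by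
    rw [Matrix.mulVec_mulVec, Matrix.mul_nonsing_inv _ hu, Matrix.one_mulVec]
  have hA : z ⬝ᵥ ((β'ᵀ * N⁻¹ * β) *ᵥ x) = β' *ᵥ z ⬝ᵥ N⁻¹ *ᵥ (β *ᵥ x) := by
    rw [← Matrix.mulVec_mulVec, ← Matrix.mulVec_mulVec, Matrix.dotProduct_mulVec z,
      Matrix.vecMul_transpose]
  have hR : x ≠ 0 → _ := hα i x (-(N⁻¹ *ᵥ (β *ᵥ x)))
  have hS : z ≠ 0 → _ := hα' i z (-(N⁻¹ *ᵥ (β' *ᵥ z)))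
  have hY : y + N⁻¹ *ᵥ (β *ᵥ x) + N⁻¹ *ᵥ (β' *ᵥ z) ≠ 0 → _ := hN _
  rw [hA]
  have hx0 : x = 0 → α i x = 0 ∧ N⁻¹ *ᵥ (β *ᵥ x) = 0 := by
    rintro rfl
    simp [h0]
  have hz0 : z = 0 → α' i z = 0 ∧ N⁻¹ *ᵥ (β' *ᵥ z) = 0 := by
    rintro rfl
    simp [h0']
  generalize N⁻¹ *ᵥ (β *ᵥ x) = s at *
  generalize N⁻¹ *ᵥ (β' *ᵥ z) = t at *
  rw [← hb] at hR ⊢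
  rw [← hb'] at hS ⊢
  have hcomm : ∀ a b : h → ℝ, a ⬝ᵥ (N *ᵥ b) = b ⬝ᵥ (N *ᵥ a) := fun a b => by
    rw [Matrix.dotProduct_mulVec, ← Matrix.mulVec_transpose, hNs, dotProduct_comm]
  have hNt : N *ᵥ t ⬝ᵥ s = s ⬝ᵥ (N *ᵥ t) := dotProduct_comm _ _
  simp only [Matrix.mulVec_add, Matrix.mulVec_neg, dotProduct_add, add_dotProduct, neg_dotProduct,
    dotProduct_neg, hNt] at hR hS hY ⊢
  rw [hcomm s y, hcomm t y, hcomm t s] at hY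
  have hR' : α i x - s ⬝ᵥ (N *ᵥ s) ≤ 0 := by
    by_cases hx : x = 0
    · simp [hx0 hx]
    · linarith [hR hx]
  have hS' : α' i z - t ⬝ᵥ (N *ᵥ t) ≤ 0 := by
    by_cases hz : z = 0
    · simp [hz0 hz]
    · linarith [hS hz]
  have hY' : y ⬝ᵥ (N *ᵥ y) + 2 * (y ⬝ᵥ (N *ᵥ s)) + 2 * (y ⬝ᵥ (N *ᵥ t)) + 2 * (s ⬝ᵥ (N *ᵥ t))
      + s ⬝ᵥ (N *ᵥ s) + t ⬝ᵥ (N *ᵥ t) ≤ 0 := by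
    by_cases hy : y + s + t = 0
    · have h2 : y = -s - t := by
        rw [← sub_eq_zero, ← hy]; abel
      subst h2
      simp only [Matrix.mulVec_sub, Matrix.mulVec_neg, dotProduct_sub, sub_dotProduct,
        neg_dotProduct, dotProduct_neg]
      rw [hcomm t s]
      linarith
    · linarith [hY hy]
  by_cases hx : x = 0
  · by_cases hz : z = 0
    · have hy : y ≠ 0 := by tauto
      have := hY (by rw [(hx0 hx).2, (hz0 hz).2]; simpa using hy)
      linarith
    · linarith [hS hz]
  · linarith [hR hx]

/-- The transformed gains `(Ĉ, B̂, D, Â)` of the controller. -/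
abbrev Gains (n p q : Type) : Type :=
  Matrix p n ℝ × Matrix n q ℝ × Matrix p q ℝ × Matrix n n ℝ

/-- The quadratic form of the closed-loop dissipation inequality in the transformed states
`v = (ξ, ε)` and the remaining variables `y`. It is affine in the gains. For `ε = 0` it is the
form of the state-feedback problem, for `ξ = 0` that of the estimation problem. -/
def synthForm (aR aS : Matrix n n ℝ) (bR bS : Matrix h n ℝ) (N : Matrix h h ℝ)
    (B : Matrix p n ℝ) (U : Matrix p h ℝ) (C : Matrix q n ℝ) (Y : Matrix q h ℝ)
    (K : Gains n p q) (v : (n → ℝ) × (n → ℝ) × (h → ℝ)) : ℝ :=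
  v.1 ⬝ᵥ (aR *ᵥ v.1) + v.2.1 ⬝ᵥ (aS *ᵥ v.2.1) + v.2.2 ⬝ᵥ (N *ᵥ v.2.2)
    + 2 * (v.2.2 ⬝ᵥ (bR *ᵥ v.1 + bS *ᵥ v.2.1))
    + 2 * ((B *ᵥ v.1 + U *ᵥ v.2.2) ⬝ᵥ (K.1 *ᵥ v.1))
    + 2 * (B *ᵥ v.1 ⬝ᵥ (K.2.2.1 *ᵥ (Y *ᵥ v.2.2)))
    + 2 * (U *ᵥ v.2.2 ⬝ᵥ (K.2.2.1 *ᵥ (C *ᵥ v.2.1 + Y *ᵥ v.2.2)))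
    + 2 * (v.2.1 ⬝ᵥ (K.2.1 *ᵥ (C *ᵥ v.2.1 + Y *ᵥ v.2.2)))
    + 2 * (v.2.1 ⬝ᵥ (K.2.2.2 *ᵥ v.1))

/-- Elimination: negative definiteness on the two kernels yields transformed gains, common to the
whole family of rates, for which the closed-loop form is negative definite. -/
theorem exists_gains {ι : Type*} [Finite ι] (aR aS : ι → Matrix n n ℝ) (bR bS : Matrix h n ℝ)
    (N : Matrix h h ℝ) (B : Matrix p n ℝ) (U : Matrix p h ℝ) (C : Matrix q n ℝ)
    (Y : Matrix q h ℝ) (haR : ∀ i, (aR i)ᵀ = aR i) (haS : ∀ i, (aS i)ᵀ = aS i) (hN : Nᵀ = N)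
    (hR : ∀ i, NegDefOnKer (symBlock (aR i) bR N) (Matrix.fromCols B U))
    (hS : ∀ i, NegDefOnKer (symBlock (aS i) bS N) (Matrix.fromCols C Y)) :
    ∃ K : Gains n p q, ∀ i v, v ≠ 0 → synthForm (aR i) (aS i) bR bS N B U C Y K v < 0 := by
  classical
  rcases isEmpty_or_nonempty ι with hι | ⟨⟨i₀⟩⟩
  · exact ⟨0, fun i => isEmptyElim i⟩
  have hdec : ∀ v : n ⊕ h → ℝ, ∃ x y, v = Sum.elim x y := fun v =>
    ⟨v ∘ Sum.inl, v ∘ Sum.inr, (Sum.elim_comp_inl_inr v).symm⟩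
  -- the direct gain `D` is found on the channels alone
  obtain ⟨D, hD⟩ : ∃ D : Matrix p q ℝ, ∀ y : h → ℝ, y ≠ 0 →
      y ⬝ᵥ (N *ᵥ y) + 2 * (U *ᵥ y ⬝ᵥ D *ᵥ (Y *ᵥ y)) < 0 := by
    obtain ⟨D, hD⟩ := exists_projection (ι := Unit) (fun _ => N) U Y (fun _ => hN)
      (fun _ y hy hy0 => by
        have := hR i₀ (Sum.elim 0 y) (by simpa [Matrix.fromCols_mulVec] using hy)
          (sumElim_ne_zero.2 (Or.inr hy0))
        rw [form_symBlock] at this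
        simpa using this)
      (fun _ y hy hy0 => by
        have := hS i₀ (Sum.elim 0 y) (by simpa [Matrix.fromCols_mulVec] using hy)
          (sumElim_ne_zero.2 (Or.inr hy0))
        rw [form_symBlock] at this
        simpa using this)
      (fun _ _ _ _ => rfl)
    exact ⟨D, fun y hy => hD () y hy⟩
  -- with `D` fixed, `Ĉ` and `B̂` multiply the state, which `E` extracts, so that the second kernel
  -- of the projection lemma is the channel space
  let E : Matrix n (n ⊕ h) ℝ := Matrix.fromCols 1 0
  have hE : ∀ x y, E *ᵥ Sum.elim x y = x := fun x y => by
    simp [E, Matrix.fromCols_mulVec]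
  have hcommon : ∀ (a : ι → Matrix n n ℝ) (b : Matrix h n ℝ) (M : Matrix (n ⊕ h) (n ⊕ h) ℝ) i j
      (v : n ⊕ h → ℝ), E *ᵥ v = 0 →
      (symBlock (a i) b N + M) *ᵥ v = (symBlock (a j) b N + M) *ᵥ v := by
    intro a b M i j v hv
    obtain ⟨x, y, rfl⟩ := hdec v
    rw [hE] at hv
    subst hv
    simp [Matrix.add_mulVec, symBlock, Matrix.fromBlocks_mulVec]
  obtain ⟨K₁, hK₁⟩ := exists_projection
    (fun i => symBlock (aR i) bR N
      + He ((Matrix.fromCols B U)ᵀ * D * (Matrix.fromCols 0 Y : Matrix q (n ⊕ h) ℝ)))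
    (Matrix.fromCols B U) E
    (fun i => by
      rw [Matrix.transpose_add, symBlock_transpose _ _ _ (haR i) hN, transpose_He])
    (fun i v hv hv0 => by
      have := hR i v hv hv0
      rw [Matrix.add_mulVec, dotProduct_add, form_He_transpose_mul_mul, hv]
      simpa using this)
    (fun i v hv hv0 => by
      obtain ⟨x, y, rfl⟩ := hdec v
      rw [hE] at hv
      subst hv
      rw [Matrix.add_mulVec, dotProduct_add, form_He_transpose_mul_mul, form_symBlock]
      have := hD y (by simpa [sumElim_ne_zero] using hv0)
      simpa [Matrix.fromCols_mulVec] using this)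
    (fun i j v hv => hcommon aR bR _ i j v hv)
  obtain ⟨K₂, hK₂⟩ := exists_projection
    (fun i => symBlock (aS i) bS N
      + He ((Matrix.fromCols 0 U : Matrix p (n ⊕ h) ℝ)ᵀ * D * (Matrix.fromCols C Y)))
    (Matrix.fromCols C Y) E
    (fun i => by
      rw [Matrix.transpose_add, symBlock_transpose _ _ _ (haS i) hN, transpose_He])
    (fun i v hv hv0 => by
      have := hS i v hv hv0
      rw [Matrix.add_mulVec, dotProduct_add, form_He_transpose_mul_mul, hv]
      simpa using this)
    (fun i v hv hv0 => by
      obtain ⟨x, y, rfl⟩ := hdec v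
      rw [hE] at hv
      subst hv
      rw [Matrix.add_mulVec, dotProduct_add, form_He_transpose_mul_mul, form_symBlock]
      have := hD y (by simpa [sumElim_ne_zero] using hv0)
      simpa [Matrix.fromCols_mulVec] using this)
    (fun i j v hv => hcommon aS bS _ i j v hv)
  have hK₁' : ∀ i (x : n → ℝ) (y : h → ℝ), x ≠ 0 →
      x ⬝ᵥ (aR i *ᵥ x) + 2 * (y ⬝ᵥ (bR *ᵥ x)) + y ⬝ᵥ (N *ᵥ y)
        + 2 * ((B *ᵥ x + U *ᵥ y) ⬝ᵥ (D *ᵥ (Y *ᵥ y)))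
        + 2 * ((B *ᵥ x + U *ᵥ y) ⬝ᵥ (K₁ *ᵥ x)) < 0 := fun i x y hx => by
    have := hK₁ i (Sum.elim x y) (sumElim_ne_zero.2 (Or.inl hx))
    rw [Matrix.add_mulVec, dotProduct_add, form_He_transpose_mul_mul, form_symBlock,
      hE] at this
    simpa [Matrix.fromCols_mulVec] using this
  have hK₂' : ∀ i (x : n → ℝ) (y : h → ℝ), x ≠ 0 →
      x ⬝ᵥ (aS i *ᵥ x) + 2 * (y ⬝ᵥ (bS *ᵥ x)) + y ⬝ᵥ (N *ᵥ y)
        + 2 * (U *ᵥ y ⬝ᵥ (D *ᵥ (C *ᵥ x + Y *ᵥ y)))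
        + 2 * ((C *ᵥ x + Y *ᵥ y) ⬝ᵥ (K₂ *ᵥ x)) < 0 := fun i x y hx => by
    have := hK₂ i (Sum.elim x y) (sumElim_ne_zero.2 (Or.inl hx))
    rw [Matrix.add_mulVec, dotProduct_add, form_He_transpose_mul_mul, form_symBlock,
      hE] at this
    simpa [Matrix.fromCols_mulVec] using this
  have htr : ∀ {l m : Type} [Fintype l] [Fintype m] (M : Matrix l m ℝ) (a : m → ℝ) (b : l → ℝ),
      a ⬝ᵥ (Mᵀ *ᵥ b) = M *ᵥ a ⬝ᵥ b := fun M a b => by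
    rw [Matrix.dotProduct_mulVec, Matrix.vecMul_transpose]
  -- the two problems share the channel block, and `Â` decouples them
  obtain ⟨A, hA⟩ := exists_completion (N + He (Uᵀ * D * Y))
    (by rw [Matrix.transpose_add, hN, transpose_He])
    (fun y hy => by
      rw [Matrix.add_mulVec, dotProduct_add, form_He_transpose_mul_mul]
      exact hD y hy)
    (fun i x => x ⬝ᵥ (aR i *ᵥ x) + 2 * (B *ᵥ x ⬝ᵥ (K₁ *ᵥ x)))
    (fun i x => x ⬝ᵥ (aS i *ᵥ x) + 2 * (C *ᵥ x ⬝ᵥ (K₂ *ᵥ x)))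
    (bR + Uᵀ * K₁ + Yᵀ * (Dᵀ * B)) (bS + Uᵀ * (D * C) + Yᵀ * K₂)
    (fun i x y hx => by
      have := hK₁' i x y hx
      simp only [Matrix.add_mulVec, dotProduct_add, form_He_transpose_mul_mul, add_dotProduct,
        ← Matrix.mulVec_mulVec, htr] at this ⊢
      rw [dotProduct_comm (D *ᵥ _)]
      linarith)
    (fun i x y hx => by
      have := hK₂' i x y hx
      simp only [Matrix.add_mulVec, dotProduct_add, form_He_transpose_mul_mul, add_dotProduct,
        Matrix.mulVec_add, ← Matrix.mulVec_mulVec, htr] at this ⊢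
      linarith)
    (fun i => by simp) (fun i => by simp)
  refine ⟨(K₁, K₂ᵀ, D, A), fun i v hv => ?_⟩
  obtain ⟨x, z, y⟩ := v
  have := hA i x z y (by
    by_contra! h0
    exact hv (by rw [h0.1, h0.2.1, h0.2.2]; rfl))
  simp only [synthForm, Matrix.add_mulVec, dotProduct_add, form_He_transpose_mul_mul,
    add_dotProduct, Matrix.mulVec_add, ← Matrix.mulVec_mulVec, htr] at this ⊢
  rw [dotProduct_comm (D *ᵥ _)] at this
  rw [dotProduct_comm (K₂ *ᵥ z) (C *ᵥ z), dotProduct_comm (K₂ *ᵥ z)]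
  linarith

end Elimination

/-! ### The synthesis conditions as elimination data -/

section Data

variable {s np nu nd ne ny N nψ : ℕ} (G : Plant s np nu nd ne ny) (F : IQCFilter N nψ nu)

/-- Index type of the augmented state. -/
abbrev AugIdx (np nψ : ℕ) : Type := Fin np ⊕ Fin nψ

/-- Index type of the non-state variables `(w, d, z₁, e)`. -/
abbrev ChanIdx (nu nd ne N : ℕ) : Type := Fin nu ⊕ Fin nd ⊕ (Fin nu × Fin N) ⊕ Fin ne

/-- Index type of the signals `(y, w)` measured by the controller. -/
abbrev MeasIdx (nu ny : ℕ) : Type := Fin ny ⊕ Fin nu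

/-- The variables `(w, d, z₁, e)` as one vector. -/
abbrev chan (w : Fin nu → ℝ) (d : Fin nd → ℝ) (z : Fin nu × Fin N → ℝ) (e : Fin ne → ℝ) :
    ChanIdx nu nd ne N → ℝ :=
  Sum.elim w (Sum.elim d (Sum.elim z e))

/-- The symmetric part of `∑ₖ νₖ ∂M/∂ρₖ`. Only the restriction of `M` to the parameter set is
known to be symmetric, so the symmetrization matters. -/
noncomputable def symRate {n : Type} (M : (Fin s → ℝ) → Matrix n n ℝ) (ν ρ : Fin s → ℝ) :
    Matrix n n ℝ :=
  (1 / 2 : ℝ) • He (rateTerm M ν ρ)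

theorem form_transpose {n : Type} [Fintype n] (A : Matrix n n ℝ) (v : n → ℝ) :
    v ⬝ᵥ (Aᵀ *ᵥ v) = v ⬝ᵥ (A *ᵥ v) := by
  rw [Matrix.mulVec_transpose, dotProduct_comm, ← Matrix.dotProduct_mulVec]

theorem form_He {n : Type} [Fintype n] (A : Matrix n n ℝ) (v : n → ℝ) :
    v ⬝ᵥ (He A *ᵥ v) = 2 * (v ⬝ᵥ (A *ᵥ v)) := by
  rw [He, Matrix.add_mulVec, dotProduct_add, form_transpose]
  ring

theorem form_symRate {n : Type} [Fintype n] (M : (Fin s → ℝ) → Matrix n n ℝ) (ν ρ : Fin s → ℝ)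
    (v : n → ℝ) : v ⬝ᵥ (symRate M ν ρ *ᵥ v) = v ⬝ᵥ (rateTerm M ν ρ *ᵥ v) := by
  rw [symRate, Matrix.smul_mulVec, dotProduct_smul, form_He, smul_eq_mul]
  ring

theorem transpose_symRate {n : Type} (M : (Fin s → ℝ) → Matrix n n ℝ) (ν ρ : Fin s → ℝ) :
    (symRate M ν ρ)ᵀ = symRate M ν ρ := by
  rw [symRate, Matrix.transpose_smul, transpose_He]

theorem form_rateTerm {n : Type} [Fintype n] (M : (Fin s → ℝ) → Matrix n n ℝ) (ν ρ : Fin s → ℝ)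
    (v : n → ℝ) :
    v ⬝ᵥ (rateTerm M ν ρ *ᵥ v) = ∑ k, ν k * (v ⬝ᵥ (partialDeriv M k ρ *ᵥ v)) := by
  rw [rateTerm, Matrix.sum_mulVec, dotProduct_sum]
  simp [Matrix.smul_mulVec, dotProduct_smul]

variable (R S : (Fin s → ℝ) → Matrix (AugIdx np nψ) (AugIdx np nψ) ℝ)
  (Xs : Fin N → (Fin s → ℝ) → Matrix (Fin nu) (Fin nu) ℝ)
  (X : (Fin s → ℝ) → Matrix (Fin nu) (Fin nu) ℝ) (γ : ℝ)

/-- The state block of the first condition. -/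
noncomputable def dataAR (ν ρ : Fin s → ℝ) : Matrix (AugIdx np nψ) (AugIdx np nψ) ℝ :=
  He (Aaug G F ρ * R ρ) - symRate R ν ρ

/-- The state block of the second condition. -/
noncomputable def dataAS (ν ρ : Fin s → ℝ) : Matrix (AugIdx np nψ) (AugIdx np nψ) ℝ :=
  He (S ρ * Aaug G F ρ) + symRate S ν ρ

/-- The off-diagonal block of the first condition, after the congruence that turns `X` into the
identity. -/
def dataBR (ρ : Fin s → ℝ) : Matrix (ChanIdx nu nd ne N) (AugIdx np nψ) ℝ :=
  Matrix.fromRows (Baug0 G F ρ)ᵀ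
    (Matrix.fromRows (Baug1 G nψ ρ)ᵀ
      (Matrix.fromRows (F.Caug0 np * R ρ) (Caug1 G nψ ρ * R ρ)))

/-- The off-diagonal block of the second condition, with the measured channel `w` included. -/
def dataBS (ρ : Fin s → ℝ) : Matrix (ChanIdx nu nd ne N) (AugIdx np nψ) ℝ :=
  Matrix.fromRows ((Baug0 G F ρ)ᵀ * S ρ)
    (Matrix.fromRows ((Baug1 G nψ ρ)ᵀ * S ρ)
      (Matrix.fromRows (F.Caug0 np) (Caug1 G nψ ρ)))

/-- The weight `∑ₖ Xₖ⁻¹` of the channel `w`. -/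
noncomputable def weightW (ρ : Fin s → ℝ) : Matrix (Fin nu) (Fin nu) ℝ := ∑ k, (Xs k ρ)⁻¹

/-- The block of the channels `(w, d, z₁, e)`. -/
noncomputable def dataN (ρ : Fin s → ℝ) :
    Matrix (ChanIdx nu nd ne N) (ChanIdx nu nd ne N) ℝ :=
  symBlock (-weightW Xs ρ)
    (Matrix.fromRows 0 (Matrix.fromRows F.Dψ2s (-G.Dp12 ρ)))
    (symBlock (-γ • 1)
      (Matrix.fromRows 0 (G.Dp11 ρ))
      (symBlock (-Matrix.blockDiagonal fun k => Xs k ρ) 0 (-γ • 1)))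

/-- The map through which the control input enters the channels. -/
def dataU (nd : ℕ) (Dp12 : Matrix (Fin ne) (Fin nu) ℝ) :
    Matrix (Fin nu) (ChanIdx nu nd ne N) ℝ :=
  Matrix.fromCols 0 (Matrix.fromCols 0 (Matrix.fromCols F.Dψ1sᵀ Dp12ᵀ))

/-- The state part of the measurement `(y, w)`. -/
def dataC (nψ : ℕ) (ρ : Fin s → ℝ) : Matrix (MeasIdx nu ny) (AugIdx np nψ) ℝ :=
  Matrix.fromRows (Caug2 G nψ ρ) 0

/-- The channel part of the measurement `(y, w)`. -/
def dataY (N : ℕ) (ρ : Fin s → ℝ) : Matrix (MeasIdx nu ny) (ChanIdx nu nd ne N) ℝ :=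
  Matrix.fromRows (Matrix.fromCols 0 (Matrix.fromCols (G.Dp21 ρ) 0)) (Matrix.fromCols 1 0)

/-- The closed-loop dissipation form at the parameter `ρ` and the rate `ν`. -/
noncomputable def loopForm (ρ ν : Fin s → ℝ) (K : Gains (AugIdx np nψ) (Fin nu) (MeasIdx nu ny))
    (v : (AugIdx np nψ → ℝ) × (AugIdx np nψ → ℝ) × (ChanIdx nu nd ne N → ℝ)) : ℝ :=
  synthForm (dataAR G F R ν ρ) (dataAS G F S ν ρ) (dataBR G F R ρ) (dataBS G F S ρ)
    (dataN G F Xs γ ρ) (Baug2 G F ρ)ᵀ (dataU F nd (G.Dp12 ρ)) (dataC G nψ ρ) (dataY G N ρ) K v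

theorem form_dataN (ρ : Fin s → ℝ) (w : Fin nu → ℝ) (d : Fin nd → ℝ) (z : Fin nu × Fin N → ℝ)
    (e : Fin ne → ℝ) :
    chan w d z e ⬝ᵥ (dataN G F Xs γ ρ *ᵥ chan w d z e) =
      -(w ⬝ᵥ (weightW Xs ρ *ᵥ w)) + 2 * (z ⬝ᵥ (F.Dψ2s *ᵥ w)) - 2 * (e ⬝ᵥ (G.Dp12 ρ *ᵥ w))
        - γ * (d ⬝ᵥ d) + 2 * (e ⬝ᵥ (G.Dp11 ρ *ᵥ d))
        - z ⬝ᵥ ((Matrix.blockDiagonal fun k => Xs k ρ) *ᵥ z) - γ * (e ⬝ᵥ e) := by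
  rw [dataN, form_symBlock, form_symBlock, form_symBlock]
  simp only [Matrix.fromRows_mulVec, sumElim_dotProduct_sumElim, Matrix.neg_mulVec,
    Matrix.zero_mulVec, dotProduct_neg, dotProduct_zero, Matrix.smul_mulVec, Matrix.one_mulVec,
    dotProduct_smul, smul_eq_mul]
  ring

theorem dataC_mulVec (ρ : Fin s → ℝ) (x : AugIdx np nψ → ℝ) :
    (dataC G nψ ρ : Matrix (MeasIdx nu ny) _ ℝ) *ᵥ x = Sum.elim (Caug2 G nψ ρ *ᵥ x) 0 := by
  rw [dataC, Matrix.fromRows_mulVec, Matrix.zero_mulVec]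

theorem dataY_mulVec (ρ : Fin s → ℝ) (w : Fin nu → ℝ) (d : Fin nd → ℝ) (z : Fin nu × Fin N → ℝ)
    (e : Fin ne → ℝ) : dataY G N ρ *ᵥ chan w d z e = Sum.elim (G.Dp21 ρ *ᵥ d) w := by
  rw [dataY, Matrix.fromRows_mulVec]
  simp only [Matrix.fromCols_mulVec_sumElim, Matrix.zero_mulVec, Matrix.one_mulVec, zero_add,
    add_zero]

theorem dataU_mulVec (Dp12 : Matrix (Fin ne) (Fin nu) ℝ) (w : Fin nu → ℝ) (d : Fin nd → ℝ)
    (z : Fin nu × Fin N → ℝ) (e : Fin ne → ℝ) :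
    dataU F nd Dp12 *ᵥ chan w d z e = F.Dψ1sᵀ *ᵥ z + Dp12ᵀ *ᵥ e := by
  simp only [dataU, Matrix.fromCols_mulVec_sumElim, Matrix.zero_mulVec, zero_add]

theorem form_lmiR (ν ρ : Fin s → ℝ) (x : AugIdx np nψ → ℝ) (w : Fin nu → ℝ) (d : Fin nd → ℝ)
    (z : Fin nu × Fin N → ℝ) (e : Fin ne → ℝ) :
    Sum.elim x (chan w d z e) ⬝ᵥ (lmiR G F R Xs X γ ν ρ *ᵥ Sum.elim x (chan w d z e)) =
      x ⬝ᵥ (dataAR G F R ν ρ *ᵥ x) + 2 * (chan (X ρ *ᵥ w) d z e ⬝ᵥ (dataBR G F R ρ *ᵥ x))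
        - ∑ k, w ⬝ᵥ ((X ρ + (X ρ)ᵀ - Xs k ρ) *ᵥ w)
        + 2 * (z ⬝ᵥ (F.Dψ2s *ᵥ (X ρ *ᵥ w))) - 2 * (e ⬝ᵥ (G.Dp12 ρ *ᵥ (X ρ *ᵥ w)))
        - γ * (d ⬝ᵥ d) + 2 * (e ⬝ᵥ (G.Dp11 ρ *ᵥ d))
        - z ⬝ᵥ ((Matrix.blockDiagonal fun k => Xs k ρ) *ᵥ z) - γ * (e ⬝ᵥ e) := by
  rw [lmiR, form_symBlock, form_symBlock, form_symBlock, form_symBlock, dataAR, dataBR]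
  simp only [Matrix.fromRows_mulVec, sumElim_dotProduct_sumElim, Matrix.neg_mulVec,
    Matrix.zero_mulVec, dotProduct_neg, dotProduct_zero, Matrix.smul_mulVec, Matrix.one_mulVec,
    dotProduct_smul, smul_eq_mul, Matrix.sub_mulVec, dotProduct_sub, form_symRate,
    Matrix.sum_mulVec, dotProduct_sum, ← Matrix.mulVec_mulVec, Matrix.neg_mul]
  rw [Matrix.dotProduct_mulVec w, Matrix.vecMul_transpose]
  ring

theorem form_lmiS (ν ρ : Fin s → ℝ) (x : AugIdx np nψ → ℝ) (d : Fin nd → ℝ)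
    (z : Fin nu × Fin N → ℝ) (e : Fin ne → ℝ) :
    Sum.elim x (Sum.elim z (Sum.elim e d)) ⬝ᵥ
        (lmiS G F S Xs γ ν ρ *ᵥ Sum.elim x (Sum.elim z (Sum.elim e d))) =
      x ⬝ᵥ (dataAS G F S ν ρ *ᵥ x) + 2 * (chan 0 d z e ⬝ᵥ (dataBS G F S ρ *ᵥ x))
        - γ * (d ⬝ᵥ d) + 2 * (e ⬝ᵥ (G.Dp11 ρ *ᵥ d))
        - z ⬝ᵥ ((Matrix.blockDiagonal fun k => Xs k ρ) *ᵥ z) - γ * (e ⬝ᵥ e) := by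
  rw [lmiS, form_symBlock, form_symBlock, form_symBlock, dataAS, dataBS]
  simp only [Matrix.fromRows_mulVec, sumElim_dotProduct_sumElim, Matrix.neg_mulVec,
    Matrix.zero_mulVec, dotProduct_neg, dotProduct_zero, Matrix.smul_mulVec, Matrix.one_mulVec,
    dotProduct_smul, smul_eq_mul, Matrix.add_mulVec, dotProduct_add, form_symRate, zero_dotProduct]
  rw [Matrix.dotProduct_mulVec d (G.Dp11 ρ)ᵀ, Matrix.vecMul_transpose,
    dotProduct_comm (G.Dp11 ρ *ᵥ d)]
  ring

theorem PosDef_form_pos {n : Type} [Fintype n] {M : Matrix n n ℝ} (hM : M.PosDef) {v : n → ℝ}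
    (hv : v ≠ 0) : 0 < v ⬝ᵥ (M *ᵥ v) := by
  simpa using hM.dotProduct_mulVec_pos hv

theorem PosDef_form_nonneg {n : Type} [Fintype n] {M : Matrix n n ℝ} (hM : M.PosDef)
    (v : n → ℝ) : 0 ≤ v ⬝ᵥ (M *ᵥ v) := by
  simpa using hM.posSemidef.dotProduct_mulVec_nonneg v

theorem PosDef_transpose {n : Type} {M : Matrix n n ℝ} (hM : M.PosDef) : Mᵀ = M := by
  simpa using hM.isHermitian.eq

/-- Completion of squares: `XᵀM⁻¹X ≥ X + Xᵀ - M`. -/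
theorem form_le_form_inv {n : Type} [Fintype n] [DecidableEq n] {M : Matrix n n ℝ} (hM : M.PosDef)
    (X : Matrix n n ℝ) (v : n → ℝ) :
    v ⬝ᵥ ((X + Xᵀ - M) *ᵥ v) ≤ X *ᵥ v ⬝ᵥ (M⁻¹ *ᵥ (X *ᵥ v)) := by
  have h := PosDef_form_nonneg hM.inv (X *ᵥ v - M *ᵥ v)
  have h1 : M⁻¹ *ᵥ (M *ᵥ v) = v := by
    rw [Matrix.mulVec_mulVec, Matrix.nonsing_inv_mul _ hM.det_pos.ne'.isUnit, Matrix.one_mulVec]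
  have h2 : M *ᵥ v ⬝ᵥ (M⁻¹ *ᵥ (X *ᵥ v)) = v ⬝ᵥ (X *ᵥ v) := by
    rw [Matrix.dotProduct_mulVec, ← Matrix.mulVec_transpose, PosDef_transpose hM.inv, h1]
  rw [Matrix.mulVec_sub, h1, sub_dotProduct, dotProduct_sub, dotProduct_sub, h2,
    dotProduct_comm (M *ᵥ v) v, dotProduct_comm (X *ᵥ v) v] at h
  rw [Matrix.sub_mulVec, Matrix.add_mulVec, dotProduct_sub, dotProduct_add, form_transpose]
  linarith

/-- The first condition with `X` removed: the channel `w` is replaced by `X w`, and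
`XᵀXₖ⁻¹X ≥ X + Xᵀ - Xₖ`. -/
theorem negDefOnKer_dataR (ν ρ : Fin s → ℝ) (hXs : ∀ k, (Xs k ρ).PosDef)
    (h : NegDefOnKer (lmiR G F R Xs X γ ν ρ) (kerRowR G F ρ)) :
    NegDefOnKer (symBlock (dataAR G F R ν ρ) (dataBR G F R ρ) (dataN G F Xs γ ρ))
      (Matrix.fromCols (Baug2 G F ρ)ᵀ (dataU F nd (G.Dp12 ρ))) := by
  have hker : ∀ (x : AugIdx np nψ → ℝ) (w w' : Fin nu → ℝ) (d : Fin nd → ℝ)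
      (z : Fin nu × Fin N → ℝ) (e : Fin ne → ℝ),
      kerRowR G F ρ *ᵥ Sum.elim x (chan w d z e) = kerRowR G F ρ *ᵥ Sum.elim x (chan w' d z e) := by
    intro x w w' d z e
    simp [kerRowR, Matrix.fromCols_mulVec]
  -- if `X w = 0`, the condition at `w` reads `∑ₖ wᵀXₖw < 0`
  have hX : IsUnit (X ρ).det := by
    rw [isUnit_iff_ne_zero]
    intro hd
    obtain ⟨w, hw, hw'⟩ := Matrix.exists_mulVec_eq_zero_iff.2 hd
    have h1 := h (Sum.elim 0 (chan w 0 0 0)) (by simp [kerRowR, Matrix.fromCols_mulVec])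
      (by rw [sumElim_ne_zero, sumElim_ne_zero]; exact Or.inr (Or.inl hw))
    rw [form_lmiR, hw'] at h1
    have h2 : ∀ k, w ⬝ᵥ ((X ρ + (X ρ)ᵀ - Xs k ρ) *ᵥ w) ≤ 0 := fun k => by
      rw [Matrix.sub_mulVec, Matrix.add_mulVec, dotProduct_sub, dotProduct_add, form_transpose,
        hw', dotProduct_zero]
      linarith [PosDef_form_nonneg (hXs k) w]
    have h3 := Finset.sum_nonpos fun k (_ : k ∈ Finset.univ) => h2 k
    simp only [Matrix.mulVec_zero, dotProduct_zero] at h1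
    linarith
  intro v hv hv0
  obtain ⟨x, w, d, z, e, rfl⟩ : ∃ x w d z e, v = Sum.elim x (chan w d z e) :=
    ⟨_, _, _, _, _, by
      rw [chan, ← Sum.elim_comp_inl_inr v, ← Sum.elim_comp_inl_inr (v ∘ Sum.inr),
        ← Sum.elim_comp_inl_inr ((v ∘ Sum.inr) ∘ Sum.inr),
        ← Sum.elim_comp_inl_inr (((v ∘ Sum.inr) ∘ Sum.inr) ∘ Sum.inr)]⟩
  have hXw : X ρ *ᵥ ((X ρ)⁻¹ *ᵥ w) = w := by
    rw [Matrix.mulVec_mulVec, Matrix.mul_nonsing_inv _ hX, Matrix.one_mulVec]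
  have h1 := h (Sum.elim x (chan ((X ρ)⁻¹ *ᵥ w) d z e)) (by rw [hker _ _ w]; exact hv) (by
    intro h0
    apply hv0
    have hx : x = 0 := funext fun i => congrFun h0 (Sum.inl i)
    have hw : (X ρ)⁻¹ *ᵥ w = 0 := funext fun i => congrFun h0 (Sum.inr (Sum.inl i))
    have hr : (Sum.elim d (Sum.elim z e)) = 0 :=
      funext fun i => congrFun h0 (Sum.inr (Sum.inr i))
    rw [hw, Matrix.mulVec_zero] at hXw
    subst hx
    rw [chan, hr, ← hXw]
    ext (i | i | i) <;> rfl)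
  rw [form_lmiR, hXw] at h1
  rw [form_symBlock, form_dataN]
  have h2 : ∑ k, (X ρ)⁻¹ *ᵥ w ⬝ᵥ ((X ρ + (X ρ)ᵀ - Xs k ρ) *ᵥ ((X ρ)⁻¹ *ᵥ w)) ≤
      w ⬝ᵥ (weightW Xs ρ *ᵥ w) := by
    rw [weightW, Matrix.sum_mulVec, dotProduct_sum]
    refine Finset.sum_le_sum fun k _ => ?_
    have := form_le_form_inv (hXs k) (X ρ) ((X ρ)⁻¹ *ᵥ w)
    rwa [hXw] at this
  linarith

/-- The second condition with `w` added as a measured channel, which the kernel forces to vanish. -/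
theorem negDefOnKer_dataS (ν ρ : Fin s → ℝ)
    (h : NegDefOnKer (lmiS G F S Xs γ ν ρ) (kerRowS G N nψ ρ)) :
    NegDefOnKer (symBlock (dataAS G F S ν ρ) (dataBS G F S ρ) (dataN G F Xs γ ρ))
      (Matrix.fromCols (dataC (nu := nu) G nψ ρ) (dataY G N ρ)) := by
  intro v hv hv0
  obtain ⟨x, w, d, z, e, rfl⟩ : ∃ x w d z e, v = Sum.elim x (chan w d z e) :=
    ⟨_, _, _, _, _, by
      rw [chan, ← Sum.elim_comp_inl_inr v, ← Sum.elim_comp_inl_inr (v ∘ Sum.inr),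
        ← Sum.elim_comp_inl_inr ((v ∘ Sum.inr) ∘ Sum.inr),
        ← Sum.elim_comp_inl_inr (((v ∘ Sum.inr) ∘ Sum.inr) ∘ Sum.inr)]⟩
  have hy : Caug2 G nψ ρ *ᵥ x + G.Dp21 ρ *ᵥ d = 0 := funext fun i => by
    have := congrFun hv (Sum.inl i)
    simpa [Matrix.fromCols_mulVec, dataC_mulVec, dataY_mulVec] using this
  have hw : w = 0 := funext fun i => by
    have := congrFun hv (Sum.inr i)
    simpa [Matrix.fromCols_mulVec, dataC_mulVec, dataY_mulVec] using this
  subst hw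
  have h1 := h (Sum.elim x (Sum.elim z (Sum.elim e d)))
    (by simpa [kerRowS, Matrix.fromCols_mulVec] using hy) (by
      simp only [sumElim_ne_zero] at hv0 ⊢
      tauto)
  rw [form_lmiS] at h1
  rw [form_symBlock, form_dataN]
  simp only [Matrix.mulVec_zero, dotProduct_zero] at h1 ⊢
  linarith

theorem transpose_dataN (ρ : Fin s → ℝ) (hXs : ∀ k, (Xs k ρ).PosDef) :
    (dataN G F Xs γ ρ)ᵀ = dataN G F Xs γ ρ := by
  refine symBlock_transpose _ _ _ ?_ (symBlock_transpose _ _ _ ?_ (symBlock_transpose _ _ _ ?_ ?_))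
  · rw [Matrix.transpose_neg, weightW, Matrix.transpose_sum]
    exact congrArg Neg.neg (Finset.sum_congr rfl fun k _ => PosDef_transpose (hXs k).inv)
  · simp
  · rw [Matrix.transpose_neg, Matrix.blockDiagonal_transpose]
    exact congrArg Neg.neg (congrArg Matrix.blockDiagonal
      (funext fun k => PosDef_transpose (hXs k)))
  · simp

/-- A function that is affine in the rate and negative at the vertices of the box is negative on
the whole box. -/
theorem affine_neg_of_vertices (νlo νhi : Fin s → ℝ) (c : ℝ) (g : Fin s → ℝ)
    (h : ∀ ν, IsVertex νlo νhi ν → c + ∑ k, ν k * g k < 0) (ν : Fin s → ℝ)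
    (hν : ν ∈ Icc νlo νhi) : c + ∑ k, ν k * g k < 0 := by
  refine lt_of_le_of_lt ?_ (h (fun k => if 0 ≤ g k then νhi k else νlo k) fun k => ?_)
  · refine add_le_add le_rfl (Finset.sum_le_sum fun k _ => ?_)
    split_ifs with hk
    · exact mul_le_mul_of_nonneg_right (hν.2 k) hk
    · exact mul_le_mul_of_nonpos_right (hν.1 k) (not_le.1 hk).le
  · by_cases hk : 0 ≤ g k <;> simp [hk]

theorem finite_isVertex (νlo νhi : Fin s → ℝ) : {ν | IsVertex νlo νhi ν}.Finite := by
  have : {ν | IsVertex νlo νhi ν} = Set.univ.pi fun k => ({νlo k, νhi k} : Set ℝ) := by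
    ext ν
    simp [IsVertex]
  rw [this]
  exact Set.Finite.pi fun k => Set.toFinite {νlo k, νhi k}

/-- At every parameter, some transformed gains make the closed-loop form negative definite for
all rates in the box. -/
theorem exists_gains_at (νlo νhi ρ : Fin s → ℝ) (hXs : ∀ k, (Xs k ρ).PosDef)
    (hR : ∀ ν, IsVertex νlo νhi ν → NegDefOnKer (lmiR G F R Xs X γ ν ρ) (kerRowR G F ρ))
    (hS : ∀ ν, IsVertex νlo νhi ν → NegDefOnKer (lmiS G F S Xs γ ν ρ) (kerRowS G N nψ ρ)) :
    ∃ K : Gains (AugIdx np nψ) (Fin nu) (MeasIdx nu ny), ∀ ν ∈ Icc νlo νhi, ∀ v, v ≠ 0 →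
      loopForm G F R S Xs γ ρ ν K v < 0 := by
  have : Finite {ν | IsVertex νlo νhi ν} := finite_isVertex νlo νhi
  obtain ⟨K, hK⟩ := exists_gains (ι := {ν | IsVertex νlo νhi ν})
    (fun ν => dataAR G F R ν ρ) (fun ν => dataAS G F S ν ρ) (dataBR G F R ρ) (dataBS G F S ρ)
    (dataN G F Xs γ ρ) (Baug2 G F ρ)ᵀ (dataU F nd (G.Dp12 ρ)) (dataC G nψ ρ) (dataY G N ρ)
    (fun ν => by rw [dataAR, Matrix.transpose_sub, transpose_He, transpose_symRate])
    (fun ν => by rw [dataAS, Matrix.transpose_add, transpose_He, transpose_symRate])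
    (transpose_dataN G F Xs γ ρ hXs)
    (fun ν => negDefOnKer_dataR G F R Xs X γ ν ρ hXs (hR ν ν.2))
    (fun ν => negDefOnKer_dataS G F S Xs γ ν ρ (hS ν ν.2))
  refine ⟨K, fun ν hν v hv => ?_⟩
  have haff : ∀ ν, loopForm G F R S Xs γ ρ ν K v = loopForm G F R S Xs γ ρ 0 K v
      + ∑ k, ν k * (v.2.1 ⬝ᵥ (partialDeriv S k ρ *ᵥ v.2.1)
        - v.1 ⬝ᵥ (partialDeriv R k ρ *ᵥ v.1)) := by
    intro ν
    simp only [loopForm, synthForm, dataAR, dataAS, Matrix.sub_mulVec, Matrix.add_mulVec,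
      dotProduct_sub, dotProduct_add, form_symRate, form_rateTerm, Pi.zero_apply, zero_mul,
      Finset.sum_const_zero, mul_sub, Finset.sum_sub_distrib]
    ring
  rw [haff]
  refine affine_neg_of_vertices νlo νhi _ _ (fun ν' hν' => ?_) ν hν
  rw [← haff]
  exact hK ⟨ν', hν'⟩ v hv

end Data

/-! ### Continuous selection of the gains -/

section Continuity

variable {T : Type*} [TopologicalSpace T]

@[fun_prop]
theorem continuous_fromRows {l m n : Type} {A : T → Matrix l n ℝ} {B : T → Matrix m n ℝ}
    (hA : Continuous A) (hB : Continuous B) :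
    Continuous fun t => Matrix.fromRows (A t) (B t) := by
  refine continuous_matrix fun i j => ?_
  rcases i with i | i
  · exact hA.matrix_elem i j
  · exact hB.matrix_elem i j

@[fun_prop]
theorem continuous_fromCols {l m n : Type} {A : T → Matrix l m ℝ} {B : T → Matrix l n ℝ}
    (hA : Continuous A) (hB : Continuous B) :
    Continuous fun t => Matrix.fromCols (A t) (B t) := by
  refine continuous_matrix fun i j => ?_
  rcases j with j | j
  · exact hA.matrix_elem i j
  · exact hB.matrix_elem i j

@[fun_prop]
theorem continuous_toCols₁ {l m n : Type} {A : T → Matrix l (m ⊕ n) ℝ} (hA : Continuous A) :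
    Continuous fun t => (A t).toCols₁ :=
  continuous_matrix fun i j => hA.matrix_elem i (Sum.inl j)

@[fun_prop]
theorem continuous_toCols₂ {l m n : Type} {A : T → Matrix l (m ⊕ n) ℝ} (hA : Continuous A) :
    Continuous fun t => (A t).toCols₂ :=
  continuous_matrix fun i j => hA.matrix_elem i (Sum.inr j)

@[fun_prop]
theorem continuous_symBlock {m n : Type} {A : T → Matrix m m ℝ} {B : T → Matrix n m ℝ}
    {D : T → Matrix n n ℝ} (hA : Continuous A) (hB : Continuous B) (hD : Continuous D) :
    Continuous fun t => symBlock (A t) (B t) (D t) :=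
  hA.matrix_fromBlocks hB.matrix_transpose hB hD

@[fun_prop]
theorem continuous_He {m : Type} {A : T → Matrix m m ℝ} (hA : Continuous A) :
    Continuous fun t => He (A t) :=
  hA.add hA.matrix_transpose

theorem continuous_matrix_inv {n : Type} [Fintype n] [DecidableEq n] {A : T → Matrix n n ℝ}
    (hA : Continuous A) (h : ∀ t, IsUnit (A t).det) : Continuous fun t => (A t)⁻¹ := by
  have h1 : (fun t => (A t)⁻¹) = fun t => ((A t).det)⁻¹ • (A t).adjugate := by
    funext t
    rw [Matrix.inv_def, Ring.inverse_eq_inv']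
  rw [h1]
  exact (hA.matrix_det.inv₀ fun t => (h t).ne_zero).smul hA.matrix_adjugate

theorem continuous_coe_of_continuousOn {X : Type*} [TopologicalSpace X] {P : Set T} {f : T → X}
    (hf : ContinuousOn f P) : Continuous fun t : P => f t :=
  continuousOn_iff_continuous_domRestrict.1 hf

theorem continuous_synthForm {n h p q : Type} [Fintype n] [Fintype h] [Fintype p] [Fintype q]
    {aR aS : T → Matrix n n ℝ} {bR bS : T → Matrix h n ℝ} {N : T → Matrix h h ℝ}
    {B : T → Matrix p n ℝ} {U : T → Matrix p h ℝ} {C : T → Matrix q n ℝ} {Y : T → Matrix q h ℝ}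
    {K : T → Gains n p q} {v : T → (n → ℝ) × (n → ℝ) × (h → ℝ)}
    (haR : Continuous aR) (haS : Continuous aS) (hbR : Continuous bR) (hbS : Continuous bS)
    (hN : Continuous N) (hB : Continuous B) (hU : Continuous U) (hC : Continuous C)
    (hY : Continuous Y) (hK : Continuous K) (hv : Continuous v) :
    Continuous fun t =>
      synthForm (aR t) (aS t) (bR t) (bS t) (N t) (B t) (U t) (C t) (Y t) (K t) (v t) := by
  unfold synthForm
  fun_prop

variable {s : ℕ} {P V : Set (Fin s → ℝ)}

theorem IsC1Near.continuousOn {m n : Type} {M : (Fin s → ℝ) → Matrix m n ℝ} (hM : IsC1Near P M) :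
    ContinuousOn M P := by
  obtain ⟨U, -, hPU, hU⟩ := hM
  exact continuousOn_pi.2 fun i => continuousOn_pi.2 fun j => ((hU i j).continuousOn).mono hPU

theorem IsC1Near.continuousOn_partialDeriv {m n : Type} {M : (Fin s → ℝ) → Matrix m n ℝ}
    (hM : IsC1Near P M) (k : Fin s) : ContinuousOn (partialDeriv M k) P := by
  obtain ⟨U, hUo, hPU, hU⟩ := hM
  refine continuousOn_pi.2 fun i => continuousOn_pi.2 fun j => ?_
  have h1 : ContinuousOn (fderiv ℝ fun ρ => M ρ i j) U :=
    (hU i j).continuousOn_fderiv_of_isOpen hUo le_rfl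
  exact (h1.clm_apply continuousOn_const).mono hPU

theorem IsC1Near.continuous_symRate {n : Type} {M : (Fin s → ℝ) → Matrix n n ℝ}
    (hM : IsC1Near P M) :
    Continuous fun p : P × V => symRate M (p.2 : Fin s → ℝ) (p.1 : Fin s → ℝ) := by
  have h1 : ∀ k, Continuous fun p : P × V => partialDeriv M k (p.1 : Fin s → ℝ) := fun k =>
    (continuous_coe_of_continuousOn (hM.continuousOn_partialDeriv k)).comp continuous_fst
  have h2 : Continuous fun p : P × V => rateTerm M (p.2 : Fin s → ℝ) (p.1 : Fin s → ℝ) := by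
    unfold rateTerm
    refine continuous_finsetSum _ fun k _ => Continuous.fun_smul ?_ (h1 k)
    exact (continuous_apply k).comp (continuous_subtype_val.comp continuous_snd)
  unfold symRate
  exact (continuous_He h2).fun_const_smul _

end Continuity

section Selection

variable {s np nu nd ne ny N nψ : ℕ} (G : Plant s np nu nd ne ny) (F : IQCFilter N nψ nu)
  (R S : (Fin s → ℝ) → Matrix (AugIdx np nψ) (AugIdx np nψ) ℝ)
  (Xs : Fin N → (Fin s → ℝ) → Matrix (Fin nu) (Fin nu) ℝ) (γ : ℝ)
  {P V : Set (Fin s → ℝ)}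

/-- The space of the transformed states and of the channels. -/
abbrev LoopSpace (np nψ nu nd ne N : ℕ) : Type :=
  (AugIdx np nψ → ℝ) × (AugIdx np nψ → ℝ) × (ChanIdx nu nd ne N → ℝ)

theorem loopForm_smul (ρ ν : Fin s → ℝ) (K : Gains (AugIdx np nψ) (Fin nu) (MeasIdx nu ny)) (c : ℝ)
    (v : LoopSpace np nψ nu nd ne N) :
    loopForm G F R S Xs γ ρ ν K (c • v) = c ^ 2 * loopForm G F R S Xs γ ρ ν K v := by
  simp only [loopForm, synthForm, Prod.smul_fst, Prod.smul_snd, Matrix.mulVec_smul,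
    Matrix.mulVec_add, smul_dotProduct, dotProduct_smul, smul_eq_mul, dotProduct_add,
    add_dotProduct]
  ring

theorem continuous_Aaug (hG : G.IsContinuousOn P) :
    Continuous fun ρ : P => Aaug G F (ρ : Fin s → ℝ) :=
  Continuous.matrix_fromBlocks (continuous_coe_of_continuousOn hG.1) continuous_const
    continuous_const continuous_const

theorem continuous_Baug0 (hG : G.IsContinuousOn P) :
    Continuous fun ρ : P => Baug0 G F (ρ : Fin s → ℝ) :=
  continuous_fromRows (continuous_coe_of_continuousOn hG.2.2.1).neg continuous_const

theorem continuous_Baug1 (hG : G.IsContinuousOn P) :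
    Continuous fun ρ : P => Baug1 G nψ (ρ : Fin s → ℝ) :=
  continuous_fromRows (continuous_coe_of_continuousOn hG.2.1) continuous_const

theorem continuous_Baug2 (hG : G.IsContinuousOn P) :
    Continuous fun ρ : P => Baug2 G F (ρ : Fin s → ℝ) :=
  continuous_fromRows (continuous_coe_of_continuousOn hG.2.2.1) continuous_const

theorem continuous_Caug1 (hG : G.IsContinuousOn P) :
    Continuous fun ρ : P => Caug1 G nψ (ρ : Fin s → ℝ) :=
  continuous_fromCols (continuous_coe_of_continuousOn hG.2.2.2.1) continuous_const

theorem continuous_Caug2 (hG : G.IsContinuousOn P) :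
    Continuous fun ρ : P => Caug2 G nψ (ρ : Fin s → ℝ) :=
  continuous_fromCols (continuous_coe_of_continuousOn hG.2.2.2.2.2.2.1) continuous_const

theorem continuous_dataAR (hG : G.IsContinuousOn P) (hR : IsC1Near P R) :
    Continuous fun p : P × V => dataAR G F R (p.2 : Fin s → ℝ) (p.1 : Fin s → ℝ) := by
  have h1 := (continuous_Aaug G F hG).matrix_mul (continuous_coe_of_continuousOn hR.continuousOn)
  exact (continuous_He (h1.comp continuous_fst)).sub hR.continuous_symRate

theorem continuous_dataAS (hG : G.IsContinuousOn P) (hS : IsC1Near P S) :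
    Continuous fun p : P × V => dataAS G F S (p.2 : Fin s → ℝ) (p.1 : Fin s → ℝ) := by
  have h1 := (continuous_coe_of_continuousOn hS.continuousOn).matrix_mul (continuous_Aaug G F hG)
  exact (continuous_He (h1.comp continuous_fst)).add hS.continuous_symRate

theorem continuous_dataBR (hG : G.IsContinuousOn P) (hR : IsC1Near P R) :
    Continuous fun ρ : P => dataBR G F R (ρ : Fin s → ℝ) := by
  have hRc := continuous_coe_of_continuousOn hR.continuousOn
  exact continuous_fromRows (continuous_Baug0 G F hG).matrix_transpose
    (continuous_fromRows (continuous_Baug1 G hG).matrix_transpose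
      (continuous_fromRows (continuous_const.matrix_mul hRc)
        ((continuous_Caug1 G hG).matrix_mul hRc)))

theorem continuous_dataBS (hG : G.IsContinuousOn P) (hS : IsC1Near P S) :
    Continuous fun ρ : P => dataBS G F S (ρ : Fin s → ℝ) := by
  have hSc := continuous_coe_of_continuousOn hS.continuousOn
  exact continuous_fromRows ((continuous_Baug0 G F hG).matrix_transpose.matrix_mul hSc)
    (continuous_fromRows ((continuous_Baug1 G hG).matrix_transpose.matrix_mul hSc)
      (continuous_fromRows continuous_const (continuous_Caug1 G hG)))

theorem continuous_weightW (hXs : ∀ k, ContinuousOn (Xs k) P)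
    (hpos : ∀ ρ ∈ P, ∀ k, (Xs k ρ).PosDef) :
    Continuous fun ρ : P => weightW Xs (ρ : Fin s → ℝ) :=
  continuous_finsetSum _ fun k _ => continuous_matrix_inv (continuous_coe_of_continuousOn (hXs k))
    fun ρ => (hpos ρ ρ.2 k).det_pos.ne'.isUnit

theorem continuous_blockDiagonal (hXs : ∀ k, ContinuousOn (Xs k) P) :
    Continuous fun ρ : P => Matrix.blockDiagonal fun k => Xs k (ρ : Fin s → ℝ) :=
  Continuous.matrix_blockDiagonal (continuous_pi fun k => continuous_coe_of_continuousOn (hXs k))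

theorem continuous_dataN (hG : G.IsContinuousOn P) (hXs : ∀ k, ContinuousOn (Xs k) P)
    (hpos : ∀ ρ ∈ P, ∀ k, (Xs k ρ).PosDef) :
    Continuous fun ρ : P => dataN G F Xs γ (ρ : Fin s → ℝ) := by
  have h11 := continuous_coe_of_continuousOn hG.2.2.2.2.1
  have h12 := continuous_coe_of_continuousOn hG.2.2.2.2.2.1
  exact continuous_symBlock (continuous_weightW Xs hXs hpos).neg
      (continuous_fromRows continuous_const (continuous_fromRows continuous_const h12.neg))
      (continuous_symBlock continuous_const (continuous_fromRows continuous_const h11)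
        (continuous_symBlock (continuous_blockDiagonal Xs hXs).neg
          continuous_const continuous_const))

theorem continuous_dataU (hG : G.IsContinuousOn P) :
    Continuous fun ρ : P => dataU F nd (G.Dp12 (ρ : Fin s → ℝ)) := by
  have h12 := continuous_coe_of_continuousOn hG.2.2.2.2.2.1
  exact continuous_fromCols continuous_const (continuous_fromCols continuous_const
      (continuous_fromCols continuous_const h12.matrix_transpose))

theorem continuous_dataC (hG : G.IsContinuousOn P) :
    Continuous fun ρ : P =>
      (dataC G nψ (ρ : Fin s → ℝ) : Matrix (MeasIdx nu ny) (AugIdx np nψ) ℝ) :=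
  continuous_fromRows (continuous_Caug2 G hG) continuous_const

theorem continuous_dataY (hG : G.IsContinuousOn P) :
    Continuous fun ρ : P => dataY G N (ρ : Fin s → ℝ) := by
  have h21 := continuous_coe_of_continuousOn hG.2.2.2.2.2.2.2
  exact continuous_fromRows (continuous_fromCols continuous_const
      (continuous_fromCols h21 continuous_const)) continuous_const

/-- The loop form depends continuously on the parameter, the rate, the gains and the vector. -/
theorem continuous_loopForm (hG : G.IsContinuousOn P) (hR : IsC1Near P R) (hS : IsC1Near P S)
    (hXs : ∀ k, ContinuousOn (Xs k) P) (hpos : ∀ ρ ∈ P, ∀ k, (Xs k ρ).PosDef)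
    {T : Type*} [TopologicalSpace T] {ρ : T → P} {ν : T → V}
    {K : T → Gains (AugIdx np nψ) (Fin nu) (MeasIdx nu ny)} {v : T → LoopSpace np nψ nu nd ne N}
    (hρ : Continuous ρ) (hν : Continuous ν) (hK : Continuous K) (hv : Continuous v) :
    Continuous fun t =>
      loopForm G F R S Xs γ (ρ t : Fin s → ℝ) (ν t : Fin s → ℝ) (K t) (v t) := by
  have h1 := (continuous_dataAR (V := V) G F R hG hR).comp (hρ.prodMk hν)
  have h2 := (continuous_dataAS (V := V) G F S hG hS).comp (hρ.prodMk hν)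
  have h3 := (continuous_dataBR G F R hG hR).comp hρ
  have h4 := (continuous_dataBS G F S hG hS).comp hρ
  have h5 := (continuous_dataN G F Xs γ hG hXs hpos).comp hρ
  have h6 := (continuous_Baug2 G F hG).matrix_transpose.comp hρ
  have h7 := (continuous_dataU G F hG).comp hρ
  have h8 := (continuous_dataC (nψ := nψ) G hG).comp hρ
  have h9 := (continuous_dataY (N := N) G hG).comp hρ
  simp only [Function.comp_def] at h1 h2 h3 h4 h5 h6 h7 h8 h9
  unfold loopForm
  exact continuous_synthForm h1 h2 h3 h4 h5 h6 h7 h8 h9 hK hv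

theorem convex_gains (t : Set (Fin s → ℝ)) (ρ : Fin s → ℝ) :
    Convex ℝ {K : Gains (AugIdx np nψ) (Fin nu) (MeasIdx nu ny) |
      ∀ ν ∈ t, ∀ v, v ≠ 0 → loopForm G F R S Xs γ ρ ν K v < 0} := by
  intro K hK L hL a b ha hb hab ν hν v hv
  have h1 : loopForm G F R S Xs γ ρ ν (a • K + b • L) v =
      a * loopForm G F R S Xs γ ρ ν K v + b * loopForm G F R S Xs γ ρ ν L v := by
    obtain rfl : b = 1 - a := by linarith
    simp only [loopForm, synthForm, Prod.smul_fst, Prod.smul_snd, Prod.fst_add, Prod.snd_add,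
      Matrix.add_mulVec, Matrix.smul_mulVec, dotProduct_add, dotProduct_smul, smul_eq_mul]
    ring
  rw [h1]
  have hK' := hK ν hν v hv
  have hL' := hL ν hν v hv
  rcases eq_or_lt_of_le ha with rfl | ha'
  · obtain rfl : b = 1 := by linarith
    linarith
  · nlinarith

/-- The gains are chosen continuously: they form convex sets, and each choice stays valid at
nearby parameters. -/
theorem exists_continuous_gains (νlo νhi : Fin s → ℝ)
    (hG : G.IsContinuousOn P) (hR : IsC1Near P R) (hS : IsC1Near P S)
    (hXs : ∀ k, ContinuousOn (Xs k) P) (hpos : ∀ ρ ∈ P, ∀ k, (Xs k ρ).PosDef)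
    (h : ∀ ρ ∈ P, ∃ K : Gains (AugIdx np nψ) (Fin nu) (MeasIdx nu ny),
      ∀ ν ∈ Icc νlo νhi, ∀ v, v ≠ 0 → loopForm G F R S Xs γ ρ ν K v < 0) :
    ∃ K : (Fin s → ℝ) → Gains (AugIdx np nψ) (Fin nu) (MeasIdx nu ny), ContinuousOn K P ∧
      ∀ ρ ∈ P, ∀ ν ∈ Icc νlo νhi, ∀ v, v ≠ 0 → loopForm G F R S Xs γ ρ ν (K ρ) v < 0 := by
  classical
  obtain ⟨K, hK⟩ := exists_continuous_forall_mem_convex_of_local_const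
    (t := fun ρ : P => {K : Gains (AugIdx np nψ) (Fin nu) (MeasIdx nu ny) |
      ∀ ν ∈ Icc νlo νhi, ∀ v, v ≠ 0 → loopForm G F R S Xs γ ρ ν K v < 0})
    (fun ρ => convex_gains G F R S Xs γ _ _) (fun ρ => by
      obtain ⟨K, hK⟩ := h ρ ρ.2
      have hV : CompactSpace (Icc νlo νhi) := isCompact_iff_compactSpace.1 isCompact_Icc
      refine ⟨K, ?_⟩
      have := eventually_forall_form_neg (Y := P) (Z := Icc νlo νhi)
        (E := LoopSpace np nψ nu nd ne N)
        (fun ρ ν v => loopForm G F R S Xs γ ρ ν K v)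
        (continuous_loopForm G F R S Xs γ hG hR hS hXs hpos continuous_fst
          (continuous_fst.comp continuous_snd) continuous_const
          (continuous_snd.comp continuous_snd))
        (fun ρ ν c v => loopForm_smul G F R S Xs γ ρ ν K c v) ρ (fun ν v hv => hK ν ν.2 v hv)
      filter_upwards [this] with ρ' hρ' ν hν v hv using hρ' ⟨ν, hν⟩ v hv)
  refine ⟨fun ρ => if hρ : ρ ∈ P then K ⟨ρ, hρ⟩ else 0, ?_, fun ρ hρ ν hν v hv => ?_⟩
  · rw [continuousOn_iff_continuous_domRestrict]
    convert K.continuous using 1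
    funext ρ
    simp
  · simp only [hρ, dite_true]
    exact hK ⟨ρ, hρ⟩ ν hν v hv

end Selection

/-! ### The controller and the dissipation identity -/

section Algebra

variable {s np nu nd ne ny N nψ : ℕ} (G : Plant s np nu nd ne ny) (F : IQCFilter N nψ nu)
  (R S : (Fin s → ℝ) → Matrix (AugIdx np nψ) (AugIdx np nψ) ℝ)
  (Xs : Fin N → (Fin s → ℝ) → Matrix (Fin nu) (Fin nu) ℝ) (γ : ℝ)

theorem dotProduct_transpose_mulVec {m n : Type} [Fintype m] [Fintype n] (M : Matrix m n ℝ)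
    (a : n → ℝ) (b : m → ℝ) : a ⬝ᵥ (Mᵀ *ᵥ b) = b ⬝ᵥ (M *ᵥ a) := by
  rw [Matrix.dotProduct_mulVec, Matrix.vecMul_transpose, dotProduct_comm]

theorem transpose_mulVec_dotProduct {m n : Type} [Fintype m] [Fintype n] (M : Matrix m n ℝ)
    (a : n → ℝ) (b : m → ℝ) : Mᵀ *ᵥ b ⬝ᵥ a = b ⬝ᵥ (M *ᵥ a) := by
  rw [dotProduct_comm, dotProduct_transpose_mulVec]

theorem mulVec_sumElim {l m n : Type} [Fintype m] [Fintype n] (M : Matrix l (m ⊕ n) ℝ)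
    (a : m → ℝ) (b : n → ℝ) : M *ᵥ Sum.elim a b = M.toCols₁ *ᵥ a + M.toCols₂ *ᵥ b := by
  conv_lhs => rw [← Matrix.fromCols_toCols M]
  rw [Matrix.fromCols_mulVec_sumElim]

/-- The loop form written out in the individual signals. -/
theorem loopForm_eq (ρ ν : Fin s → ℝ) (K : Gains (AugIdx np nψ) (Fin nu) (MeasIdx nu ny))
    (ξ ε : AugIdx np nψ → ℝ) (w : Fin nu → ℝ) (d : Fin nd → ℝ) (z : Fin nu × Fin N → ℝ)
    (e : Fin ne → ℝ) :
    loopForm G F R S Xs γ ρ ν K (ξ, ε, chan w d z e) =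
      2 * (ξ ⬝ᵥ (Aaug G F ρ *ᵥ (R ρ *ᵥ ξ))) - ξ ⬝ᵥ (symRate R ν ρ *ᵥ ξ)
        + 2 * (ε ⬝ᵥ (S ρ *ᵥ (Aaug G F ρ *ᵥ ε))) + ε ⬝ᵥ (symRate S ν ρ *ᵥ ε)
        - w ⬝ᵥ (weightW Xs ρ *ᵥ w) + 2 * (z ⬝ᵥ (F.Dψ2s *ᵥ w)) - 2 * (e ⬝ᵥ (G.Dp12 ρ *ᵥ w))
        - γ * (d ⬝ᵥ d) + 2 * (e ⬝ᵥ (G.Dp11 ρ *ᵥ d))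
        - z ⬝ᵥ ((Matrix.blockDiagonal fun k => Xs k ρ) *ᵥ z) - γ * (e ⬝ᵥ e)
        + 2 * (ξ ⬝ᵥ (Baug0 G F ρ *ᵥ w) + ξ ⬝ᵥ (Baug1 G nψ ρ *ᵥ d)
          + z ⬝ᵥ (F.Caug0 np *ᵥ (R ρ *ᵥ ξ)) + e ⬝ᵥ (Caug1 G nψ ρ *ᵥ (R ρ *ᵥ ξ)))
        + 2 * (S ρ *ᵥ ε ⬝ᵥ (Baug0 G F ρ *ᵥ w) + S ρ *ᵥ ε ⬝ᵥ (Baug1 G nψ ρ *ᵥ d)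
          + z ⬝ᵥ (F.Caug0 np *ᵥ ε) + e ⬝ᵥ (Caug1 G nψ ρ *ᵥ ε))
        + 2 * (ξ ⬝ᵥ (Baug2 G F ρ *ᵥ (K.1 *ᵥ ξ)) + z ⬝ᵥ (F.Dψ1s *ᵥ (K.1 *ᵥ ξ))
          + e ⬝ᵥ (G.Dp12 ρ *ᵥ (K.1 *ᵥ ξ)))
        + 2 * (ξ ⬝ᵥ (Baug2 G F ρ *ᵥ (K.2.2.1 *ᵥ Sum.elim (G.Dp21 ρ *ᵥ d) w)))
        + 2 * (z ⬝ᵥ (F.Dψ1s *ᵥ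
              (K.2.2.1 *ᵥ Sum.elim (Caug2 G nψ ρ *ᵥ ε + G.Dp21 ρ *ᵥ d) w))
          + e ⬝ᵥ (G.Dp12 ρ *ᵥ
              (K.2.2.1 *ᵥ Sum.elim (Caug2 G nψ ρ *ᵥ ε + G.Dp21 ρ *ᵥ d) w)))
        + 2 * (ε ⬝ᵥ (K.2.1 *ᵥ Sum.elim (Caug2 G nψ ρ *ᵥ ε + G.Dp21 ρ *ᵥ d) w))
        + 2 * (ε ⬝ᵥ (K.2.2.2 *ᵥ ξ)) := by
  have hsum : dataC G nψ ρ *ᵥ ε + dataY G N ρ *ᵥ chan w d z e =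
      Sum.elim (Caug2 G nψ ρ *ᵥ ε + G.Dp21 ρ *ᵥ d) w := by
    rw [dataC_mulVec, dataY_mulVec]
    ext (i | i) <;> simp
  simp only [loopForm, synthForm]
  rw [hsum, form_dataN, dataY_mulVec, dataU_mulVec]
  simp only [dataAR, dataAS, dataBR, dataBS, Matrix.sub_mulVec, Matrix.add_mulVec, dotProduct_sub,
    dotProduct_add, form_He, Matrix.fromRows_mulVec, sumElim_dotProduct_sumElim,
    ← Matrix.mulVec_mulVec, dotProduct_transpose_mulVec, transpose_mulVec_dotProduct,
    add_dotProduct]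
  ring

/-- The controller with transformed gains `K = (Ĉ, B̂, D, Â)`. Its state is an estimate of the
augmented plant state `x`; the transformed states are `ξ = R⁻¹ xc` and `ε = x - xc`. -/
noncomputable def gainController (K : (Fin s → ℝ) → Gains (AugIdx np nψ) (Fin nu) (MeasIdx nu ny)) :
    Controller s nu ny (AugIdx np nψ) where
  Ac ρ ν := ((R ρ)⁻¹ - S ρ)⁻¹ *
    ((K ρ).2.2.2 - (Aaug G F ρ)ᵀ - (Baug2 G F ρ * (K ρ).2.2.1.toCols₁ * Caug2 G nψ ρ)ᵀ
      - S ρ * Aaug G F ρ * R ρ - S ρ * Baug2 G F ρ * (K ρ).1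
      - ((K ρ).2.1.toCols₁ - S ρ * Baug2 G F ρ * (K ρ).2.2.1.toCols₁) * Caug2 G nψ ρ * R ρ
      + (R ρ)⁻¹ * symRate R ν ρ) * (R ρ)⁻¹
  Bc1 ρ := ((R ρ)⁻¹ - S ρ)⁻¹ *
    ((K ρ).2.1.toCols₁ - S ρ * Baug2 G F ρ * (K ρ).2.2.1.toCols₁)
  Bc2 ρ := ((R ρ)⁻¹ - S ρ)⁻¹ *
    ((K ρ).2.1.toCols₂ - S ρ * Baug2 G F ρ * (K ρ).2.2.1.toCols₂)
  Cc ρ := (K ρ).1 * (R ρ)⁻¹ - (K ρ).2.2.1.toCols₁ * Caug2 G nψ ρ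
  Dc1 ρ := (K ρ).2.2.1.toCols₁
  Dc2 ρ := (K ρ).2.2.1.toCols₂

/-- The storage function `xᵀR⁻¹x + (x - xc)ᵀ(S - R⁻¹)(x - xc)` at fixed parameter. -/
noncomputable def storage (ρ : Fin s → ℝ) (x xc : AugIdx np nψ → ℝ) : ℝ :=
  x ⬝ᵥ ((R ρ)⁻¹ *ᵥ x) + (x - xc) ⬝ᵥ ((S ρ - (R ρ)⁻¹) *ᵥ (x - xc))

/-- The derivative of the storage function along `ẋ = f`, `ẋc = g`, `ρ̇ = ν`. -/
noncomputable def storageRate (ρ ν : Fin s → ℝ) (x xc f g : AugIdx np nψ → ℝ) : ℝ :=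
  2 * (x ⬝ᵥ ((R ρ)⁻¹ *ᵥ f)) - (R ρ)⁻¹ *ᵥ x ⬝ᵥ (symRate R ν ρ *ᵥ ((R ρ)⁻¹ *ᵥ x))
    + 2 * ((x - xc) ⬝ᵥ ((S ρ - (R ρ)⁻¹) *ᵥ (f - g)))
    + (x - xc) ⬝ᵥ (symRate S ν ρ *ᵥ (x - xc))
    + (R ρ)⁻¹ *ᵥ (x - xc) ⬝ᵥ (symRate R ν ρ *ᵥ ((R ρ)⁻¹ *ᵥ (x - xc)))

theorem posDef_sub_inv {n : Type} [Fintype n] [DecidableEq n] {A B : Matrix n n ℝ}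
    (hA : A.PosDef) (h : (Matrix.fromBlocks A 1 1 B).PosDef) : (B - A⁻¹).PosDef := by
  have hs : (Matrix.fromBlocks A 1 1 B)ᵀ = Matrix.fromBlocks A 1 1 B := PosDef_transpose h
  rw [Matrix.fromBlocks_transpose, Matrix.fromBlocks_inj] at hs
  have hAt := PosDef_transpose hA.inv
  refine Matrix.PosDef.of_dotProduct_mulVec_pos ?_ fun v hv => ?_
  · rw [Matrix.IsHermitian, Matrix.conjTranspose_eq_transpose_of_trivial, Matrix.transpose_sub,
      hs.2.2.2, hAt]
  -- Schur complement
  · have h1 := PosDef_form_pos h (v := Sum.elim (-(A⁻¹ *ᵥ v)) v) (sumElim_ne_zero.2 (Or.inr hv))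
    have h2 : A *ᵥ (A⁻¹ *ᵥ v) = v := by
      rw [Matrix.mulVec_mulVec, Matrix.mul_nonsing_inv _ hA.det_pos.ne'.isUnit, Matrix.one_mulVec]
    rw [Matrix.fromBlocks_mulVec, sumElim_dotProduct_sumElim] at h1
    simp only [Sum.elim_comp_inl, Sum.elim_comp_inr, Matrix.mulVec_neg, h2, Matrix.one_mulVec,
      neg_add_cancel, dotProduct_zero, zero_add] at h1
    rw [dotProduct_add, dotProduct_neg] at h1
    simp only [star_trivial, Matrix.sub_mulVec, dotProduct_sub]
    linarith

/-- The dissipation identity: for the controller with transformed gains `K`, the derivative of the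
storage function plus the supply rate, with `z` and `e` weighted by multipliers `zt` and `et`, is
the loop form in the transformed states. -/
theorem storageRate_add_supply (K : (Fin s → ℝ) → Gains (AugIdx np nψ) (Fin nu) (MeasIdx nu ny))
    (ρ ν : Fin s → ℝ) (hR : (R ρ).PosDef) (hT : (S ρ - (R ρ)⁻¹).PosDef)
    (x xc : AugIdx np nψ → ℝ) (w u : Fin nu → ℝ) (d : Fin nd → ℝ) (y : Fin ny → ℝ)
    (zt : Fin nu × Fin N → ℝ) (et : Fin ne → ℝ)
    (hy : y = Caug2 G nψ ρ *ᵥ x + G.Dp21 ρ *ᵥ d)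
    (hu : u = (gainController G F R S K).Cc ρ *ᵥ xc + (gainController G F R S K).Dc1 ρ *ᵥ y
      + (gainController G F R S K).Dc2 ρ *ᵥ w) :
    storageRate R S ρ ν x xc
        (Aaug G F ρ *ᵥ x + Baug0 G F ρ *ᵥ w + Baug1 G nψ ρ *ᵥ d + Baug2 G F ρ *ᵥ u)
        ((gainController G F R S K).Ac ρ ν *ᵥ xc + (gainController G F R S K).Bc1 ρ *ᵥ y
          + (gainController G F R S K).Bc2 ρ *ᵥ w)
      + 2 * (zt ⬝ᵥ (F.Caug0 np *ᵥ x + F.Dψ1s *ᵥ u + F.Dψ2s *ᵥ w))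
      + 2 * (et ⬝ᵥ (Caug1 G nψ ρ *ᵥ x + G.Dp11 ρ *ᵥ d + G.Dp12 ρ *ᵥ (u - w)))
      - zt ⬝ᵥ ((Matrix.blockDiagonal fun k => Xs k ρ) *ᵥ zt) - γ * (et ⬝ᵥ et)
      - w ⬝ᵥ (weightW Xs ρ *ᵥ w) - γ * (d ⬝ᵥ d) =
    loopForm G F R S Xs γ ρ ν (K ρ) ((R ρ)⁻¹ *ᵥ xc, x - xc, chan w d zt et) := by
  have hRu : IsUnit (R ρ).det := hR.det_pos.ne'.isUnit
  have hTu : IsUnit ((R ρ)⁻¹ - S ρ).det := by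
    rw [← neg_sub, Matrix.det_neg]
    exact ((isUnit_one.neg).pow _).mul hT.det_pos.ne'.isUnit
  have hZt : ((R ρ)⁻¹)ᵀ = (R ρ)⁻¹ := PosDef_transpose hR.inv
  have hSt : (S ρ)ᵀ = S ρ := by
    have := PosDef_transpose hT
    rwa [Matrix.transpose_sub, hZt, sub_left_inj] at this
  have hZR : ∀ a, (R ρ)⁻¹ *ᵥ (R ρ *ᵥ a) = a := fun a => by
    rw [Matrix.mulVec_mulVec, Matrix.nonsing_inv_mul _ hRu, Matrix.one_mulVec]
  have hRZ : ∀ a, R ρ *ᵥ ((R ρ)⁻¹ *ᵥ a) = a := fun a => by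
    rw [Matrix.mulVec_mulVec, Matrix.mul_nonsing_inv _ hRu, Matrix.one_mulVec]
  have hTT : ∀ a, ((R ρ)⁻¹ - S ρ) *ᵥ (((R ρ)⁻¹ - S ρ)⁻¹ *ᵥ a) = a := fun a => by
    rw [Matrix.mulVec_mulVec, Matrix.mul_nonsing_inv _ hTu, Matrix.one_mulVec]
  obtain ⟨ε, hε⟩ : ∃ ε, ε = x - xc := ⟨_, rfl⟩
  obtain ⟨ξ, rfl⟩ : ∃ ξ, xc = R ρ *ᵥ ξ := ⟨(R ρ)⁻¹ *ᵥ xc, (hRZ xc).symm⟩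
  obtain rfl : x = R ρ *ᵥ ξ + ε := by rw [hε]; abel
  have hd : R ρ *ᵥ ξ + ε - R ρ *ᵥ ξ = ε := by abel
  obtain ⟨m, hm⟩ : ∃ m, m = (K ρ).2.2.1 *ᵥ Sum.elim (Caug2 G nψ ρ *ᵥ ε + G.Dp21 ρ *ᵥ d) w :=
    ⟨_, rfl⟩
  have hu' : u = (K ρ).1 *ᵥ ξ + m := by
    rw [hu, hy, hm, mulVec_sumElim]
    simp only [gainController, Matrix.sub_mulVec, ← Matrix.mulVec_mulVec, hZR, Matrix.mulVec_add]
    abel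
  obtain ⟨f, hf⟩ : ∃ f, f = Aaug G F ρ *ᵥ (R ρ *ᵥ ξ + ε) + Baug0 G F ρ *ᵥ w
    + Baug1 G nψ ρ *ᵥ d + Baug2 G F ρ *ᵥ u := ⟨_, rfl⟩
  obtain ⟨g, hg⟩ : ∃ g, g = (gainController G F R S K).Ac ρ ν *ᵥ (R ρ *ᵥ ξ)
    + (gainController G F R S K).Bc1 ρ *ᵥ y + (gainController G F R S K).Bc2 ρ *ᵥ w := ⟨_, rfl⟩
  -- the gains are defined such that the coefficient of `2ε` in the storage rate has this form
  have hco : S ρ *ᵥ f + ((R ρ)⁻¹ - S ρ) *ᵥ g = S ρ *ᵥ (Aaug G F ρ *ᵥ ε)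
      + S ρ *ᵥ (Baug0 G F ρ *ᵥ w) + S ρ *ᵥ (Baug1 G nψ ρ *ᵥ d) + (K ρ).2.2.2 *ᵥ ξ
      - (Aaug G F ρ)ᵀ *ᵥ ξ
      - (Baug2 G F ρ * (K ρ).2.2.1.toCols₁ * Caug2 G nψ ρ)ᵀ *ᵥ ξ
      + (R ρ)⁻¹ *ᵥ (symRate R ν ρ *ᵥ ξ)
      + (K ρ).2.1 *ᵥ Sum.elim (Caug2 G nψ ρ *ᵥ ε + G.Dp21 ρ *ᵥ d) w := by
    rw [hf, hg, hu', hm, hy, mulVec_sumElim, mulVec_sumElim]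
    simp only [gainController, ← Matrix.mulVec_mulVec, hZR]
    simp only [Matrix.mulVec_add, hTT]
    simp only [Matrix.add_mulVec, Matrix.sub_mulVec, ← Matrix.mulVec_mulVec]
    abel
  rw [← hf, ← hg, hZR, loopForm_eq, hd, ← hm, storageRate, hd]
  have h1 : 2 * ((R ρ *ᵥ ξ + ε) ⬝ᵥ ((R ρ)⁻¹ *ᵥ f)) + 2 * (ε ⬝ᵥ ((S ρ - (R ρ)⁻¹) *ᵥ (f - g))) =
      2 * (ξ ⬝ᵥ f) + 2 * (ε ⬝ᵥ (S ρ *ᵥ f + ((R ρ)⁻¹ - S ρ) *ᵥ g)) := by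
    have h2 : R ρ *ᵥ ξ ⬝ᵥ ((R ρ)⁻¹ *ᵥ f) = ξ ⬝ᵥ f := by
      rw [← hZt, dotProduct_transpose_mulVec, hZR, dotProduct_comm]
    simp only [add_dotProduct, h2, dotProduct_add, Matrix.sub_mulVec, Matrix.mulVec_sub,
      dotProduct_sub]
    ring
  have h3 : (R ρ)⁻¹ *ᵥ (R ρ *ᵥ ξ + ε) = ξ + (R ρ)⁻¹ *ᵥ ε := by
    rw [Matrix.mulVec_add, hZR]
  have h4 : (ξ + (R ρ)⁻¹ *ᵥ ε) ⬝ᵥ (symRate R ν ρ *ᵥ (ξ + (R ρ)⁻¹ *ᵥ ε)) =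
      ξ ⬝ᵥ (symRate R ν ρ *ᵥ ξ) + 2 * (ε ⬝ᵥ ((R ρ)⁻¹ *ᵥ (symRate R ν ρ *ᵥ ξ)))
        + (R ρ)⁻¹ *ᵥ ε ⬝ᵥ (symRate R ν ρ *ᵥ ((R ρ)⁻¹ *ᵥ ε)) := by
    have h5 : ξ ⬝ᵥ (symRate R ν ρ *ᵥ ((R ρ)⁻¹ *ᵥ ε)) =
        ε ⬝ᵥ ((R ρ)⁻¹ *ᵥ (symRate R ν ρ *ᵥ ξ)) := by
      rw [← transpose_symRate, dotProduct_transpose_mulVec, transpose_symRate, dotProduct_comm]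
      conv_rhs => rw [← hZt]
      rw [dotProduct_transpose_mulVec]
    have h6 : (R ρ)⁻¹ *ᵥ ε ⬝ᵥ (symRate R ν ρ *ᵥ ξ) =
        ε ⬝ᵥ ((R ρ)⁻¹ *ᵥ (symRate R ν ρ *ᵥ ξ)) := by
      conv_rhs => rw [← hZt]
      rw [dotProduct_transpose_mulVec, dotProduct_comm]
    simp only [Matrix.mulVec_add, dotProduct_add, add_dotProduct, h5, h6]
    ring
  have h7 : ∀ a : AugIdx np nψ → ℝ, S ρ *ᵥ ε ⬝ᵥ a = ε ⬝ᵥ (S ρ *ᵥ a) := fun a => by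
    conv_rhs => rw [← hSt]
    rw [dotProduct_transpose_mulVec, dotProduct_comm]
  have h8 : ξ ⬝ᵥ (Baug2 G F ρ *ᵥ m) =
      ξ ⬝ᵥ (Baug2 G F ρ *ᵥ ((K ρ).2.2.1 *ᵥ Sum.elim (G.Dp21 ρ *ᵥ d) w))
        + ξ ⬝ᵥ ((Baug2 G F ρ * (K ρ).2.2.1.toCols₁ * Caug2 G nψ ρ) *ᵥ ε) := by
    rw [hm, mulVec_sumElim, mulVec_sumElim]
    simp only [← Matrix.mulVec_mulVec, Matrix.mulVec_add, dotProduct_add]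
    ring
  rw [hco] at h1
  rw [h3, h4]
  rw [hu']
  have h9 : ξ ⬝ᵥ f = ξ ⬝ᵥ (Aaug G F ρ *ᵥ (R ρ *ᵥ ξ)) + ξ ⬝ᵥ (Aaug G F ρ *ᵥ ε)
      + ξ ⬝ᵥ (Baug0 G F ρ *ᵥ w) + ξ ⬝ᵥ (Baug1 G nψ ρ *ᵥ d) + ξ ⬝ᵥ (Baug2 G F ρ *ᵥ ((K ρ).1 *ᵥ ξ))
      + ξ ⬝ᵥ (Baug2 G F ρ *ᵥ m) := by
    rw [hf, hu']
    simp only [Matrix.mulVec_add, dotProduct_add]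
    ring
  rw [h9, h8] at h1
  simp only [dotProduct_add, dotProduct_sub, dotProduct_transpose_mulVec] at h1
  simp only [dotProduct_add, dotProduct_sub, Matrix.mulVec_add, Matrix.mulVec_sub, h7] at h1 ⊢
  linarith

end Algebra

/-! ### Absolutely continuous functions and locally square integrable signals -/

section Calculus

theorem absolutelyContinuousOnInterval_congr {f g : ℝ → ℝ} {a b : ℝ}
    (hf : AbsolutelyContinuousOnInterval f a b) (h : ∀ t ∈ uIcc a b, f t = g t) :
    AbsolutelyContinuousOnInterval g a b := by
  rw [absolutelyContinuousOnInterval_iff] at hf ⊢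
  intro ε hε
  obtain ⟨δ, hδ, hf⟩ := hf ε hε
  refine ⟨δ, hδ, fun E hE hEδ => ?_⟩
  refine lt_of_eq_of_lt (Finset.sum_congr rfl fun i hi => ?_) (hf E hE hEδ)
  rw [h _ (hE.1 i hi).1, h _ (hE.1 i hi).2]

/-- `f` is absolutely continuous on `[0, T]`, with derivative `f'` almost everywhere. -/
structure RateOn (T : ℝ) (f f' : ℝ → ℝ) : Prop where
  ac : AbsolutelyContinuousOnInterval f 0 T
  deriv : ∀ᵐ t ∂volume.restrict (Ioc 0 T), HasDerivAt f (f' t) t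

variable {T : ℝ} {f f' g g' : ℝ → ℝ}

theorem RateOn.congr_ae (h : RateOn T f f') (hg : ∀ᵐ t ∂volume.restrict (Ioc 0 T), f' t = g' t) :
    RateOn T f g' := by
  refine ⟨h.ac, ?_⟩
  filter_upwards [h.deriv, hg] with t h1 h2
  rwa [← h2]

theorem RateOn.intervalIntegrable (hT : 0 ≤ T) (h : RateOn T f f') :
    IntervalIntegrable f' volume 0 T := by
  refine h.ac.intervalIntegrable_deriv.congr_ae ?_
  rw [uIoc_of_le hT]
  filter_upwards [h.deriv] with t ht using ht.deriv

theorem RateOn.integral_eq (hT : 0 ≤ T) (h : RateOn T f f') :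
    ∫ t in (0 : ℝ)..T, f' t = f T - f 0 := by
  rw [← h.ac.integral_deriv_eq_sub]
  refine intervalIntegral.integral_congr_ae_restrict ?_
  rw [uIoc_of_le hT]
  filter_upwards [h.deriv] with t ht using ht.deriv.symm

theorem RateOn.add (hf : RateOn T f f') (hg : RateOn T g g') :
    RateOn T (fun t => f t + g t) (fun t => f' t + g' t) := by
  refine ⟨hf.ac.add hg.ac, ?_⟩
  filter_upwards [hf.deriv, hg.deriv] with t h1 h2 using h1.add h2

theorem RateOn.sub (hf : RateOn T f f') (hg : RateOn T g g') :
    RateOn T (fun t => f t - g t) (fun t => f' t - g' t) := by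
  refine ⟨hf.ac.sub hg.ac, ?_⟩
  filter_upwards [hf.deriv, hg.deriv] with t h1 h2 using h1.sub h2

theorem RateOn.mul (hf : RateOn T f f') (hg : RateOn T g g') :
    RateOn T (fun t => f t * g t) (fun t => f' t * g t + f t * g' t) := by
  refine ⟨hf.ac.mul hg.ac, ?_⟩
  filter_upwards [hf.deriv, hg.deriv] with t h1 h2 using h1.mul h2

theorem RateOn.const (c : ℝ) : RateOn T (fun _ => c) (fun _ => 0) :=
  ⟨(LipschitzWith.const c).lipschitzOnWith.absolutelyContinuousOnInterval,
    Eventually.of_forall fun t => hasDerivAt_const t c⟩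

theorem RateOn.sum {ι : Type*} (s : Finset ι) {f f' : ι → ℝ → ℝ}
    (h : ∀ i, RateOn T (f i) (f' i)) :
    RateOn T (fun t => ∑ i ∈ s, f i t) (fun t => ∑ i ∈ s, f' i t) := by
  classical
  induction s using Finset.induction_on with
  | empty => simpa using RateOn.const 0
  | insert a s ha ih =>
    simp only [Finset.sum_insert ha]
    exact (h a).add ih

theorem RateOn.mulVec {m n : Type} [Fintype n] {M M' : ℝ → Matrix m n ℝ} {x x' : ℝ → n → ℝ}
    (hM : ∀ i j, RateOn T (fun t => M t i j) (fun t => M' t i j))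
    (hx : ∀ i, RateOn T (fun t => x t i) (fun t => x' t i)) (i : m) :
    RateOn T (fun t => (M t *ᵥ x t) i) (fun t => (M' t *ᵥ x t + M t *ᵥ x' t) i) := by
  have := RateOn.sum Finset.univ fun j => (hM i j).mul (hx j)
  simp only [Matrix.mulVec, dotProduct, Pi.add_apply]
  simpa only [Finset.sum_add_distrib] using this

theorem RateOn.dotProduct {n : Type} [Fintype n] {x x' y y' : ℝ → n → ℝ}
    (hx : ∀ i, RateOn T (fun t => x t i) (fun t => x' t i))
    (hy : ∀ i, RateOn T (fun t => y t i) (fun t => y' t i)) :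
    RateOn T (fun t => x t ⬝ᵥ y t) (fun t => x' t ⬝ᵥ y t + x t ⬝ᵥ y' t) := by
  have := RateOn.sum Finset.univ fun j => (hx j).mul (hy j)
  simp only [_root_.dotProduct]
  simpa only [Finset.sum_add_distrib] using this

/-- The derivative of a quadratic form with varying symmetric matrix. -/
theorem RateOn.form {n : Type} [Fintype n] {M M' : ℝ → Matrix n n ℝ} {x x' : ℝ → n → ℝ}
    (hM : ∀ i j, RateOn T (fun t => M t i j) (fun t => M' t i j))
    (hx : ∀ i, RateOn T (fun t => x t i) (fun t => x' t i))
    (hs : ∀ t ∈ Ioc 0 T, (M t)ᵀ = M t) :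
    RateOn T (fun t => x t ⬝ᵥ (M t *ᵥ x t))
      (fun t => 2 * (x t ⬝ᵥ (M t *ᵥ x' t)) + x t ⬝ᵥ (M' t *ᵥ x t)) := by
  refine (RateOn.dotProduct hx (RateOn.mulVec hM hx)).congr_ae ?_
  filter_upwards [ae_restrict_mem measurableSet_Ioc] with t ht
  have h1 : x' t ⬝ᵥ (M t *ᵥ x t) = x t ⬝ᵥ (M t *ᵥ x' t) := by
    conv_lhs => rw [← hs t ht]
    rw [dotProduct_transpose_mulVec]
  rw [dotProduct_add, h1]
  ring

theorem HasRate.continuousOn {ι : Type} [Fintype ι] {x f : ℝ → ι → ℝ} (h : HasRate x f) :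
    ContinuousOn x (Ici 0) := by
  intro t ht
  have h1 : IntervalIntegrable f volume 0 (t + 1) := (h (t + 1) (by linarith [mem_Ici.1 ht])).1
  have h2 := intervalIntegral.continuousOn_primitive_interval' h1 left_mem_uIcc
  rw [uIcc_of_le (by linarith [mem_Ici.1 ht])] at h2
  have h3 : ContinuousOn x (Icc 0 (t + 1)) :=
    (continuousOn_const.add h2).congr fun s hs => (h s hs.1).2
  refine (h3 t ⟨ht, by linarith⟩).mono_of_mem_nhdsWithin ?_
  rw [← Ici_inter_Iic]
  exact inter_mem_nhdsWithin _ (Iic_mem_nhds (by linarith))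

theorem HasRate.rateOn {ι : Type} [Fintype ι] {x f : ℝ → ι → ℝ} (h : HasRate x f) (hT : 0 ≤ T)
    (i : ι) : RateOn T (fun t => x t i) (fun t => f t i) := by
  have hint : ∀ t, 0 ≤ t → IntervalIntegrable (fun t => f t i) volume 0 t := fun t ht =>
    ⟨((h t ht).1.1).eval i, ((h t ht).1.2).eval i⟩
  have hx : ∀ t, 0 ≤ t → x t i = x 0 i + ∫ σ in (0 : ℝ)..t, f σ i := fun t ht => by
    have h1 := congrFun (h t ht).2 i
    rw [Pi.add_apply] at h1
    rw [h1, intervalIntegral.integral_of_le ht, intervalIntegral.integral_of_le ht,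
      MeasureTheory.eval_integral fun j => ((h t ht).1.1).eval j]
  constructor
  · have h1 := (hint T hT).absolutelyContinuousOnInterval_intervalIntegral (c := 0) left_mem_uIcc
    have h2 := (RateOn.const (T := T) (x 0 i)).ac.add h1
    refine absolutelyContinuousOnInterval_congr h2 fun t ht => ?_
    rw [uIcc_of_le hT] at ht
    exact (hx t ht.1).symm
  · have h1 := (hint (T + 1) (by linarith)).ae_hasDerivAt_integral
    filter_upwards [ae_restrict_of_ae h1, ae_restrict_mem measurableSet_Ioc] with t ht htT
    rw [uIcc_of_le (by linarith)] at ht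
    have h2 := (ht ⟨htT.1.le, by linarith [htT.2]⟩ 0 ⟨le_rfl, by linarith⟩).const_add (x 0 i)
    refine h2.congr_of_eventuallyEq ?_
    filter_upwards [lt_mem_nhds htT.1] with σ hσ using hx σ hσ.le

theorem HasRate.of_rateOn {ι : Type} [Fintype ι] {x f : ℝ → ι → ℝ}
    (h : ∀ T, 0 ≤ T → ∀ i, RateOn T (fun t => x t i) (fun t => f t i)) : HasRate x f := by
  intro t ht
  have h1 : ∀ i, IntervalIntegrable (fun σ => f σ i) volume 0 t := fun i =>
    (h t ht i).intervalIntegrable ht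
  have h2 : IntervalIntegrable f volume 0 t :=
    ⟨Integrable.of_eval fun i => (h1 i).1, Integrable.of_eval fun i => (h1 i).2⟩
  refine ⟨h2, funext fun i => ?_⟩
  have h3 := (h t ht i).integral_eq ht
  rw [Pi.add_apply, intervalIntegral.integral_of_le ht,
    MeasureTheory.eval_integral fun j => (h1 j).1, ← intervalIntegral.integral_of_le ht, h3]
  ring

end Calculus

/-! ### Locally square integrable scalar signals -/

section LocallySquareIntegrable

/-- `f` is square integrable on every `(0, T]`. -/
def LocL2 (f : ℝ → ℝ) : Prop := ∀ T : ℝ, 0 ≤ T → MemLp f 2 (volume.restrict (Ioc 0 T))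

variable {f g : ℝ → ℝ}

theorem LocL2.add (hf : LocL2 f) (hg : LocL2 g) : LocL2 fun t => f t + g t :=
  fun T hT => (hf T hT).add (hg T hT)

theorem LocL2.sub (hf : LocL2 f) (hg : LocL2 g) : LocL2 fun t => f t - g t :=
  fun T hT => (hf T hT).sub (hg T hT)

theorem LocL2.sum {ι : Type*} (s : Finset ι) {f : ι → ℝ → ℝ} (h : ∀ i, LocL2 (f i)) :
    LocL2 fun t => ∑ i ∈ s, f i t :=
  fun T hT => memLp_finsetSum s fun i _ => h i T hT

theorem LocL2.congr_ae (hf : LocL2 f) (h : ∀ᵐ t ∂volume.restrict (Ici (0 : ℝ)), g t = f t) :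
    LocL2 g := fun T hT => (memLp_congr_ae (ae_restrict_of_ae_restrict_of_subset
  (fun _ ht => mem_Ici.2 (mem_Ioc.1 ht).1.le) h)).2 (hf T hT)

theorem LocL2.continuousOn_mul (hf : LocL2 f) (hg : ContinuousOn g (Ici 0)) :
    LocL2 fun t => g t * f t := by
  intro T hT
  have hgT : ContinuousOn g (Icc 0 T) := hg.mono fun t ht => ht.1
  obtain ⟨C, hC⟩ := isCompact_Icc.exists_bound_of_continuousOn hgT
  have hm : AEStronglyMeasurable g (volume.restrict (Ioc 0 T)) :=
    (hgT.mono Ioc_subset_Icc_self).aestronglyMeasurable measurableSet_Ioc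
  refine (hf T hT).of_le_mul (c := C) (hm.mul (hf T hT).1) ?_
  filter_upwards [ae_restrict_mem measurableSet_Ioc] with t ht
  rw [norm_mul]
  exact mul_le_mul_of_nonneg_right (hC t (Ioc_subset_Icc_self ht)) (norm_nonneg _)

theorem LocL2.of_continuousOn (hg : ContinuousOn g (Ici 0)) : LocL2 g := by
  have h1 : LocL2 fun _ => (1 : ℝ) := fun T _ => memLp_const 1
  simpa using h1.continuousOn_mul hg

theorem LocL2.intervalIntegrable_mul (hf : LocL2 f) (hg : LocL2 g) {T : ℝ} (hT : 0 ≤ T) :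
    IntervalIntegrable (fun t => f t * g t) volume 0 T := by
  rw [intervalIntegrable_iff_integrableOn_Ioc_of_le hT]
  exact (hf T hT).integrable_mul (hg T hT)

theorem LocL2.mulVec {m n : Type} [Fintype n] {M : ℝ → Matrix m n ℝ} {v : ℝ → n → ℝ}
    (hM : ∀ i j, ContinuousOn (fun t => M t i j) (Ici 0)) (hv : ∀ j, LocL2 fun t => v t j) (i : m) :
    LocL2 fun t => (M t *ᵥ v t) i :=
  LocL2.sum Finset.univ fun j => (hv j).continuousOn_mul (hM i j)

theorem LocL2.intervalIntegrable_dotProduct {n : Type} [Fintype n] {v w : ℝ → n → ℝ}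
    (hv : ∀ j, LocL2 fun t => v t j) (hw : ∀ j, LocL2 fun t => w t j) {T : ℝ} (hT : 0 ≤ T) :
    IntervalIntegrable (fun t => v t ⬝ᵥ w t) volume 0 T := by
  have := IntervalIntegrable.sum Finset.univ fun j _ => (hv j).intervalIntegrable_mul (hw j) hT
  simpa only [dotProduct, Finset.sum_fn] using this

theorem L2e.locL2 {n : ℕ} {v : ℝ → Fin n → ℝ} (hv : L2e v) (i : Fin n) :
    LocL2 fun t => v t i := by
  intro T hT
  have hm : AEStronglyMeasurable (fun t => v t i) (volume.restrict (Ioc 0 T)) :=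
    ((continuous_apply i).comp_aestronglyMeasurable hv.1).mono_measure
      (Measure.restrict_mono (fun t ht => ht.1.le) le_rfl)
  refine (memLp_two_iff_integrable_sq hm).2 ?_
  have h1 := (intervalIntegrable_iff_integrableOn_Ioc_of_le hT).1 (hv.2 T hT)
  refine Integrable.mono' h1 (hm.pow 2) (Eventually.of_forall fun t => ?_)
  rw [Real.norm_eq_abs, abs_of_nonneg (sq_nonneg _), sq]
  exact Finset.single_le_sum (f := fun j => v t j * v t j) (fun j _ => mul_self_nonneg _)
    (Finset.mem_univ i)

theorem L2e.of_locL2 {n : ℕ} {v : ℝ → Fin n → ℝ} (hv : ∀ i, LocL2 fun t => v t i) : L2e v := by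
  refine ⟨?_, fun T hT => LocL2.intervalIntegrable_dotProduct hv hv hT⟩
  have h1 : ∀ k : ℕ, AEStronglyMeasurable v (volume.restrict (Ioc (0 : ℝ) k)) := fun k =>
    aestronglyMeasurable_iff_aemeasurable.2
      (aemeasurable_pi_lambda _ fun i => (hv i k k.cast_nonneg).1.aemeasurable)
  have h2 : (⋃ k : ℕ, Ioc (0 : ℝ) k) = Ioi 0 := by
    ext t
    simp only [mem_iUnion, mem_Ioc, mem_Ioi, exists_and_left, and_iff_left_iff_imp]
    exact fun _ => exists_nat_ge t
  rw [← Measure.restrict_congr_set Ioi_ae_eq_Ici, ← h2]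
  exact aestronglyMeasurable_iUnion_iff.2 h1

end LocallySquareIntegrable

/-! ### Parameter-dependent matrices along trajectories -/

section Trajectories

variable {s : ℕ} {P : Set (Fin s → ℝ)} {νlo νhi : Fin s → ℝ} {ρ ρ' : ℝ → Fin s → ℝ}

theorem AdmissibleTraj.continuousOn_comp {X : Type*} [TopologicalSpace X] {f : (Fin s → ℝ) → X}
    (h : AdmissibleTraj P νlo νhi ρ ρ') (hf : ContinuousOn f P) :
    ContinuousOn (fun t => f (ρ t)) (Ici 0) :=
  hf.comp h.2.2.continuousOn fun t ht => h.1 t ht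

theorem AdmissibleTraj.exists_lipschitzOnWith (h : AdmissibleTraj P νlo νhi ρ ρ') :
    ∃ K, LipschitzOnWith K ρ (Ici 0) := by
  obtain ⟨C, hC⟩ := (isCompact_Icc (a := νlo) (b := νhi)).isBounded.exists_norm_le
  have hC0 : 0 ≤ C := (norm_nonneg _).trans (hC _ (h.2.1 0 le_rfl))
  refine ⟨⟨C, hC0⟩, LipschitzOnWith.of_dist_le_mul fun a ha b hb => ?_⟩
  have h1 : ρ a - ρ b = ∫ σ in b..a, ρ' σ := by
    rw [(h.2.2 a ha).2, (h.2.2 b hb).2, add_sub_add_left_eq_sub,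
      intervalIntegral.integral_interval_sub_left (h.2.2 a ha).1 (h.2.2 b hb).1]
  rw [dist_eq_norm, h1, Real.dist_eq]
  refine intervalIntegral.norm_integral_le_of_norm_le_const fun σ hσ => hC _ (h.2.1 σ ?_)
  exact (le_min hb ha).trans (mem_uIoc.1 hσ |>.elim (fun h => (min_le_left _ _).trans h.1.le)
    fun h => (min_le_right _ _).trans h.1.le)

theorem AdmissibleTraj.rateOn_comp (hP : IsCompact P) (h : AdmissibleTraj P νlo νhi ρ ρ')
    {g : (Fin s → ℝ) → ℝ} {U : Set (Fin s → ℝ)} (hU : IsOpen U) (hPU : P ⊆ U)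
    (hg : ContDiffOn ℝ 1 g U) {T : ℝ} (hT : 0 ≤ T) :
    RateOn T (fun t => g (ρ t)) (fun t => fderiv ℝ g (ρ t) (ρ' t)) := by
  constructor
  · have hl : LocallyLipschitzOn P g := fun x hx => by
      obtain ⟨K, t, ht, hK⟩ := (hg.contDiffAt (hU.mem_nhds (hPU hx))).exists_lipschitzOnWith
      exact ⟨K, t, mem_nhdsWithin_of_mem_nhds ht, hK⟩
    obtain ⟨K, hK⟩ := hl.exists_lipschitzOnWith_of_compact hP
    obtain ⟨L, hL⟩ := h.exists_lipschitzOnWith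
    have h1 : LipschitzOnWith (K * L) (g ∘ ρ) (uIcc 0 T) := by
      rw [uIcc_of_le hT]
      exact hK.comp (hL.mono fun t ht => ht.1) fun t ht => h.1 t ht.1
    exact h1.absolutelyContinuousOnInterval
  · have h1 : ∀ᵐ t ∂volume.restrict (Ioc 0 T), ∀ i, HasDerivAt (fun t => ρ t i) (ρ' t i) t :=
      ae_all_iff.2 fun i => (h.2.2.rateOn hT i).deriv
    filter_upwards [h1, ae_restrict_mem measurableSet_Ioc] with t ht htT
    have h2 : HasDerivAt ρ (ρ' t) t := hasDerivAt_pi.2 ht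
    have h3 : HasFDerivAt g (fderiv ℝ g (ρ t)) (ρ t) :=
      ((hg.contDiffAt (hU.mem_nhds (hPU (h.1 t htT.1.le)))).differentiableAt
        one_ne_zero).hasFDerivAt
    exact h3.comp_hasDerivAt t h2

theorem rateTerm_apply {m n : Type} (M : (Fin s → ℝ) → Matrix m n ℝ) (ν ρ : Fin s → ℝ) (i : m)
    (j : n) : rateTerm M ν ρ i j = fderiv ℝ (fun ρ => M ρ i j) ρ ν := by
  rw [rateTerm, Matrix.sum_apply]
  conv_rhs => rw [pi_eq_sum_univ' ν, map_sum]
  refine Finset.sum_congr rfl fun k _ => ?_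
  rw [map_smul]
  rfl

theorem IsC1Near.rateOn {m n : Type} {M : (Fin s → ℝ) → Matrix m n ℝ} (hM : IsC1Near P M)
    (hP : IsCompact P) (h : AdmissibleTraj P νlo νhi ρ ρ') {T : ℝ} (hT : 0 ≤ T) (i : m) (j : n) :
    RateOn T (fun t => M (ρ t) i j) (fun t => rateTerm M (ρ' t) (ρ t) i j) := by
  obtain ⟨U, hU, hPU, hMU⟩ := hM
  simp only [rateTerm_apply]
  exact h.rateOn_comp hP hU hPU (hMU i j) hT

theorem contDiffOn_det {n : Type} [Fintype n] [DecidableEq n] {M : (Fin s → ℝ) → Matrix n n ℝ}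
    {U : Set (Fin s → ℝ)} (h : ∀ i j, ContDiffOn ℝ 1 (fun ρ => M ρ i j) U) :
    ContDiffOn ℝ 1 (fun ρ => (M ρ).det) U := by
  simp only [Matrix.det_apply]
  exact ContDiffOn.sum fun σ _ => (contDiffOn_prod fun i _ => h _ _).const_smul _

theorem IsC1Near.inv {n : Type} [Fintype n] [DecidableEq n] {M : (Fin s → ℝ) → Matrix n n ℝ}
    (hM : IsC1Near P M) (hu : ∀ ρ ∈ P, IsUnit (M ρ).det) : IsC1Near P fun ρ => (M ρ)⁻¹ := by
  obtain ⟨U, hU, hPU, hMU⟩ := hM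
  have hd := contDiffOn_det hMU
  refine ⟨U ∩ (fun ρ => (M ρ).det) ⁻¹' {0}ᶜ,
    hd.continuousOn.isOpen_inter_preimage hU isOpen_compl_singleton,
    fun ρ hρ => ⟨hPU hρ, (hu ρ hρ).ne_zero⟩, fun i j => ?_⟩
  have h1 : (fun ρ => (M ρ)⁻¹ i j) = fun ρ => ((M ρ).det)⁻¹ * (M ρ).adjugate i j := by
    funext ρ
    rw [Matrix.inv_def, Ring.inverse_eq_inv', Matrix.smul_apply, smul_eq_mul]
  rw [h1]
  refine ((hd.mono inter_subset_left).inv fun ρ hρ => hρ.2).mul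
    (ContDiffOn.mono ?_ inter_subset_left)
  simp only [Matrix.adjugate_apply]
  refine contDiffOn_det fun k l => ?_
  by_cases hk : k = j
  · subst hk
    simpa using contDiffOn_const
  · simpa [Matrix.updateRow_ne hk] using hMU k l

/-- Along a trajectory, `d(M⁻¹)/dt = -M⁻¹ (dM/dt) M⁻¹`. -/
theorem IsC1Near.rateTerm_inv {n : Type} [Fintype n] [DecidableEq n]
    {M : (Fin s → ℝ) → Matrix n n ℝ} (hM : IsC1Near P M) (hu : ∀ ρ ∈ P, IsUnit (M ρ).det)
    (hP : IsCompact P) (h : AdmissibleTraj P νlo νhi ρ ρ') {T : ℝ} (hT : 0 ≤ T) :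
    ∀ᵐ t ∂volume.restrict (Ioc 0 T), rateTerm (fun ρ => (M ρ)⁻¹) (ρ' t) (ρ t) =
      -((M (ρ t))⁻¹ * rateTerm M (ρ' t) (ρ t) * (M (ρ t))⁻¹) := by
  have h1 : ∀ᵐ t ∂volume.restrict (Ioc 0 T), ∀ i j,
      HasDerivAt (fun t => ∑ k, M (ρ t) i k * (M (ρ t))⁻¹ k j)
        (∑ k, (rateTerm M (ρ' t) (ρ t) i k * (M (ρ t))⁻¹ k j
          + M (ρ t) i k * rateTerm (fun ρ => (M ρ)⁻¹) (ρ' t) (ρ t) k j)) t :=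
    ae_all_iff.2 fun i => ae_all_iff.2 fun j => (RateOn.sum Finset.univ fun k =>
      (hM.rateOn hP h hT i k).mul ((hM.inv hu).rateOn hP h hT k j)).deriv
  filter_upwards [h1, ae_restrict_mem measurableSet_Ioc] with t ht htT
  have h2 : rateTerm M (ρ' t) (ρ t) * (M (ρ t))⁻¹
      + M (ρ t) * rateTerm (fun ρ => (M ρ)⁻¹) (ρ' t) (ρ t) = 0 := by
    ext i j
    have h3 : HasDerivAt (fun t => ∑ k, M (ρ t) i k * (M (ρ t))⁻¹ k j) 0 t := by
      refine (hasDerivAt_const t ((1 : Matrix n n ℝ) i j)).congr_of_eventuallyEq ?_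
      filter_upwards [lt_mem_nhds htT.1] with σ hσ
      rw [← Matrix.mul_apply, Matrix.mul_nonsing_inv _ (hu _ (h.1 σ hσ.le))]
    have h4 := (ht i j).unique h3
    rw [Finset.sum_add_distrib] at h4
    simpa [Matrix.add_apply, Matrix.mul_apply] using h4
  have h5 := congrArg (fun A => (M (ρ t))⁻¹ * A) h2
  simp only [Matrix.mul_add, Matrix.mul_zero, ← Matrix.mul_assoc,
    Matrix.nonsing_inv_mul _ (hu _ (h.1 t htT.1.le)), Matrix.one_mul] at h5
  exact eq_neg_of_add_eq_zero_right h5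

variable {np nψ : ℕ}

/-- The storage function is absolutely continuous along trajectories. -/
theorem rateOn_storage {R S : (Fin s → ℝ) → Matrix (AugIdx np nψ) (AugIdx np nψ) ℝ}
    (hP : IsCompact P) (hR : IsC1Near P R) (hS : IsC1Near P S) (hRp : ∀ ρ ∈ P, (R ρ).PosDef)
    (hT : ∀ ρ ∈ P, (S ρ - (R ρ)⁻¹).PosDef) (h : AdmissibleTraj P νlo νhi ρ ρ') {T : ℝ}
    (hT0 : 0 ≤ T) {x xc f g : ℝ → AugIdx np nψ → ℝ}
    (hx : ∀ i, RateOn T (fun t => x t i) (fun t => f t i))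
    (hxc : ∀ i, RateOn T (fun t => xc t i) (fun t => g t i)) :
    RateOn T (fun t => storage R S (ρ t) (x t) (xc t))
      (fun t => storageRate R S (ρ t) (ρ' t) (x t) (xc t) (f t) (g t)) := by
  have hu : ∀ ρ ∈ P, IsUnit (R ρ).det := fun ρ hρ => (hRp ρ hρ).det_pos.ne'.isUnit
  have hZ := (hR.inv hu).rateOn hP h hT0
  have h1 := RateOn.form (M := fun t => (R (ρ t))⁻¹)
    (M' := fun t => rateTerm (fun ρ => (R ρ)⁻¹) (ρ' t) (ρ t)) hZ hx
    (fun t ht => PosDef_transpose (hRp _ (h.1 t ht.1.le)).inv)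
  have h2 := RateOn.form (M := fun t => S (ρ t) - (R (ρ t))⁻¹) (x := fun t => x t - xc t)
    (x' := fun t => f t - g t)
    (M' := fun t => rateTerm S (ρ' t) (ρ t) - rateTerm (fun ρ => (R ρ)⁻¹) (ρ' t) (ρ t))
    (fun i j => (hS.rateOn hP h hT0 i j).sub (hZ i j)) (fun i => (hx i).sub (hxc i))
    (fun t ht => PosDef_transpose (hT _ (h.1 t ht.1.le)))
  refine (h1.add h2).congr_ae ?_
  filter_upwards [hR.rateTerm_inv hu hP h hT0, ae_restrict_mem measurableSet_Ioc] with t ht htT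
  have hZt : ((R (ρ t))⁻¹)ᵀ = (R (ρ t))⁻¹ := PosDef_transpose (hRp _ (h.1 t htT.1.le)).inv
  have h3 : ∀ v, v ⬝ᵥ (rateTerm (fun ρ => (R ρ)⁻¹) (ρ' t) (ρ t) *ᵥ v) =
      -((R (ρ t))⁻¹ *ᵥ v ⬝ᵥ (symRate R (ρ' t) (ρ t) *ᵥ ((R (ρ t))⁻¹ *ᵥ v))) := fun v => by
    rw [ht, form_symRate, Matrix.neg_mulVec, dotProduct_neg, ← Matrix.mulVec_mulVec,
      ← Matrix.mulVec_mulVec]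
    conv_lhs => rw [← hZt]
    rw [dotProduct_transpose_mulVec, hZt, dotProduct_comm]
  simp only [storageRate, h3, form_symRate, Matrix.sub_mulVec (rateTerm S _ _), dotProduct_sub
    (_ : AugIdx np nψ → ℝ) (rateTerm S _ _ *ᵥ _)]
  ring

end Trajectories

/-! ### Uniform estimates for the closed loop -/

section Norms

theorem norm_sq_le_dotProduct {n : Type} [Fintype n] (v : n → ℝ) : ‖v‖ ^ 2 ≤ v ⬝ᵥ v := by
  have h : ‖v‖ ≤ Real.sqrt (v ⬝ᵥ v) := by
    refine (pi_norm_le_iff_of_nonneg (Real.sqrt_nonneg _)).2 fun i => ?_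
    refine Real.le_sqrt_of_sq_le ?_
    rw [Real.norm_eq_abs, sq_abs, sq]
    exact Finset.single_le_sum (f := fun j => v j * v j) (fun j _ => mul_self_nonneg _)
      (Finset.mem_univ i)
  calc ‖v‖ ^ 2 ≤ Real.sqrt (v ⬝ᵥ v) ^ 2 := by gcongr
    _ = v ⬝ᵥ v := Real.sq_sqrt (dotProduct_self_nonneg_real v)

variable {np nψ nu nd ne N : ℕ}

/-- The sum of squares of all entries. -/
def sumSq (v : LoopSpace np nψ nu nd ne N) : ℝ :=
  v.1 ⬝ᵥ v.1 + v.2.1 ⬝ᵥ v.2.1 + v.2.2 ⬝ᵥ v.2.2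

theorem norm_sq_le_sumSq (v : LoopSpace np nψ nu nd ne N) : ‖v‖ ^ 2 ≤ sumSq v := by
  obtain ⟨a, b, c⟩ := v
  have ha := norm_sq_le_dotProduct a
  have hb := norm_sq_le_dotProduct b
  have hc := norm_sq_le_dotProduct c
  have ha0 := dotProduct_self_nonneg_real a
  have hb0 := dotProduct_self_nonneg_real b
  have hc0 := dotProduct_self_nonneg_real c
  simp only [sumSq, Prod.norm_def]
  rcases max_choice ‖a‖ (max ‖b‖ ‖c‖) with h | h <;> rw [h]
  · linarith
  · rcases max_choice ‖b‖ ‖c‖ with h' | h' <;> rw [h'] <;> linarith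

theorem exists_sumSq_le : ∃ C : ℝ, 0 < C ∧
    ∀ v : LoopSpace np nψ nu nd ne N, sumSq v ≤ C * ‖v‖ ^ 2 := by
  obtain ⟨C, hC, h⟩ := exists_forall_abs_form_le (Y := Unit) (E := LoopSpace np nψ nu nd ne N)
    (fun _ v => sumSq v) (by unfold sumSq; fun_prop) (fun _ c v => by
      simp only [sumSq, Prod.smul_fst, Prod.smul_snd, smul_dotProduct, dotProduct_smul,
        smul_eq_mul]
      ring)
  exact ⟨C, hC, fun v => (le_abs_self _).trans (h () v)⟩

end Norms

theorem continuous_stateMatrix {T : Type*} [TopologicalSpace T] {n p q : Type} [Fintype n]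
    [Fintype p] [Fintype q] {Ti Ah A S R Z Rd : T → Matrix n n ℝ} {B2 : T → Matrix n p ℝ}
    {D : T → Matrix p q ℝ} {C2 : T → Matrix q n ℝ} {C : T → Matrix p n ℝ} {B : T → Matrix n q ℝ}
    (hTi : Continuous Ti) (hAh : Continuous Ah) (hA : Continuous A) (hB2 : Continuous B2)
    (hD : Continuous D) (hC2 : Continuous C2) (hS : Continuous S) (hR : Continuous R)
    (hC : Continuous C) (hB : Continuous B) (hZ : Continuous Z) (hRd : Continuous Rd) :
    Continuous fun t => Ti t * (Ah t - (A t)ᵀ - (B2 t * D t * C2 t)ᵀ - S t * A t * R t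
      - S t * B2 t * C t - (B t - S t * B2 t * D t) * C2 t * R t + Z t * Rd t) * Z t := by
  fun_prop

section Design

variable {s np nu nd ne ny N nψ : ℕ} {G : Plant s np nu nd ne ny} {F : IQCFilter N nψ nu}
  {P : Set (Fin s → ℝ)} {νlo νhi : Fin s → ℝ}
  {R S : (Fin s → ℝ) → Matrix (AugIdx np nψ) (AugIdx np nψ) ℝ}
  {Xs : Fin N → (Fin s → ℝ) → Matrix (Fin nu) (Fin nu) ℝ} {γ : ℝ}
  {K : (Fin s → ℝ) → Gains (AugIdx np nψ) (Fin nu) (MeasIdx nu ny)}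

/-- Continuous transformed gains for which the dissipation form is negative definite on the
parameter set and the rate box, with the Lyapunov and multiplier matrices that certify it. -/
structure IsDesign (G : Plant s np nu nd ne ny) (F : IQCFilter N nψ nu) (P : Set (Fin s → ℝ))
    (νlo νhi : Fin s → ℝ) (R S : (Fin s → ℝ) → Matrix (AugIdx np nψ) (AugIdx np nψ) ℝ)
    (Xs : Fin N → (Fin s → ℝ) → Matrix (Fin nu) (Fin nu) ℝ) (γ : ℝ)
    (K : (Fin s → ℝ) → Gains (AugIdx np nψ) (Fin nu) (MeasIdx nu ny)) : Prop where
  isCompact : IsCompact P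
  plant : G.IsContinuousOn P
  c1R : IsC1Near P R
  c1S : IsC1Near P S
  continuousXs : ∀ k, ContinuousOn (Xs k) P
  pos : 0 < γ
  posR : ∀ ρ ∈ P, (R ρ).PosDef
  posT : ∀ ρ ∈ P, (S ρ - (R ρ)⁻¹).PosDef
  posXs : ∀ ρ ∈ P, ∀ k, (Xs k ρ).PosDef
  continuousK : ContinuousOn K P
  neg : ∀ ρ ∈ P, ∀ ν ∈ Icc νlo νhi, ∀ v, v ≠ 0 → loopForm G F R S Xs γ ρ ν (K ρ) v < 0

namespace IsDesign

theorem continuous_inv (h : IsDesign G F P νlo νhi R S Xs γ K) :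
    Continuous fun ρ : P => (R (ρ : Fin s → ℝ))⁻¹ :=
  continuous_matrix_inv (continuous_coe_of_continuousOn h.c1R.continuousOn)
    fun ρ => (h.posR ρ ρ.2).det_pos.ne'.isUnit

theorem isUnit_sub (h : IsDesign G F P νlo νhi R S Xs γ K) {ρ : Fin s → ℝ} (hρ : ρ ∈ P) :
    IsUnit ((R ρ)⁻¹ - S ρ).det := by
  rw [← neg_sub, Matrix.det_neg]
  exact ((isUnit_one.neg).pow _).mul (h.posT ρ hρ).det_pos.ne'.isUnit

theorem controller_isContinuousOn (h : IsDesign G F P νlo νhi R S Xs γ K) :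
    (gainController G F R S K).IsContinuousOn P (Icc νlo νhi) := by
  have hZ := h.continuous_inv
  have hS := continuous_coe_of_continuousOn h.c1S.continuousOn
  have hR := continuous_coe_of_continuousOn h.c1R.continuousOn
  have hT := continuous_matrix_inv (hZ.sub hS) fun ρ => h.isUnit_sub ρ.2
  have hK := continuous_coe_of_continuousOn h.continuousK
  have hA := continuous_Aaug G F h.plant
  have hB2 := continuous_Baug2 G F h.plant
  have hC2 := continuous_Caug2 (nψ := nψ) G h.plant
  have hC : Continuous fun ρ : P => (K ρ).1 := continuous_fst.comp hK
  have hB : Continuous fun ρ : P => (K ρ).2.1 := (continuous_fst.comp continuous_snd).comp hK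
  have hD : Continuous fun ρ : P => (K ρ).2.2.1 :=
    (continuous_fst.comp (continuous_snd.comp continuous_snd)).comp hK
  have hAh : Continuous fun ρ : P => (K ρ).2.2.2 :=
    (continuous_snd.comp (continuous_snd.comp continuous_snd)).comp hK
  have hSB := hS.matrix_mul hB2
  have hB1 := (continuous_toCols₁ hB).sub (hSB.matrix_mul (continuous_toCols₁ hD))
  have hB2' := (continuous_toCols₂ hB).sub (hSB.matrix_mul (continuous_toCols₂ hD))
  refine ⟨?_, ?_, ?_, ?_, ?_, ?_⟩
  · have hAc := continuous_stateMatrix (T := P × Icc νlo νhi) (hT.comp continuous_fst)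
      (hAh.comp continuous_fst) (hA.comp continuous_fst) (hB2.comp continuous_fst)
      ((continuous_toCols₁ hD).comp continuous_fst) (hC2.comp continuous_fst)
      (hS.comp continuous_fst) (hR.comp continuous_fst) (hC.comp continuous_fst)
      ((continuous_toCols₁ hB).comp continuous_fst) (hZ.comp continuous_fst)
      h.c1R.continuous_symRate
    rw [continuousOn_iff_continuous_domRestrict]
    have hm : Continuous fun p : ↥(P ×ˢ Icc νlo νhi) =>
        ((⟨p.1.1, p.2.1⟩, ⟨p.1.2, p.2.2⟩) : P × Icc νlo νhi) :=
      ((continuous_fst.comp continuous_subtype_val).subtype_mk _).prodMk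
        ((continuous_snd.comp continuous_subtype_val).subtype_mk _)
    have hAc' := hAc.comp hm
    simp only [Function.comp_def] at hAc'
    simp only [gainController]
    exact hAc'
  · exact continuousOn_iff_continuous_domRestrict.2 (hT.matrix_mul hB1)
  · exact continuousOn_iff_continuous_domRestrict.2 (hT.matrix_mul hB2')
  · exact continuousOn_iff_continuous_domRestrict.2
      ((hC.matrix_mul hZ).sub ((continuous_toCols₁ hD).matrix_mul hC2))
  · exact continuousOn_iff_continuous_domRestrict.2 (continuous_toCols₁ hD)
  · exact continuousOn_iff_continuous_domRestrict.2 (continuous_toCols₂ hD)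

/-- The loop form in the original states `(x, xc)`. -/
noncomputable def stateForm (G : Plant s np nu nd ne ny) (F : IQCFilter N nψ nu)
    (R S : (Fin s → ℝ) → Matrix (AugIdx np nψ) (AugIdx np nψ) ℝ)
    (Xs : Fin N → (Fin s → ℝ) → Matrix (Fin nu) (Fin nu) ℝ) (γ : ℝ)
    (K : (Fin s → ℝ) → Gains (AugIdx np nψ) (Fin nu) (MeasIdx nu ny)) (ρ ν : Fin s → ℝ)
    (v : LoopSpace np nψ nu nd ne N) : ℝ :=
  loopForm G F R S Xs γ ρ ν (K ρ) ((R ρ)⁻¹ *ᵥ v.2.1, v.1 - v.2.1, v.2.2)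

theorem stateForm_smul (ρ ν : Fin s → ℝ) (c : ℝ) (v : LoopSpace np nψ nu nd ne N) :
    stateForm G F R S Xs γ K ρ ν (c • v) = c ^ 2 * stateForm G F R S Xs γ K ρ ν v := by
  rw [stateForm, stateForm, ← loopForm_smul]
  simp [Matrix.mulVec_smul, smul_sub]

theorem continuous_stateForm (h : IsDesign G F P νlo νhi R S Xs γ K) :
    Continuous fun p : (P × Icc νlo νhi) × LoopSpace np nψ nu nd ne N =>
      stateForm G F R S Xs γ K (p.1.1 : Fin s → ℝ) (p.1.2 : Fin s → ℝ) p.2 := by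
  have hρ : Continuous fun p : (P × Icc νlo νhi) × LoopSpace np nψ nu nd ne N => p.1.1 :=
    continuous_fst.comp continuous_fst
  have hx : Continuous fun p : (P × Icc νlo νhi) × LoopSpace np nψ nu nd ne N => p.2.1 := by
    fun_prop
  have hxc : Continuous fun p : (P × Icc νlo νhi) × LoopSpace np nψ nu nd ne N => p.2.2.1 := by
    fun_prop
  have hy : Continuous fun p : (P × Icc νlo νhi) × LoopSpace np nψ nu nd ne N => p.2.2.2 := by
    fun_prop
  have hZ := h.continuous_inv.comp hρ
  exact continuous_loopForm G F R S Xs γ h.plant h.c1R h.c1S h.continuousXs h.posXs hρ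
    (continuous_snd.comp continuous_fst) ((continuous_coe_of_continuousOn h.continuousK).comp hρ)
    ((Continuous.matrix_mulVec hZ hxc).prodMk ((hx.sub hxc).prodMk hy))

theorem compactSpace (h : IsDesign G F P νlo νhi R S Xs γ K) : CompactSpace P :=
  isCompact_iff_compactSpace.1 h.isCompact

theorem exists_decay (h : IsDesign G F P νlo νhi R S Xs γ K) :
    ∃ c : ℝ, 0 < c ∧ ∀ ρ ∈ P, ∀ ν ∈ Icc νlo νhi, ∀ v : LoopSpace np nψ nu nd ne N,
      stateForm G F R S Xs γ K ρ ν v ≤ -c * sumSq v := by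
  have hPc := h.compactSpace
  have hV : CompactSpace (Icc νlo νhi) := isCompact_iff_compactSpace.1 isCompact_Icc
  obtain ⟨c, hc, hcv⟩ := exists_forall_form_le_neg (Y := P × Icc νlo νhi)
    (E := LoopSpace np nψ nu nd ne N)
    (fun y v => stateForm G F R S Xs γ K (y.1 : Fin s → ℝ) (y.2 : Fin s → ℝ) v)
    h.continuous_stateForm (fun y c v => stateForm_smul _ _ c v) (fun y v hv => by
      refine h.neg y.1 y.1.2 y.2 y.2.2 _ fun h0 => hv ?_
      have hu : IsUnit (R y.1).det := (h.posR y.1 y.1.2).det_pos.ne'.isUnit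
      have h1 : (R y.1)⁻¹ *ᵥ v.2.1 = 0 := congrArg Prod.fst h0
      have h2 : v.1 - v.2.1 = 0 := congrArg (fun q => q.2.1) h0
      have h3 : v.2.2 = 0 := congrArg (fun q => q.2.2) h0
      have h4 : v.2.1 = 0 := by
        rw [← Matrix.one_mulVec v.2.1, ← Matrix.mul_nonsing_inv _ hu, ← Matrix.mulVec_mulVec, h1,
          Matrix.mulVec_zero]
      rw [h4, sub_zero] at h2
      exact Prod.ext h2 (Prod.ext h4 h3))
  obtain ⟨C, hC, hCv⟩ := exists_sumSq_le (np := np) (nψ := nψ) (nu := nu) (nd := nd) (ne := ne)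
    (N := N)
  refine ⟨c / C, by positivity, fun ρ hρ ν hν v => ?_⟩
  have h1 := hcv (⟨ρ, hρ⟩, ⟨ν, hν⟩) v
  have h2 : c / C * sumSq v ≤ c * ‖v‖ ^ 2 := by
    rw [div_mul_eq_mul_div, div_le_iff₀ hC]
    nlinarith [hCv v]
  linarith

/-- The part of the supply rate that is quadratic in the channels. -/
noncomputable def supplyForm (Xs : Fin N → (Fin s → ℝ) → Matrix (Fin nu) (Fin nu) ℝ) (γ : ℝ)
    (ρ : Fin s → ℝ) (y : ChanIdx nu nd ne N → ℝ) : ℝ :=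
  (fun i => y (Sum.inr (Sum.inr (Sum.inl i)))) ⬝ᵥ ((Matrix.blockDiagonal fun k => Xs k ρ) *ᵥ
      fun i => y (Sum.inr (Sum.inr (Sum.inl i))))
    + γ * ((fun i => y (Sum.inr (Sum.inr (Sum.inr i)))) ⬝ᵥ
      fun i => y (Sum.inr (Sum.inr (Sum.inr i))))
    - (fun i => y (Sum.inl i)) ⬝ᵥ (weightW Xs ρ *ᵥ fun i => y (Sum.inl i))
    - γ * ((fun i => y (Sum.inr (Sum.inl i))) ⬝ᵥ fun i => y (Sum.inr (Sum.inl i)))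

theorem exists_rate_bound (h : IsDesign G F P νlo νhi R S Xs γ K) :
    ∃ C : ℝ, 0 < C ∧ ∀ ρ ∈ P, ∀ ν ∈ Icc νlo νhi, ∀ v : LoopSpace np nψ nu nd ne N,
      |stateForm G F R S Xs γ K ρ ν v - supplyForm Xs γ ρ v.2.2| ≤ C * sumSq v := by
  have hPc := h.compactSpace
  have hV : CompactSpace (Icc νlo νhi) := isCompact_iff_compactSpace.1 isCompact_Icc
  have hρ : Continuous fun p : (P × Icc νlo νhi) × LoopSpace np nψ nu nd ne N => p.1.1 :=
    continuous_fst.comp continuous_fst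
  have hL := (continuous_blockDiagonal Xs h.continuousXs).comp hρ
  have hW := (continuous_weightW Xs h.continuousXs h.posXs).comp hρ
  have hy : ∀ i, Continuous fun p : (P × Icc νlo νhi) × LoopSpace np nψ nu nd ne N =>
      p.2.2.2 i := fun i => by fun_prop
  have hc : Continuous fun p : (P × Icc νlo νhi) × LoopSpace np nψ nu nd ne N =>
      supplyForm Xs γ (p.1.1 : Fin s → ℝ) p.2.2.2 := by
    unfold supplyForm
    refine Continuous.sub (Continuous.sub (Continuous.add ?_ ?_) ?_) ?_
    · exact Continuous.dotProduct (continuous_pi fun i => hy _)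
        (Continuous.matrix_mulVec hL (continuous_pi fun i => hy _))
    · exact continuous_const.mul (Continuous.dotProduct (continuous_pi fun i => hy _)
        (continuous_pi fun i => hy _))
    · exact Continuous.dotProduct (continuous_pi fun i => hy _)
        (Continuous.matrix_mulVec hW (continuous_pi fun i => hy _))
    · exact continuous_const.mul (Continuous.dotProduct (continuous_pi fun i => hy _)
        (continuous_pi fun i => hy _))
  obtain ⟨C, hC, hCv⟩ := exists_forall_abs_form_le (Y := P × Icc νlo νhi)
    (E := LoopSpace np nψ nu nd ne N)
    (fun y v => stateForm G F R S Xs γ K (y.1 : Fin s → ℝ) (y.2 : Fin s → ℝ) v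
      - supplyForm Xs γ (y.1 : Fin s → ℝ) v.2.2)
    (h.continuous_stateForm.sub hc) (fun y c v => by
      have hs : ∀ {ι : Type} (f : ι → ChanIdx nu nd ne N),
          (fun i => (c • v).2.2 (f i)) = c • fun i => v.2.2 (f i) := fun f => rfl
      simp only [stateForm_smul, supplyForm, hs, Matrix.mulVec_smul, smul_dotProduct,
        dotProduct_smul, smul_eq_mul]
      ring)
  refine ⟨C, hC, fun ρ hρ ν hν v => (hCv (⟨ρ, hρ⟩, ⟨ν, hν⟩) v).trans ?_⟩
  exact mul_le_mul_of_nonneg_left (norm_sq_le_sumSq v) hC.le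

theorem exists_storage_bounds (h : IsDesign G F P νlo νhi R S Xs γ K) :
    ∃ α β : ℝ, 0 < α ∧ 0 < β ∧ ∀ ρ ∈ P, ∀ x xc : AugIdx np nψ → ℝ,
      α * ‖(x, xc)‖ ^ 2 ≤ storage R S ρ x xc ∧ storage R S ρ x xc ≤ β * ‖(x, xc)‖ ^ 2 := by
  have hPc := h.compactSpace
  have hZ := h.continuous_inv
  have hS := continuous_coe_of_continuousOn h.c1S.continuousOn
  have hc : Continuous fun p : P × (AugIdx np nψ → ℝ) × (AugIdx np nψ → ℝ) =>
      storage R S (p.1 : Fin s → ℝ) p.2.1 p.2.2 := by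
    have hx : Continuous fun p : P × (AugIdx np nψ → ℝ) × (AugIdx np nψ → ℝ) => p.2.1 := by
      fun_prop
    have he : Continuous fun p : P × (AugIdx np nψ → ℝ) × (AugIdx np nψ → ℝ) =>
      p.2.1 - p.2.2 := by fun_prop
    exact (Continuous.dotProduct hx (Continuous.matrix_mulVec (hZ.comp continuous_fst) hx)).add
      (Continuous.dotProduct he
        (Continuous.matrix_mulVec ((hS.sub hZ).comp continuous_fst) he))
  have hom : ∀ (ρ : P) (c : ℝ) (v : (AugIdx np nψ → ℝ) × (AugIdx np nψ → ℝ)),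
      storage R S (ρ : Fin s → ℝ) (c • v).1 (c • v).2 =
        c ^ 2 * storage R S (ρ : Fin s → ℝ) v.1 v.2 := by
    intro ρ c v
    simp only [storage, Prod.smul_fst, Prod.smul_snd, ← smul_sub, Matrix.mulVec_smul,
      smul_dotProduct, dotProduct_smul, smul_eq_mul]
    ring
  obtain ⟨α, hα, hα'⟩ := exists_forall_form_le_neg (Y := P)
    (E := (AugIdx np nψ → ℝ) × (AugIdx np nψ → ℝ))
    (fun ρ v => -storage R S (ρ : Fin s → ℝ) v.1 v.2) hc.neg
    (fun ρ c v => by rw [hom]; ring) (fun ρ v hv => by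
      have h1 := PosDef_form_nonneg (h.posR ρ ρ.2).inv v.1
      have h2 := PosDef_form_nonneg (h.posT ρ ρ.2) (v.1 - v.2)
      rw [neg_lt_zero, storage]
      by_cases hx : v.1 = 0
      · have hx' : v.1 - v.2 ≠ 0 := fun h0 => hv (by
          rw [hx, zero_sub, neg_eq_zero] at h0
          exact Prod.ext hx h0)
        linarith [PosDef_form_pos (h.posT ρ ρ.2) hx']
      · linarith [PosDef_form_pos (h.posR ρ ρ.2).inv hx])
  obtain ⟨β, hβ, hβ'⟩ := exists_forall_abs_form_le (Y := P)
    (E := (AugIdx np nψ → ℝ) × (AugIdx np nψ → ℝ))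
    (fun ρ v => storage R S (ρ : Fin s → ℝ) v.1 v.2) hc hom
  refine ⟨α, β, hα, hβ, fun ρ hρ x xc => ⟨?_, ?_⟩⟩
  · linarith [hα' ⟨ρ, hρ⟩ (x, xc)]
  · exact (le_abs_self _).trans (hβ' ⟨ρ, hρ⟩ (x, xc))

end IsDesign

end Design

/-! ### Dissipation along closed-loop trajectories -/

section Trajectory

variable {s np nu nd ne ny N nψ : ℕ} {G : Plant s np nu nd ne ny} {F : IQCFilter N nψ nu}
  {P : Set (Fin s → ℝ)} {νlo νhi : Fin s → ℝ}
  {R S : (Fin s → ℝ) → Matrix (AugIdx np nψ) (AugIdx np nψ) ℝ}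
  {Xs : Fin N → (Fin s → ℝ) → Matrix (Fin nu) (Fin nu) ℝ} {γ : ℝ}
  {K : (Fin s → ℝ) → Gains (AugIdx np nψ) (Fin nu) (MeasIdx nu ny)}
  {τ : ℝ → ℝ} {ρ ρ' : ℝ → Fin s → ℝ} {d : ℝ → Fin nd → ℝ} {xp : ℝ → Fin np → ℝ}
  {xψ : ℝ → Fin nψ → ℝ} {xc : ℝ → AugIdx np nψ → ℝ} {u : ℝ → Fin nu → ℝ} {y : ℝ → Fin ny → ℝ}
  {e : ℝ → Fin ne → ℝ}

/-- The weighted filter outputs `Xₖ⁻¹ z₁ₖ`, stacked over `k`. -/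
noncomputable def weightedZ
    (Xs : Fin N → (Fin s → ℝ) → Matrix (Fin nu) (Fin nu) ℝ) (ρ : Fin s → ℝ)
    (z : Fin N → Fin nu → ℝ) : Fin nu × Fin N → ℝ :=
  fun ik => ((Xs ik.2 ρ)⁻¹ *ᵥ z ik.2) ik.1

theorem blockDiagonal_mulVec_weightedZ {ρ : Fin s → ℝ} (hX : ∀ k, (Xs k ρ).PosDef)
    (z : Fin N → Fin nu → ℝ) :
    (Matrix.blockDiagonal fun k => Xs k ρ) *ᵥ weightedZ Xs ρ z = fun ik => z ik.2 ik.1 := by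
  funext ik
  obtain ⟨i, k⟩ := ik
  have h1 : Xs k ρ *ᵥ ((Xs k ρ)⁻¹ *ᵥ z k) = z k := by
    rw [Matrix.mulVec_mulVec, Matrix.mul_nonsing_inv _ (hX k).det_pos.ne'.isUnit,
      Matrix.one_mulVec]
  conv_rhs => rw [← h1]
  simp only [Matrix.mulVec, dotProduct, Matrix.blockDiagonal_apply, Fintype.sum_prod_type,
    weightedZ]
  refine Finset.sum_congr rfl fun j _ => ?_
  simp

theorem weightedZ_dotProduct (ρ : Fin s → ℝ) (z : Fin N → Fin nu → ℝ) :
    weightedZ Xs ρ z ⬝ᵥ (fun ik => z ik.2 ik.1) = ∑ k, z k ⬝ᵥ ((Xs k ρ)⁻¹ *ᵥ z k) := by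
  simp only [dotProduct, Fintype.sum_prod_type_right, weightedZ]
  exact Finset.sum_congr rfl fun k _ => Finset.sum_congr rfl fun i _ => mul_comm _ _

/-- The stacked output of the filters. -/
theorem stacked_output (F : IQCFilter N nψ nu) (a : Fin np → ℝ) (b : Fin nψ → ℝ)
    (u w : Fin nu → ℝ) :
    F.Caug0 np *ᵥ Sum.elim a b + F.Dψ1s *ᵥ u + F.Dψ2s *ᵥ w =
      fun ik => (F.Cψ ik.2 *ᵥ b + F.Dψ1 ik.2 *ᵥ u + F.Dψ2 ik.2 *ᵥ w) ik.1 := by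
  rw [IQCFilter.Caug0, Matrix.fromCols_mulVec_sumElim, Matrix.zero_mulVec, zero_add]
  rfl

/-- The integrand of the `k`-th integral quadratic constraint. -/
noncomputable def iqcTerm (F : IQCFilter N nψ nu)
    (Xs : Fin N → (Fin s → ℝ) → Matrix (Fin nu) (Fin nu) ℝ) (τ : ℝ → ℝ) (ρ : ℝ → Fin s → ℝ)
    (u : ℝ → Fin nu → ℝ) (xψ : ℝ → Fin nψ → ℝ) (k : Fin N) (t : ℝ) : ℝ :=
  F.z1 k u (delayDiff τ u) xψ t ⬝ᵥ ((Xs k (ρ t))⁻¹ *ᵥ F.z1 k u (delayDiff τ u) xψ t)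
    - delayDiff τ u t ⬝ᵥ ((Xs k (ρ t))⁻¹ *ᵥ delayDiff τ u t)

/-- The vector of all closed-loop signals at time `t`, the performance output and the filter
outputs being replaced by their multipliers. -/
noncomputable def loopVec (F : IQCFilter N nψ nu)
    (Xs : Fin N → (Fin s → ℝ) → Matrix (Fin nu) (Fin nu) ℝ) (γ : ℝ) (τ : ℝ → ℝ)
    (ρ : ℝ → Fin s → ℝ) (d : ℝ → Fin nd → ℝ) (xp : ℝ → Fin np → ℝ) (xψ : ℝ → Fin nψ → ℝ)
    (xc : ℝ → AugIdx np nψ → ℝ) (u : ℝ → Fin nu → ℝ) (e : ℝ → Fin ne → ℝ) (t : ℝ) :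
    LoopSpace np nψ nu nd ne N :=
  (Sum.elim (xp t) (xψ t), xc t, chan (delayDiff τ u t) (d t)
    (weightedZ Xs (ρ t) fun k => F.z1 k u (delayDiff τ u) xψ t) (γ⁻¹ • e t))

theorem supplyForm_eq (hγ : 0 < γ) {t : ℝ} (hX : ∀ k, (Xs k (ρ t)).PosDef) :
    IsDesign.supplyForm Xs γ (ρ t) (loopVec F Xs γ τ ρ d xp xψ xc u e t).2.2 =
      ∑ k, iqcTerm F Xs τ ρ u xψ k t + γ⁻¹ * (e t ⬝ᵥ e t) - γ * (d t ⬝ᵥ d t) := by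
  have h1 : IsDesign.supplyForm Xs γ (ρ t) (loopVec F Xs γ τ ρ d xp xψ xc u e t).2.2 =
      (weightedZ Xs (ρ t) fun k => F.z1 k u (delayDiff τ u) xψ t) ⬝ᵥ
        ((Matrix.blockDiagonal fun k => Xs k (ρ t)) *ᵥ
          weightedZ Xs (ρ t) fun k => F.z1 k u (delayDiff τ u) xψ t)
      + γ * ((γ⁻¹ • e t) ⬝ᵥ (γ⁻¹ • e t))
      - delayDiff τ u t ⬝ᵥ (weightW Xs (ρ t) *ᵥ delayDiff τ u t) - γ * (d t ⬝ᵥ d t) := rfl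
  rw [h1, blockDiagonal_mulVec_weightedZ hX, weightedZ_dotProduct, weightW, Matrix.sum_mulVec,
    dotProduct_sum]
  simp only [iqcTerm, Finset.sum_sub_distrib, smul_dotProduct, dotProduct_smul, smul_eq_mul]
  rw [← mul_assoc γ γ⁻¹, mul_inv_cancel₀ hγ.ne']
  ring

theorem rateOn_augState
    (hcl : ClosedLoop G F (gainController G F R S K) τ ρ ρ' d xp xψ xc u y e) {T : ℝ} (hT : 0 ≤ T) (i : AugIdx np nψ) :
    RateOn T (fun t => Sum.elim (xp t) (xψ t) i) (fun t =>
      (Aaug G F (ρ t) *ᵥ Sum.elim (xp t) (xψ t) + Baug0 G F (ρ t) *ᵥ delayDiff τ u t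
        + Baug1 G nψ (ρ t) *ᵥ d t + Baug2 G F (ρ t) *ᵥ u t) i) := by
  rcases i with i | i
  · have h1 := hcl.plant_state.rateOn hT i
    refine h1.congr_ae (Eventually.of_forall fun t => ?_)
    have h2 : delayed τ u t = u t - delayDiff τ u t := by
      rw [delayDiff, sub_sub_cancel]
    simp [Aaug, Baug0, Baug1, Baug2, Matrix.fromBlocks_mulVec, Matrix.fromRows_mulVec, h2,
      Matrix.mulVec_sub, Matrix.neg_mulVec]
    ring
  · have h1 := hcl.filter_state.2.rateOn hT i
    refine h1.congr_ae (Eventually.of_forall fun t => ?_)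
    simp [Aaug, Baug0, Baug1, Baug2, Matrix.fromBlocks_mulVec, Matrix.fromRows_mulVec]
    ring

/-- The storage function along the closed loop. -/
theorem rateOn_storage_closedLoop
    (h : IsDesign G F P νlo νhi R S Xs γ K)
    (htr : AdmissibleTraj P νlo νhi ρ ρ')
    (hcl : ClosedLoop G F (gainController G F R S K) τ ρ ρ' d xp xψ xc u y e) {T : ℝ} (hT : 0 ≤ T) :
    RateOn T (fun t => storage R S (ρ t) (Sum.elim (xp t) (xψ t)) (xc t))
      (fun t => IsDesign.stateForm G F R S Xs γ K (ρ t) (ρ' t)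
          (loopVec F Xs γ τ ρ d xp xψ xc u e t)
        - IsDesign.supplyForm Xs γ (ρ t) (loopVec F Xs γ τ ρ d xp xψ xc u e t).2.2) := by
  have h1 := rateOn_storage h.isCompact h.c1R h.c1S h.posR h.posT htr hT
    (rateOn_augState hcl hT) (fun i => hcl.ctrl_state.rateOn hT i)
  refine h1.congr_ae ?_
  have hsub : Ioc (0 : ℝ) T ⊆ Ici 0 := fun t ht => ht.1.le
  filter_upwards [ae_restrict_of_ae_restrict_of_subset hsub hcl.plant_e,
    ae_restrict_of_ae_restrict_of_subset hsub hcl.plant_y,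
    ae_restrict_of_ae_restrict_of_subset hsub hcl.ctrl_u,
    ae_restrict_mem measurableSet_Ioc] with t he hy hu ht
  have hρ := htr.1 t ht.1.le
  have hy' : y t = Caug2 G nψ (ρ t) *ᵥ Sum.elim (xp t) (xψ t) + G.Dp21 (ρ t) *ᵥ d t := by
    rw [hy, Caug2, Matrix.fromCols_mulVec_sumElim, Matrix.zero_mulVec, add_zero]
  have he' : e t = Caug1 G nψ (ρ t) *ᵥ Sum.elim (xp t) (xψ t) + G.Dp11 (ρ t) *ᵥ d t
      + G.Dp12 (ρ t) *ᵥ (u t - delayDiff τ u t) := by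
    rw [he, Caug1, Matrix.fromCols_mulVec_sumElim, Matrix.zero_mulVec, add_zero, delayDiff,
      sub_sub_cancel]
  have h2 := storageRate_add_supply G F R S Xs γ K (ρ t) (ρ' t) (h.posR _ hρ) (h.posT _ hρ)
    (Sum.elim (xp t) (xψ t)) (xc t) (delayDiff τ u t) (u t) (d t) (y t)
    (weightedZ Xs (ρ t) fun k => F.z1 k u (delayDiff τ u) xψ t) (γ⁻¹ • e t) hy' hu
  rw [← he', stacked_output] at h2
  have h3 := supplyForm_eq (F := F) (τ := τ) (d := d) (xp := xp) (xψ := xψ) (xc := xc) (u := u)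
    (e := e) h.pos (h.posXs _ hρ)
  rw [blockDiagonal_mulVec_weightedZ (h.posXs _ hρ)] at h2
  have h4 := weightedZ_dotProduct (Xs := Xs) (ρ t)
    fun k => F.z1 k u (delayDiff τ u) xψ t
  simp only [IQCFilter.z1] at h2 h3 h4 ⊢
  rw [h4] at h2
  have h5 : IsDesign.stateForm G F R S Xs γ K (ρ t) (ρ' t)
      (loopVec F Xs γ τ ρ d xp xψ xc u e t) = loopForm G F R S Xs γ (ρ t) (ρ' t) (K (ρ t))
        ((R (ρ t))⁻¹ *ᵥ xc t, Sum.elim (xp t) (xψ t) - xc t, (loopVec F Xs γ τ ρ d xp xψ xc u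
          e t).2.2) := rfl
  rw [h5, h3]
  simp only [loopVec, IQCFilter.z1]
  rw [← h2]
  simp only [iqcTerm, IQCFilter.z1, Finset.sum_sub_distrib, smul_dotProduct, dotProduct_smul,
    smul_eq_mul, weightW, Matrix.sum_mulVec, dotProduct_sum]
  have h6 : γ * (γ⁻¹ * (γ⁻¹ * (e t ⬝ᵥ e t))) = γ⁻¹ * (e t ⬝ᵥ e t) := by
    rw [← mul_assoc γ γ⁻¹, mul_inv_cancel₀ h.pos.ne', one_mul]
  rw [h6]
  ring

theorem locL2_augState
    (hcl : ClosedLoop G F (gainController G F R S K) τ ρ ρ' d xp xψ xc u y e) (i : AugIdx np nψ) : LocL2 fun t => Sum.elim (xp t) (xψ t) i := by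
  rcases i with i | i
  · exact LocL2.of_continuousOn ((continuous_apply i).comp_continuousOn
      hcl.plant_state.continuousOn)
  · exact LocL2.of_continuousOn ((continuous_apply i).comp_continuousOn
      hcl.filter_state.2.continuousOn)

theorem AdmissibleTraj.continuousOn_entry {m n : Type} {M : (Fin s → ℝ) → Matrix m n ℝ}
    (htr : AdmissibleTraj P νlo νhi ρ ρ') (hM : ContinuousOn M P) (i : m) (j : n) :
    ContinuousOn (fun t => M (ρ t) i j) (Ici 0) :=
  htr.continuousOn_comp (f := fun ρ => M ρ i j)
    ((continuous_apply j).comp_continuousOn ((continuous_apply i).comp_continuousOn hM))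

theorem locL2_e
    (h : IsDesign G F P νlo νhi R S Xs γ K)
    (htr : AdmissibleTraj P νlo νhi ρ ρ')
    (hcl : ClosedLoop G F (gainController G F R S K) τ ρ ρ' d xp xψ xc u y e) (i : Fin ne) : LocL2 fun t => e t i := by
  have hxp : ∀ i, LocL2 fun t => xp t i := fun i => locL2_augState hcl (Sum.inl i)
  have hv : ∀ i, LocL2 fun t => delayed τ u t i := fun i => by
    have := (hcl.u_mem.locL2 i).sub (hcl.w_mem.locL2 i)
    refine this.congr_ae (Eventually.of_forall fun t => ?_)
    rw [delayDiff, Pi.sub_apply, sub_sub_cancel]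
  have h1 := ((LocL2.mulVec (htr.continuousOn_entry h.plant.2.2.2.1) hxp i).add
    (LocL2.mulVec (htr.continuousOn_entry h.plant.2.2.2.2.1) hcl.d_mem.locL2 i)).add
    (LocL2.mulVec (htr.continuousOn_entry h.plant.2.2.2.2.2.1) hv i)
  refine h1.congr_ae ?_
  filter_upwards [hcl.plant_e] with t ht
  rw [ht]
  rfl

theorem locL2_z1 (hu : L2e u) (hw : L2e (delayDiff τ u))
    (hx : F.IsResponse u (delayDiff τ u) xψ) (k : Fin N) (i : Fin nu) :
    LocL2 fun t => F.z1 k u (delayDiff τ u) xψ t i :=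
  ((LocL2.mulVec (M := fun _ => F.Cψ k) (v := xψ) (fun _ _ => continuousOn_const)
      (fun i => LocL2.of_continuousOn
        ((continuous_apply i).comp_continuousOn hx.2.continuousOn)) i).add
    (LocL2.mulVec (M := fun _ => F.Dψ1 k) (fun _ _ => continuousOn_const) hu.locL2 i)).add
    (LocL2.mulVec (M := fun _ => F.Dψ2 k) (fun _ _ => continuousOn_const) hw.locL2 i)

theorem continuousOn_inv_entry
    (h : IsDesign G F P νlo νhi R S Xs γ K)
    (htr : AdmissibleTraj P νlo νhi ρ ρ') (k : Fin N) (i j : Fin nu) :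
    ContinuousOn (fun t => (Xs k (ρ t))⁻¹ i j) (Ici 0) := by
  refine htr.continuousOn_entry (M := fun ρ => (Xs k ρ)⁻¹) ?_ i j
  exact continuousOn_iff_continuous_domRestrict.2 (continuous_matrix_inv
    (continuous_coe_of_continuousOn (h.continuousXs k)) fun ρ =>
      (h.posXs ρ ρ.2 k).det_pos.ne'.isUnit)

theorem intervalIntegrable_iqcTerm
    (h : IsDesign G F P νlo νhi R S Xs γ K)
    (htr : AdmissibleTraj P νlo νhi ρ ρ')
    (hu : L2e u) (hw : L2e (delayDiff τ u)) (hx : F.IsResponse u (delayDiff τ u) xψ) (k : Fin N)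
    {T : ℝ} (hT : 0 ≤ T) :
    IntervalIntegrable (iqcTerm F Xs τ ρ u xψ k) volume 0 T :=
  (LocL2.intervalIntegrable_dotProduct (locL2_z1 hu hw hx k)
    (LocL2.mulVec (continuousOn_inv_entry h htr k) (locL2_z1 hu hw hx k)) hT).sub
  (LocL2.intervalIntegrable_dotProduct hw.locL2
    (LocL2.mulVec (continuousOn_inv_entry h htr k) hw.locL2) hT)

theorem intervalIntegrable_sumSq
    (h : IsDesign G F P νlo νhi R S Xs γ K)
    (htr : AdmissibleTraj P νlo νhi ρ ρ')
    (hcl : ClosedLoop G F (gainController G F R S K) τ ρ ρ' d xp xψ xc u y e) {T : ℝ} (hT : 0 ≤ T) :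
    IntervalIntegrable (fun t => sumSq (loopVec F Xs γ τ ρ d xp xψ xc u e t)) volume 0 T := by
  have hxc : ∀ i, LocL2 fun t => xc t i := fun i => LocL2.of_continuousOn
    ((continuous_apply i).comp_continuousOn hcl.ctrl_state.continuousOn)
  have hch : ∀ i, LocL2 fun t => (loopVec F Xs γ τ ρ d xp xψ xc u e t).2.2 i := by
    rintro (i | i | i | i)
    · exact hcl.w_mem.locL2 i
    · exact hcl.d_mem.locL2 i
    · exact LocL2.mulVec (continuousOn_inv_entry h htr i.2) (locL2_z1 hcl.u_mem hcl.w_mem hcl.filter_state i.2) i.1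
    · exact (locL2_e h htr hcl i).continuousOn_mul continuousOn_const
  exact ((LocL2.intervalIntegrable_dotProduct (locL2_augState hcl) (locL2_augState hcl) hT).add
    (LocL2.intervalIntegrable_dotProduct hxc hxc hT)).add
    (LocL2.intervalIntegrable_dotProduct hch hch hT)

/-- The integrated dissipation inequality. The hard integral quadratic constraints allow the
multiplier terms to be dropped at every horizon. -/
theorem dissipation
    (h : IsDesign G F P νlo νhi R S Xs γ K)
    (htr : AdmissibleTraj P νlo νhi ρ ρ')
    (hcl : ClosedLoop G F (gainController G F R S K) τ ρ ρ' d xp xψ xc u y e) {c : ℝ}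
    (hc : ∀ ρ ∈ P, ∀ ν ∈ Icc νlo νhi, ∀ v : LoopSpace np nψ nu nd ne N,
      IsDesign.stateForm G F R S Xs γ K ρ ν v ≤ -c * sumSq v)
    (hiqc : ∀ k, F.SatisfiesHardIQC k (fun t => (Xs k (ρ t))⁻¹) τ) {T : ℝ} (hT : 0 ≤ T) :
    storage R S (ρ T) (Sum.elim (xp T) (xψ T)) (xc T)
        + c * (∫ t in (0 : ℝ)..T, sumSq (loopVec F Xs γ τ ρ d xp xψ xc u e t))
        + γ⁻¹ * ∫ t in (0 : ℝ)..T, e t ⬝ᵥ e t ≤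
      storage R S (ρ 0) (Sum.elim (xp 0) (xψ 0)) (xc 0) + γ * ∫ t in (0 : ℝ)..T, d t ⬝ᵥ d t := by
  have hr := rateOn_storage_closedLoop h htr hcl hT
  have hI := fun k => intervalIntegrable_iqcTerm h htr hcl.u_mem
    hcl.w_mem hcl.filter_state k hT
  have hS := intervalIntegrable_sumSq h htr hcl hT
  have hE := LocL2.intervalIntegrable_dotProduct (locL2_e h htr hcl) (locL2_e h htr hcl) hT
  have hD := LocL2.intervalIntegrable_dotProduct hcl.d_mem.locL2 hcl.d_mem.locL2 hT
  have hIs : IntervalIntegrable (fun t => ∑ k, iqcTerm F Xs τ ρ u xψ k t) volume 0 T := by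
    have := IntervalIntegrable.sum Finset.univ fun k _ => hI k
    simpa only [Finset.sum_fn] using this
  have hmono := intervalIntegral.integral_mono_on hT (hr.intervalIntegrable hT)
    ((((hS.const_mul (-c)).sub hIs).sub (hE.const_mul γ⁻¹)).add (hD.const_mul γ))
    (fun t ht => by
      rw [supplyForm_eq h.pos (h.posXs _ (htr.1 t ht.1))]
      have := hc (ρ t) (htr.1 t ht.1) (ρ' t) (htr.2.1 t ht.1)
        (loopVec F Xs γ τ ρ d xp xψ xc u e t)
      linarith)
  rw [hr.integral_eq hT, intervalIntegral.integral_add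
    (((hS.const_mul (-c)).sub hIs).sub (hE.const_mul γ⁻¹)) (hD.const_mul γ),
    intervalIntegral.integral_sub ((hS.const_mul (-c)).sub hIs) (hE.const_mul γ⁻¹),
    intervalIntegral.integral_sub (hS.const_mul (-c)) hIs,
    intervalIntegral.integral_const_mul, intervalIntegral.integral_const_mul,
    intervalIntegral.integral_const_mul, intervalIntegral.integral_finsetSum fun k _ => hI k]
    at hmono
  have hpos : 0 ≤ ∑ k, ∫ t in (0 : ℝ)..T, iqcTerm F Xs τ ρ u xψ k t :=
    Finset.sum_nonneg fun k _ => hiqc k u hcl.u_mem hcl.w_mem xψ hcl.filter_state T hT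
  linarith

end Trajectory

/-! ### Asymptotic stability and the gain bound -/

section Convergence

theorem integrableOn_Ioi_of_abs_le {f q : ℝ → ℝ} {C I : ℝ} (hC : 0 ≤ C)
    (hf : ∀ T, 0 ≤ T → IntervalIntegrable f volume 0 T)
    (hq : ∀ T, 0 ≤ T → IntervalIntegrable q volume 0 T)
    (hI : ∀ T, 0 ≤ T → ∫ t in (0 : ℝ)..T, q t ≤ I) (hfq : ∀ t, 0 ≤ t → |f t| ≤ C * q t) :
    IntegrableOn f (Ioi 0) := by
  refine integrableOn_Ioi_of_intervalIntegral_norm_bounded (l := atTop) (b := fun n : ℕ => (n : ℝ))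
    (C * I) 0 (fun n => ?_) tendsto_natCast_atTop_atTop (Eventually.of_forall fun n => ?_)
  · exact (intervalIntegrable_iff_integrableOn_Ioc_of_le n.cast_nonneg).1 (hf n n.cast_nonneg)
  · have hn : (0 : ℝ) ≤ n := n.cast_nonneg
    calc ∫ t in (0 : ℝ)..n, ‖f t‖ ≤ ∫ t in (0 : ℝ)..n, C * q t :=
          intervalIntegral.integral_mono_on hn (hf n hn).norm ((hq n hn).const_mul C)
            fun t ht => hfq t ht.1
      _ = C * ∫ t in (0 : ℝ)..n, q t := intervalIntegral.integral_const_mul _ _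
      _ ≤ C * I := mul_le_mul_of_nonneg_left (hI n hn) hC

/-- An absolutely continuous function tends to zero if it and its derivative are dominated by an
integrable function. -/
theorem tendsto_zero_of_rateOn {V V' q : ℝ → ℝ} {C β I : ℝ} (hC : 0 ≤ C) (hβ : 0 ≤ β)
    (hV : ∀ T, 0 ≤ T → RateOn T V V') (hq : ∀ T, 0 ≤ T → IntervalIntegrable q volume 0 T)
    (hI : ∀ T, 0 ≤ T → ∫ t in (0 : ℝ)..T, q t ≤ I) (hV' : ∀ t, 0 ≤ t → |V' t| ≤ C * q t)
    (hVq : ∀ t, 0 ≤ t → |V t| ≤ β * q t) : Tendsto V atTop (𝓝 0) := by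
  have h1 := integrableOn_Ioi_of_abs_le hC (fun T hT => (hV T hT).intervalIntegrable hT) hq hI hV'
  have h2 := integrableOn_Ioi_of_abs_le hβ (fun T hT => (hV T hT).ac.continuousOn.intervalIntegrable)
    hq hI hVq
  have h3 : Tendsto V atTop (𝓝 (V 0 + ∫ t in Ioi (0 : ℝ), V' t)) := by
    refine ((intervalIntegral_tendsto_integral_Ioi 0 h1 tendsto_id).const_add (V 0)).congr' ?_
    filter_upwards [eventually_ge_atTop 0] with T hT
    rw [id, (hV T hT).integral_eq hT]
    ring
  have h4 : V 0 + ∫ t in Ioi (0 : ℝ), V' t = 0 :=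
    IntegrableAtFilter.eq_zero_of_tendsto (l := atTop) (μ := volume) ⟨Ioi 0, Ioi_mem_atTop _, h2⟩
      (fun A hA => by
        obtain ⟨b, hb⟩ := mem_atTop_sets.1 hA
        rw [← top_le_iff, ← Real.volume_Ici (a := b)]
        exact measure_mono hb) h3
  rwa [h4] at h3

end Convergence

section Performance

variable {s np nu nd ne ny N nψ : ℕ} {G : Plant s np nu nd ne ny} {F : IQCFilter N nψ nu}
  {P : Set (Fin s → ℝ)} {νlo νhi : Fin s → ℝ}
  {R S : (Fin s → ℝ) → Matrix (AugIdx np nψ) (AugIdx np nψ) ℝ}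
  {Xs : Fin N → (Fin s → ℝ) → Matrix (Fin nu) (Fin nu) ℝ} {γ : ℝ}
  {K : (Fin s → ℝ) → Gains (AugIdx np nψ) (Fin nu) (MeasIdx nu ny)} {τmax r : ℝ}

theorem dotProduct_le_sumSq_loopVec (τ : ℝ → ℝ) (ρ : ℝ → Fin s → ℝ) (d : ℝ → Fin nd → ℝ)
    (xp : ℝ → Fin np → ℝ) (xψ : ℝ → Fin nψ → ℝ) (xc : ℝ → AugIdx np nψ → ℝ)
    (u : ℝ → Fin nu → ℝ) (e : ℝ → Fin ne → ℝ) (t : ℝ) :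
    d t ⬝ᵥ d t ≤ sumSq (loopVec F Xs γ τ ρ d xp xψ xc u e t) := by
  have h : ∀ {n : Type} [Fintype n] (v : n → ℝ), 0 ≤ v ⬝ᵥ v := fun v =>
    dotProduct_self_nonneg_real v
  simp only [sumSq, loopVec, chan, sumElim_dotProduct_sumElim]
  linarith [h (xp t), h (xψ t), h (xc t), h (delayDiff τ u t), h (γ⁻¹ • e t),
    h (weightedZ Xs (ρ t) fun k => F.z1 k u (delayDiff τ u) xψ t)]

theorem norm_sq_state_le_sumSq (v : LoopSpace np nψ nu nd ne N) :
    ‖(v.1, v.2.1)‖ ^ 2 ≤ sumSq v := by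
  refine le_trans ?_ (norm_sq_le_sumSq v)
  gcongr
  simp only [Prod.norm_def]
  exact max_le_max_left _ (le_max_left _ _)

theorem norm_state_le {a : Fin np → ℝ} {b : Fin nψ → ℝ} {c : AugIdx np nψ → ℝ} :
    ‖a‖ ≤ ‖(Sum.elim a b, c)‖ ∧ ‖b‖ ≤ ‖(Sum.elim a b, c)‖ ∧ ‖c‖ ≤ ‖(Sum.elim a b, c)‖ := by
  have h := norm_fst_le (Sum.elim a b, c)
  refine ⟨le_trans ?_ h, le_trans ?_ h, norm_snd_le (Sum.elim a b, c)⟩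
  · exact (pi_norm_le_iff_of_nonneg (norm_nonneg _)).2 fun i =>
      norm_le_pi_norm (Sum.elim a b) (Sum.inl i)
  · exact (pi_norm_le_iff_of_nonneg (norm_nonneg _)).2 fun i =>
      norm_le_pi_norm (Sum.elim a b) (Sum.inr i)

theorem IsDesign.l2GainLT (h : IsDesign G F P νlo νhi R S Xs γ K)
    (hiqc : ∀ k τ ρ ρ', AdmissibleDelay τmax r τ → AdmissibleTraj P νlo νhi ρ ρ' →
      F.SatisfiesHardIQC k (fun t => (Xs k (ρ t))⁻¹) τ) :
    L2GainLT G F (gainController G F R S K) P νlo νhi τmax r γ := by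
  obtain ⟨c, hc, hdecay⟩ := h.exists_decay
  obtain ⟨α, β, hα, -, hV⟩ := h.exists_storage_bounds
  have hγ := h.pos
  have hδ : 0 < min c γ := lt_min hc hγ
  -- the minimum keeps the radicand nonnegative
  have hδγ : 0 ≤ γ - min c γ := sub_nonneg.2 (min_le_right _ _)
  refine ⟨Real.sqrt (γ * (γ - min c γ)), Real.sqrt_nonneg _, ?_, ?_⟩
  · rw [Real.sqrt_lt' hγ]
    nlinarith
  intro τ hτ ρ ρ' htr d xp xψ xc u y e hcl hxp hxc
  refine ⟨L2e.of_locL2 (locL2_e h htr hcl), fun T hT => ?_⟩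
  have h1 := dissipation h htr hcl hdecay (fun k => hiqc k τ ρ ρ' hτ htr) hT
  have h2 : storage R S (ρ 0) (Sum.elim (xp 0) (xψ 0)) (xc 0) = 0 := by
    have hz : (Sum.elim (0 : Fin np → ℝ) (0 : Fin nψ → ℝ)) = 0 := by
      ext i; cases i <;> rfl
    rw [hxp, hxc, hcl.filter_state.1, hz]
    simp [storage]
  have h3 : 0 ≤ storage R S (ρ T) (Sum.elim (xp T) (xψ T)) (xc T) :=
    le_trans (by positivity) (hV (ρ T) (htr.1 T hT) _ _).1
  have hD := LocL2.intervalIntegrable_dotProduct hcl.d_mem.locL2 hcl.d_mem.locL2 hT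
  have h4 : ∫ t in (0 : ℝ)..T, d t ⬝ᵥ d t ≤
      ∫ t in (0 : ℝ)..T, sumSq (loopVec F Xs γ τ ρ d xp xψ xc u e t) :=
    intervalIntegral.integral_mono_on hT hD (intervalIntegrable_sumSq h htr hcl hT)
      fun t _ => dotProduct_le_sumSq_loopVec τ ρ d xp xψ xc u e t
  have h5 : 0 ≤ ∫ t in (0 : ℝ)..T, d t ⬝ᵥ d t :=
    intervalIntegral.integral_nonneg hT fun t _ => dotProduct_self_nonneg_real _
  rw [Real.sq_sqrt (mul_nonneg hγ.le hδγ)]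
  -- the decay term absorbs a part of the disturbance, which makes the gain bound strict
  have h6 : γ⁻¹ * ∫ t in (0 : ℝ)..T, e t ⬝ᵥ e t ≤
      (γ - min c γ) * ∫ t in (0 : ℝ)..T, d t ⬝ᵥ d t := by
    have h7 := mul_le_mul_of_nonneg_right (min_le_left c γ) h5
    have h8 := mul_le_mul_of_nonneg_left h4 hc.le
    rw [sub_mul]
    linarith
  rw [inv_mul_le_iff₀ hγ] at h6
  rwa [mul_assoc]

theorem IsDesign.asymptoticallyStable (h : IsDesign G F P νlo νhi R S Xs γ K)
    (hiqc : ∀ k τ ρ ρ', AdmissibleDelay τmax r τ → AdmissibleTraj P νlo νhi ρ ρ' →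
      F.SatisfiesHardIQC k (fun t => (Xs k (ρ t))⁻¹) τ) :
    AsymptoticallyStable G F (gainController G F R S K) P νlo νhi τmax r := by
  obtain ⟨c, hc, hdecay⟩ := h.exists_decay
  obtain ⟨C, hC, hrate⟩ := h.exists_rate_bound
  obtain ⟨α, β, hα, hβ, hV⟩ := h.exists_storage_bounds
  have hγ := h.pos
  -- the dissipation inequality without disturbance
  have key : ∀ τ, AdmissibleDelay τmax r τ → ∀ ρ ρ', AdmissibleTraj P νlo νhi ρ ρ' →
      ∀ xp xψ xc u y e, ClosedLoop G F (gainController G F R S K) τ ρ ρ' (fun _ => 0)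
        xp xψ xc u y e → ∀ T, 0 ≤ T →
      storage R S (ρ T) (Sum.elim (xp T) (xψ T)) (xc T) + c * (∫ t in (0 : ℝ)..T,
        sumSq (loopVec F Xs γ τ ρ (fun _ => (0 : Fin nd → ℝ)) xp xψ xc u e t)) ≤
      storage R S (ρ 0) (Sum.elim (xp 0) (xψ 0)) (xc 0) := by
    intro τ hτ ρ ρ' htr xp xψ xc u y e hcl T hT
    have h1 := dissipation h htr hcl hdecay (fun k => hiqc k τ ρ ρ' hτ htr) hT
    have h2 : 0 ≤ γ⁻¹ * ∫ t in (0 : ℝ)..T, e t ⬝ᵥ e t :=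
      mul_nonneg (inv_nonneg.2 hγ.le)
        (intervalIntegral.integral_nonneg hT fun t _ => dotProduct_self_nonneg_real _)
    simp only [dotProduct_zero, intervalIntegral.integral_zero, mul_zero, add_zero] at h1
    linarith
  have hq0 : ∀ v : LoopSpace np nψ nu nd ne N, 0 ≤ sumSq v := fun v =>
    (sq_nonneg _).trans (norm_sq_le_sumSq v)
  constructor
  · intro ε hε
    refine ⟨ε * Real.sqrt (α / β), mul_pos hε (Real.sqrt_pos.2 (div_pos hα hβ)), ?_⟩
    intro τ hτ ρ ρ' htr xp xψ xc u y e hcl hxp hxc t ht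
    have h1 := key τ hτ ρ ρ' htr xp xψ xc u y e hcl t ht
    have h2 := mul_nonneg hc.le (intervalIntegral.integral_nonneg (μ := volume) ht fun t _ =>
      hq0 (loopVec F Xs γ τ ρ (fun _ => (0 : Fin nd → ℝ)) xp xψ xc u e t))
    have h3 := (hV (ρ t) (htr.1 t ht) (Sum.elim (xp t) (xψ t)) (xc t)).1
    have h4 := (hV (ρ 0) (htr.1 0 le_rfl) (Sum.elim (xp 0) (xψ 0)) (xc 0)).2
    have hδ := mul_pos hε (Real.sqrt_pos.2 (div_pos hα hβ))
    have h5 : ‖(Sum.elim (xp 0) (xψ 0), xc 0)‖ < ε * Real.sqrt (α / β) := by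
      refine max_lt ?_ hxc
      refine (pi_norm_lt_iff hδ).2 ?_
      rintro (i | i)
      · exact (norm_le_pi_norm (xp 0) i).trans_lt hxp
      · simpa [hcl.filter_state.1] using hδ
    have h6 : ‖(Sum.elim (xp 0) (xψ 0), xc 0)‖ ^ 2 < ε ^ 2 * (α / β) := by
      have := pow_lt_pow_left₀ h5 (norm_nonneg _) two_ne_zero
      rwa [mul_pow, Real.sq_sqrt (div_pos hα hβ).le] at this
    have h7 : β * ‖(Sum.elim (xp 0) (xψ 0), xc 0)‖ ^ 2 < α * ε ^ 2 := by
      have := mul_lt_mul_of_pos_left h6 hβ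
      have h8 : β * (ε ^ 2 * (α / β)) = α * ε ^ 2 := by field_simp
      rwa [h8] at this
    have h9 : ‖(Sum.elim (xp t) (xψ t), xc t)‖ < ε := by
      refine lt_of_pow_lt_pow_left₀ 2 hε.le ?_
      refine lt_of_mul_lt_mul_left ?_ hα.le
      linarith
    obtain ⟨ha, hb, hc'⟩ := norm_state_le (a := xp t) (b := xψ t) (c := xc t)
    exact ⟨ha.trans_lt h9, hb.trans_lt h9, hc'.trans_lt h9⟩
  · intro τ hτ ρ ρ' htr xp xψ xc u y e hcl
    have hVnn : ∀ t, 0 ≤ t → 0 ≤ storage R S (ρ t) (Sum.elim (xp t) (xψ t)) (xc t) :=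
      fun t ht => le_trans (by positivity) (hV (ρ t) (htr.1 t ht) _ _).1
    have h1 : Tendsto (fun t => storage R S (ρ t) (Sum.elim (xp t) (xψ t)) (xc t)) atTop
        (𝓝 0) := by
      refine tendsto_zero_of_rateOn (C := C) (β := β)
        (I := c⁻¹ * storage R S (ρ 0) (Sum.elim (xp 0) (xψ 0)) (xc 0)) hC.le hβ.le
        (fun T hT => rateOn_storage_closedLoop h htr hcl hT)
        (fun T hT => intervalIntegrable_sumSq h htr hcl hT) (fun T hT => ?_)
        (fun t ht => hrate (ρ t) (htr.1 t ht) (ρ' t) (htr.2.1 t ht) _) (fun t ht => ?_)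
      · rw [le_inv_mul_iff₀ hc]
        linarith [key τ hτ ρ ρ' htr xp xψ xc u y e hcl T hT, hVnn T hT]
      · rw [abs_of_nonneg (hVnn t ht)]
        exact (hV (ρ t) (htr.1 t ht) _ _).2.trans (mul_le_mul_of_nonneg_left
          (norm_sq_state_le_sumSq (loopVec F Xs γ τ ρ (fun _ => (0 : Fin nd → ℝ)) xp xψ xc u e t))
          hβ.le)
    have h2 : Tendsto (fun t => ‖(Sum.elim (xp t) (xψ t), xc t)‖) atTop (𝓝 0) := by
      have h3 : Tendsto (fun t => Real.sqrt (α⁻¹ * storage R S (ρ t) (Sum.elim (xp t) (xψ t))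
          (xc t))) atTop (𝓝 0) := by
        have := (h1.const_mul α⁻¹).sqrt
        rwa [mul_zero, Real.sqrt_zero] at this
      refine squeeze_zero' (Eventually.of_forall fun t => norm_nonneg _) ?_ h3
      filter_upwards [eventually_ge_atTop 0] with t ht
      refine Real.le_sqrt_of_sq_le ?_
      rw [le_inv_mul_iff₀ hα]
      exact (hV (ρ t) (htr.1 t ht) _ _).1
    refine ⟨?_, ?_, ?_⟩
    · exact squeeze_zero_norm (fun t => norm_state_le.1) h2
    · exact squeeze_zero_norm (fun t => norm_state_le.2.1) h2
    · exact squeeze_zero_norm (fun t => norm_state_le.2.2) h2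

end Performance

/-! ### Solvability of the loop equation -/

section FilterResponse

theorem RateOn.of_hasDerivAt {f f' : ℝ → ℝ} (h : ∀ t, HasDerivAt f (f' t) t)
    (hc : Continuous f') (T : ℝ) : RateOn T f f' := by
  refine ⟨?_, Eventually.of_forall h⟩
  have h1 : ContDiff ℝ 1 f := by
    rw [contDiff_one_iff_deriv]
    refine ⟨fun t => (h t).differentiableAt, ?_⟩
    rwa [show _root_.deriv f = f' from funext fun t => (h t).deriv]
  obtain ⟨L, hL⟩ := (h1.locallyLipschitz.locallyLipschitzOn
    (s := uIcc 0 T)).exists_lipschitzOnWith_of_compact isCompact_uIcc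
  exact hL.absolutelyContinuousOnInterval

/-- The matrix exponential as a fundamental matrix, with its inverse. -/
theorem exists_fundamental_matrix {n : Type} [Fintype n] [DecidableEq n] (A : Matrix n n ℝ) :
    ∃ E H : ℝ → Matrix n n ℝ, (∀ t i j, HasDerivAt (fun t => E t i j) ((A * E t) i j) t) ∧
      Continuous E ∧ Continuous H ∧ ∀ t, E t * H t = 1 := by
  let _ := Matrix.linftyOpNormedRing (n := n) (α := ℝ)
  let _ := Matrix.linftyOpNormedAlgebra (n := n) (R := ℝ) (α := ℝ)
  have hd : ∀ t : ℝ, HasDerivAt (fun t : ℝ => NormedSpace.exp (t • A))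
      (A * NormedSpace.exp (t • A)) t := fun t => hasDerivAt_exp_smul_const' A t
  refine ⟨fun t => NormedSpace.exp (t • A), fun t => NormedSpace.exp (-(t • A)), fun t i j => ?_,
    ?_, ?_, fun t => ?_⟩
  · exact hasDerivAt_pi.1 (hasDerivAt_pi.1 (hd t) i) j
  · exact continuous_iff_continuousAt.2 fun t => (hd t).continuousAt
  · have h1 := continuous_iff_continuousAt.2 fun t => (hd t).continuousAt
    have h2 : (fun t : ℝ => NormedSpace.exp (-(t • A))) =
        (fun t : ℝ => NormedSpace.exp (t • A)) ∘ fun t => -t := funext fun t => by simp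
    rw [h2]
    exact h1.comp continuous_neg
  · rw [← Matrix.exp_add_of_commute _ _ (Commute.neg_right (Commute.refl (t • A))),
      add_neg_cancel, NormedSpace.exp_zero]

theorem LocL2.intervalIntegrable {f : ℝ → ℝ} (hf : LocL2 f) {T : ℝ} (hT : 0 ≤ T) :
    IntervalIntegrable f volume 0 T := by
  have h1 : LocL2 fun _ => (1 : ℝ) := LocL2.of_continuousOn continuousOn_const
  simpa using hf.intervalIntegrable_mul h1 hT

theorem intervalIntegrable_pi {n : Type} [Fintype n] {f : ℝ → n → ℝ} {a b : ℝ}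
    (h : ∀ i, IntervalIntegrable (fun t => f t i) volume a b) : IntervalIntegrable f volume a b :=
  ⟨Integrable.of_eval fun i => (h i).1, Integrable.of_eval fun i => (h i).2⟩

/-- Variation of constants: a linear system driven by a locally square integrable input has a
response from zero initial state, which vanishes as long as the input does. -/
theorem exists_response {n : Type} [Fintype n] [DecidableEq n] (A : Matrix n n ℝ)
    {b : ℝ → n → ℝ} (hb : ∀ i, LocL2 fun t => b t i) {t₀ : ℝ} (h0 : ∀ t, 0 ≤ t → t < t₀ → b t = 0) :
    ∃ x : ℝ → n → ℝ, HasRate x (fun t => A *ᵥ x t + b t) ∧ ∀ t, 0 ≤ t → t ≤ t₀ → x t = 0 := by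
  obtain ⟨E, H, hE, hEc, hHc, hEH⟩ := exists_fundamental_matrix A
  have hf : ∀ i, LocL2 fun t => (H t *ᵥ b t) i := fun i => LocL2.mulVec
    (fun i j => (hHc.matrix_elem i j).continuousOn) hb i
  have hi : ∀ T, 0 ≤ T → IntervalIntegrable (fun t => H t *ᵥ b t) volume 0 T := fun T hT =>
    intervalIntegrable_pi fun i => (hf i).intervalIntegrable hT
  have hy : HasRate (fun t => ∫ σ in (0 : ℝ)..t, H σ *ᵥ b σ) fun t => H t *ᵥ b t :=
    fun t ht => ⟨hi t ht, by simp⟩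
  refine ⟨fun t => E t *ᵥ ∫ σ in (0 : ℝ)..t, H σ *ᵥ b σ, ?_, fun t ht htt => ?_⟩
  · refine HasRate.of_rateOn fun T hT i => ?_
    have h1 := RateOn.mulVec (M' := fun t => A * E t)
      (fun i j => RateOn.of_hasDerivAt (fun t => hE t i j)
        ((continuous_const.matrix_mul hEc).matrix_elem i j) T) (fun i => hy.rateOn hT i) i
    refine h1.congr_ae (Eventually.of_forall fun t => ?_)
    rw [Matrix.mulVec_mulVec, hEH, Matrix.one_mulVec, Matrix.mulVec_mulVec]
  · have h1 : ∫ σ in (0 : ℝ)..t, H σ *ᵥ b σ = ∫ σ in (0 : ℝ)..t, (0 : n → ℝ) := by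
      rw [intervalIntegral.integral_of_le ht, intervalIntegral.integral_of_le ht,
        integral_Ioc_eq_integral_Ioo, integral_Ioc_eq_integral_Ioo]
      refine setIntegral_congr_fun measurableSet_Ioo fun σ hσ => ?_
      rw [h0 σ hσ.1.le (hσ.2.trans_le htt), Matrix.mulVec_zero]
    beta_reduce
    rw [h1, intervalIntegral.integral_zero, Matrix.mulVec_zero]

end FilterResponse

section TestInput

variable {nu : ℕ} {τmax r : ℝ} {τ : ℝ → ℝ}

theorem AdmissibleDelay.continuousOn (h : AdmissibleDelay τmax r τ) : ContinuousOn τ (Ici 0) := by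
  have h1 : LipschitzOnWith (Real.toNNReal r) τ (Ici 0) :=
    LipschitzOnWith.of_dist_le_mul fun a ha b hb => by
      rw [Real.dist_eq, Real.dist_eq]
      exact (h.2 a b ha hb).trans
        (mul_le_mul_of_nonneg_right (Real.le_coe_toNNReal r) (abs_nonneg _))
  exact h1.continuousOn

/-- The input that switches from `0` to `v` at time `t₀`. -/
noncomputable def stepInput (t₀ : ℝ) (v : Fin nu → ℝ) (t : ℝ) : Fin nu → ℝ :=
  if t₀ ≤ t then v else 0

theorem delayed_stepInput {t₀ : ℝ} (h0 : 0 ≤ t₀) (v : Fin nu → ℝ) (t : ℝ) :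
    delayed τ (stepInput t₀ v) t = if t₀ ≤ t - τ t then v else 0 := by
  unfold delayed stepInput
  split_ifs with h1 h2 h2 <;> first | rfl | exact absurd (h0.trans h2) h1

theorem locL2_indicator {A : Set ℝ} (hA : MeasurableSet A) (c : ℝ) :
    LocL2 (A.indicator fun _ => c) := fun _ _ => (memLp_const c).indicator hA

theorem l2e_stepInput (t₀ : ℝ) (v : Fin nu → ℝ) : L2e (stepInput t₀ v) := by
  refine L2e.of_locL2 fun i => (locL2_indicator (measurableSet_Ici (a := t₀)) (v i)).congr_ae
    (Eventually.of_forall fun t => ?_)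
  by_cases h : t₀ ≤ t <;> simp [stepInput, h]

theorem l2e_delayDiff_stepInput (hτ : AdmissibleDelay τmax r τ) {t₀ : ℝ} (h0 : 0 ≤ t₀)
    (v : Fin nu → ℝ) : L2e (delayDiff τ (stepInput t₀ v)) := by
  have hA : IsClosed (Ici 0 ∩ (fun t => t - τ t) ⁻¹' Ici t₀) :=
    (continuousOn_id.sub hτ.continuousOn).preimage_isClosed_of_isClosed isClosed_Ici isClosed_Ici
  refine L2e.of_locL2 fun i => ((l2e_stepInput t₀ v).locL2 i).sub ?_
  refine (locL2_indicator hA.measurableSet (v i)).congr_ae ?_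
  filter_upwards [ae_restrict_mem measurableSet_Ici] with t ht
  rw [delayed_stepInput h0]
  by_cases h : t₀ ≤ t - τ t
  · have hm : t ∈ Ici 0 ∩ (fun t => t - τ t) ⁻¹' Ici t₀ := ⟨ht, h⟩
    rw [if_pos h, indicator_of_mem hm]
  · rw [if_neg h, indicator_of_notMem (fun hm => h hm.2), Pi.zero_apply]

end TestInput

section Loop

variable {s np nu nd ne ny N nψ : ℕ} {G : Plant s np nu nd ne ny} {F : IQCFilter N nψ nu}
  {P : Set (Fin s → ℝ)} {νlo νhi : Fin s → ℝ}
  {R S : (Fin s → ℝ) → Matrix (AugIdx np nψ) (AugIdx np nψ) ℝ}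
  {Xs : Fin N → (Fin s → ℝ) → Matrix (Fin nu) (Fin nu) ℝ} {γ : ℝ}
  {K : (Fin s → ℝ) → Gains (AugIdx np nψ) (Fin nu) (MeasIdx nu ny)} {τmax r : ℝ}
  {τ : ℝ → ℝ} {ρ ρ' : ℝ → Fin s → ℝ}

/-- At a time with positive delay, a step input is passed on unchanged by `𝒮` for a while, and the
filter state is still zero. The hard constraint on a short horizon therefore bounds the static
part of the filters. -/
theorem IsDesign.form_inv_le_of_hardIQC (h : IsDesign G F P νlo νhi R S Xs γ K)
    (hτ : AdmissibleDelay τmax r τ) (htr : AdmissibleTraj P νlo νhi ρ ρ') {k : Fin N}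
    (hiqc : F.SatisfiesHardIQC k (fun t => (Xs k (ρ t))⁻¹) τ) {t₀ : ℝ} (h0 : 0 ≤ t₀)
    (hpos : 0 < τ t₀) (v : Fin nu → ℝ) :
    v ⬝ᵥ ((Xs k (ρ t₀))⁻¹ *ᵥ v) ≤ (F.Dψ1 k *ᵥ v + F.Dψ2 k *ᵥ v) ⬝ᵥ
      ((Xs k (ρ t₀))⁻¹ *ᵥ (F.Dψ1 k *ᵥ v + F.Dψ2 k *ᵥ v)) := by
  set u := stepInput t₀ v with hu
  have hum := l2e_stepInput t₀ v
  have hwm := l2e_delayDiff_stepInput hτ h0 v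
  have hu0 : ∀ t < t₀, u t = 0 := fun t ht => if_neg ht.not_ge
  have hw0 : ∀ t, 0 ≤ t → t < t₀ → delayDiff τ u t = 0 := fun t ht htt => by
    rw [delayDiff, hu0 t htt, delayed_stepInput h0, if_neg, sub_zero]
    linarith [(hτ.1 t ht).1]
  obtain ⟨x, hx, hx0⟩ := exists_response F.Aψ
    (b := fun t => F.Bψ1 *ᵥ u t + F.Bψ2 *ᵥ delayDiff τ u t) (t₀ := t₀)
    (fun i => (LocL2.mulVec (M := fun _ => F.Bψ1) (fun _ _ => continuousOn_const) hum.locL2 i).add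
      (LocL2.mulVec (M := fun _ => F.Bψ2) (fun _ _ => continuousOn_const) hwm.locL2 i))
    (fun t ht htt => by simp [hu0 t htt, hw0 t ht htt])
  have hresp : F.IsResponse u (delayDiff τ u) x := by
    refine ⟨hx0 0 le_rfl h0, ?_⟩
    simpa only [add_assoc] using hx
  have hxi : ∀ i, ContinuousOn (fun t => x t i) (Ici 0) := fun i =>
    (continuous_apply i).comp_continuousOn hx.continuousOn
  have hXc := continuousOn_inv_entry h htr k
  -- the integrand of the constraint as long as `𝒮 u = u = v`
  set z : ℝ → Fin nu → ℝ := fun t => F.Cψ k *ᵥ x t + F.Dψ1 k *ᵥ v + F.Dψ2 k *ᵥ v with hz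
  set g : ℝ → ℝ := fun t => z t ⬝ᵥ ((Xs k (ρ t))⁻¹ *ᵥ z t) - v ⬝ᵥ ((Xs k (ρ t))⁻¹ *ᵥ v) with hg
  have hzc : ∀ i, ContinuousOn (fun t => z t i) (Ici 0) := fun i => by
    simp only [hz, Pi.add_apply, Matrix.mulVec, dotProduct]
    exact ((continuousOn_finsetSum _ fun j _ => continuousOn_const.mul (hxi j)).add
      continuousOn_const).add continuousOn_const
  have hgc : ContinuousOn g (Ici 0) := by
    simp only [hg, Matrix.mulVec, dotProduct]
    exact (continuousOn_finsetSum _ fun i _ => (hzc i).mul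
      (continuousOn_finsetSum _ fun j _ => (hXc i j).mul (hzc j))).sub
      (continuousOn_finsetSum _ fun i _ => continuousOn_const.mul
        (continuousOn_finsetSum _ fun j _ => (hXc i j).mul continuousOn_const))
  -- otherwise the integrand, which vanishes before `t₀`, is negative right after `t₀`
  by_contra! hlt
  have hg0 : g t₀ < 0 := by
    simp only [hg, hz, hx0 t₀ h0 le_rfl, Matrix.mulVec_zero, zero_add]
    linarith
  have hsub : Ici t₀ ⊆ Ici 0 := Ici_subset_Ici.2 h0
  have hev1 : ∀ᶠ t in 𝓝[≥] t₀, g t < g t₀ / 2 :=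
    ((hgc t₀ h0).mono hsub).eventually_lt_const (by linarith)
  have hev2 : ∀ᶠ t in 𝓝[≥] t₀, t - τ t < t₀ :=
    (((continuousOn_id.sub hτ.continuousOn) t₀ h0).mono hsub).eventually_lt_const
      (show t₀ - τ t₀ < t₀ by linarith)
  obtain ⟨T, hT, hTs⟩ := mem_nhdsGE_iff_exists_Icc_subset.1 (hev1.and hev2)
  have hT0 : 0 ≤ T := h0.trans (mem_Ioi.1 hT).le
  have hq1 : ∀ t ∈ Icc t₀ T, iqcTerm F Xs τ ρ u x k t ≤ g t₀ / 2 := fun t ht => by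
    have h1 : u t = v := if_pos ht.1
    have h2 : delayDiff τ u t = v := by
      rw [delayDiff, h1, delayed_stepInput h0, if_neg (hTs ht).2.not_ge, sub_zero]
    have h3 : iqcTerm F Xs τ ρ u x k t = g t := by
      simp only [iqcTerm, IQCFilter.z1, h1, h2, hg, hz]
    rw [h3]
    exact (hTs ht).1.le
  have hq0 : ∫ t in (0 : ℝ)..t₀, iqcTerm F Xs τ ρ u x k t = 0 := by
    rw [intervalIntegral.integral_of_le h0, integral_Ioc_eq_integral_Ioo]
    refine setIntegral_eq_zero_of_forall_eq_zero fun t ht => ?_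
    simp [iqcTerm, IQCFilter.z1, hu0 t ht.2, hw0 t ht.1.le ht.2, hx0 t ht.1.le ht.2.le]
  have hi0 := intervalIntegrable_iqcTerm h htr hum hwm hresp k h0
  have hiT := hi0.symm.trans (intervalIntegrable_iqcTerm h htr hum hwm hresp k hT0)
  have hle : ∫ t in t₀..T, iqcTerm F Xs τ ρ u x k t ≤ ∫ _ in t₀..T, g t₀ / 2 :=
    intervalIntegral.integral_mono_on (mem_Ioi.1 hT).le hiT intervalIntegrable_const hq1
  have hnn : 0 ≤ ∫ t in (0 : ℝ)..T, iqcTerm F Xs τ ρ u x k t :=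
    hiqc u hum hwm x hresp T hT0
  rw [← intervalIntegral.integral_add_adjacent_intervals hi0 hiT, hq0, zero_add] at hnn
  rw [intervalIntegral.integral_const, smul_eq_mul] at hle
  have hneg : (T - t₀) * (g t₀ / 2) < 0 :=
    mul_neg_of_pos_of_neg (sub_pos.2 hT) (by linarith)
  linarith

theorem IsDesign.loopSolvable (h : IsDesign G F P νlo νhi R S Xs γ K)
    (hiqc : ∀ k τ ρ ρ', AdmissibleDelay τmax r τ → AdmissibleTraj P νlo νhi ρ ρ' →
      F.SatisfiesHardIQC k (fun t => (Xs k (ρ t))⁻¹) τ) :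
    LoopSolvable (gainController G F R S K) P νlo νhi τmax r := by
  intro τ hτ ρ ρ' htr t ht hpos
  rw [Matrix.isUnit_iff_isUnit_det, isUnit_iff_ne_zero]
  intro hdet
  obtain ⟨v, hv, hv0⟩ := Matrix.exists_mulVec_eq_zero_iff.2 hdet
  have hDv : (K (ρ t)).2.2.1.toCols₂ *ᵥ v = v := by
    rw [Matrix.sub_mulVec, Matrix.one_mulVec, sub_eq_zero] at hv0
    exact hv0.symm
  have hρ := htr.1 t ht
  set z : Fin N → Fin nu → ℝ := fun k => F.Dψ1 k *ᵥ v + F.Dψ2 k *ᵥ v with hz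
  -- negativity of the loop form at the states `ξ = ε = 0` contradicts the hard constraints
  have h1 := h.neg (ρ t) hρ (ρ' t) (htr.2.1 t ht)
    (0, 0, chan v (0 : Fin nd → ℝ) (weightedZ Xs (ρ t) z) (0 : Fin ne → ℝ)) fun h0 => hv (by
      funext i
      exact congrFun (congrArg (fun q => q.2.2) h0) (Sum.inl i))
  have h2 : (K (ρ t)).2.2.1 *ᵥ Sum.elim (0 : Fin ny → ℝ) v = v := by
    conv_lhs => rw [← Matrix.fromCols_toCols (K (ρ t)).2.2.1]
    rw [Matrix.fromCols_mulVec_sumElim, Matrix.mulVec_zero, zero_add, hDv]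
  have h3 : F.Dψ1s *ᵥ v + F.Dψ2s *ᵥ v = fun ik => z ik.2 ik.1 := rfl
  have h4 := weightedZ_dotProduct (Xs := Xs) (ρ t) z
  rw [loopForm_eq] at h1
  simp only [Matrix.mulVec_zero, zero_dotProduct, dotProduct_zero, add_zero, mul_zero, sub_zero,
    zero_sub, h2, blockDiagonal_mulVec_weightedZ (h.posXs _ hρ), h4] at h1
  rw [← h3, dotProduct_add] at h4
  have h5 : v ⬝ᵥ (weightW Xs (ρ t) *ᵥ v) ≤ ∑ k, z k ⬝ᵥ ((Xs k (ρ t))⁻¹ *ᵥ z k) := by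
    rw [weightW, Matrix.sum_mulVec, dotProduct_sum]
    exact Finset.sum_le_sum fun k _ =>
      h.form_inv_le_of_hardIQC hτ htr (hiqc k τ ρ ρ' hτ htr) ht hpos v
  linarith

end Loop

/-! ### Convexity of the synthesis conditions -/

section Combinations

variable {m n p : Type} {a b : ℝ}

theorem symBlock_combo (A A' : Matrix m m ℝ) (B B' : Matrix n m ℝ) (D D' : Matrix n n ℝ) :
    a • symBlock A B D + b • symBlock A' B' D' =
      symBlock (a • A + b • A') (a • B + b • B') (a • D + b • D') := by
  simp only [symBlock, Matrix.fromBlocks_smul, Matrix.fromBlocks_add, Matrix.transpose_add,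
    Matrix.transpose_smul]

theorem fromRows_combo (A A' : Matrix m p ℝ) (B B' : Matrix n p ℝ) :
    a • Matrix.fromRows A B + b • Matrix.fromRows A' B' =
      Matrix.fromRows (a • A + b • A') (a • B + b • B') := by
  ext (i | i) j <;> simp

theorem NegDefOnKer.combo [Fintype n] {M M' : Matrix n n ℝ} {L : Matrix m n ℝ}
    (h : NegDefOnKer M L) (h' : NegDefOnKer M' L) (ha : 0 ≤ a) (hb : 0 ≤ b) (hab : a + b = 1) :
    NegDefOnKer (a • M + b • M') L := by
  intro ξ hL hξ
  have h1 := h ξ hL hξ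
  have h2 := h' ξ hL hξ
  rw [Matrix.add_mulVec, Matrix.smul_mulVec, Matrix.smul_mulVec, dotProduct_add, dotProduct_smul,
    dotProduct_smul]
  exact convex_Iio (0 : ℝ) h1 h2 ha hb hab

theorem posDef_combo [Fintype n] [DecidableEq n] {M M' : Matrix n n ℝ} (h : M.PosDef)
    (h' : M'.PosDef) (ha : 0 ≤ a) (hb : 0 ≤ b) (hab : a + b = 1) : (a • M + b • M').PosDef := by
  rcases ha.eq_or_lt with rfl | ha
  · rw [zero_add] at hab
    rwa [hab, zero_smul, one_smul, zero_add]
  · exact (h.smul ha).add_posSemidef (h'.posSemidef.smul hb)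

variable {s : ℕ} {P : Set (Fin s → ℝ)} {M M' : (Fin s → ℝ) → Matrix m n ℝ}

theorem IsC1Near.combo (h : IsC1Near P M) (h' : IsC1Near P M') :
    IsC1Near P (a • M + b • M') := by
  obtain ⟨U, hU, hPU, hM⟩ := h
  obtain ⟨U', hU', hPU', hM'⟩ := h'
  refine ⟨U ∩ U', hU.inter hU', subset_inter hPU hPU', fun i j => ?_⟩
  exact (contDiffOn_const.mul ((hM i j).mono inter_subset_left)).add
    (contDiffOn_const.mul ((hM' i j).mono inter_subset_right))

theorem IsC1Near.differentiableAt (h : IsC1Near P M) {ρ : Fin s → ℝ} (hρ : ρ ∈ P) (i : m) (j : n) :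
    DifferentiableAt ℝ (fun ρ => M ρ i j) ρ := by
  obtain ⟨U, hU, hPU, hM⟩ := h
  exact ((hM i j).contDiffAt (hU.mem_nhds (hPU hρ))).differentiableAt one_ne_zero

theorem rateTerm_combo (h : IsC1Near P M) (h' : IsC1Near P M') {ρ : Fin s → ℝ} (hρ : ρ ∈ P)
    (ν : Fin s → ℝ) :
    rateTerm (a • M + b • M') ν ρ = a • rateTerm M ν ρ + b • rateTerm M' ν ρ := by
  ext i j
  have h1 := (((h.differentiableAt hρ i j).hasFDerivAt.const_smul a).add
    ((h'.differentiableAt hρ i j).hasFDerivAt.const_smul b)).fderiv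
  simp only [Matrix.add_apply, Matrix.smul_apply, rateTerm_apply]
  exact congrArg (fun f => f ν) h1

end Combinations

section Convexity

variable {s np nu nd ne ny N nψ : ℕ} (G : Plant s np nu nd ne ny) (F : IQCFilter N nψ nu)
  {P : Set (Fin s → ℝ)} {R R' S S' : (Fin s → ℝ) → Matrix (AugIdx np nψ) (AugIdx np nψ) ℝ}
  (Xs Xs' : Fin N → (Fin s → ℝ) → Matrix (Fin nu) (Fin nu) ℝ)
  (X X' : (Fin s → ℝ) → Matrix (Fin nu) (Fin nu) ℝ) (γ γ' : ℝ) {a b : ℝ}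

theorem blockDiagonal_combo (ρ : Fin s → ℝ) :
    (Matrix.blockDiagonal fun k => a • Xs k ρ + b • Xs' k ρ) =
      a • (Matrix.blockDiagonal fun k => Xs k ρ) + b • Matrix.blockDiagonal fun k => Xs' k ρ := by
  rw [← Matrix.blockDiagonal_smul, ← Matrix.blockDiagonal_smul, ← Matrix.blockDiagonal_add]
  rfl

theorem lmiR_combo (hab : a + b = 1) (hR : IsC1Near P R) (hR' : IsC1Near P R') {ρ : Fin s → ℝ}
    (hρ : ρ ∈ P) (ν : Fin s → ℝ) :
    lmiR G F (a • R + b • R') (a • Xs + b • Xs') (a • X + b • X') (a • γ + b • γ') ν ρ =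
      a • lmiR G F R Xs X γ ν ρ + b • lmiR G F R' Xs' X' γ' ν ρ := by
  have hc : ∀ {m n : Type} (M : Matrix m n ℝ), a • M + b • M = M := fun M => by
    rw [← add_smul, hab, one_smul]
  simp only [lmiR, symBlock_combo, fromRows_combo, hc, rateTerm_combo hR hR' hρ,
    blockDiagonal_combo, He, Pi.add_apply, Pi.smul_apply, Matrix.transpose_add,
    Matrix.transpose_smul, Matrix.mul_add, Matrix.add_mul, Matrix.mul_smul, Matrix.smul_mul,
    Finset.sum_add_distrib, Finset.sum_sub_distrib, ← Finset.smul_sum]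
  repeat' first | module | congr 1

theorem lmiS_combo (hab : a + b = 1) (hS : IsC1Near P S) (hS' : IsC1Near P S') {ρ : Fin s → ℝ}
    (hρ : ρ ∈ P) (ν : Fin s → ℝ) :
    lmiS G F (a • S + b • S') (a • Xs + b • Xs') (a • γ + b • γ') ν ρ =
      a • lmiS G F S Xs γ ν ρ + b • lmiS G F S' Xs' γ' ν ρ := by
  have hc : ∀ {m n : Type} (M : Matrix m n ℝ), a • M + b • M = M := fun M => by
    rw [← add_smul, hab, one_smul]
  simp only [lmiS, symBlock_combo, fromRows_combo, hc, rateTerm_combo hS hS' hρ,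
    blockDiagonal_combo, He, Pi.add_apply, Pi.smul_apply, Matrix.transpose_add,
    Matrix.transpose_smul, Matrix.mul_add, Matrix.add_mul, Matrix.mul_smul, Matrix.smul_mul]
  repeat' first | module | congr 1

theorem convex_feasibleSet (P : Set (Fin s → ℝ)) (νlo νhi : Fin s → ℝ) :
    Convex ℝ (feasibleSet G F P νlo νhi) := by
  rintro ⟨R, S, Xs, X, γ⟩ ⟨hR, hS, hXs, hX, hγ, h⟩ ⟨R', S', Xs', X', γ'⟩
    ⟨hR', hS', hXs', hX', hγ', h'⟩ a b ha hb hab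
  refine ⟨hR.combo hR', hS.combo hS', fun k => ?_, ?_, convex_Ioi (0 : ℝ) hγ hγ' ha hb hab,
    fun ρ hρ => ?_⟩
  · exact ((hXs k).const_smul a).add ((hXs' k).const_smul b)
  · exact (hX.const_smul a).add (hX'.const_smul b)
  obtain ⟨h1, h2, h3, h4, h5, h6⟩ := h ρ hρ
  obtain ⟨h1', h2', h3', h4', h5', h6'⟩ := h' ρ hρ
  refine ⟨posDef_combo h1 h1' ha hb hab, posDef_combo h2 h2' ha hb hab,
    fun k => posDef_combo (h3 k) (h3' k) ha hb hab, fun ν hν => ?_, fun ν hν => ?_, ?_⟩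
  · have := (h4 ν hν).combo (h4' ν hν) ha hb hab
    rwa [← lmiR_combo G F Xs Xs' X X' γ γ' hab hR hR' hρ] at this
  · have := (h5 ν hν).combo (h5' ν hν) ha hb hab
    rwa [← lmiS_combo G F Xs Xs' γ γ' hab hS hS' hρ] at this
  · have := posDef_combo h6 h6' ha hb hab
    rw [Matrix.fromBlocks_smul, Matrix.fromBlocks_smul, Matrix.fromBlocks_add, ← add_smul, hab,
      one_smul] at this
    exact this

end Convexity

end DelayLPV

open DelayLPV
theorem theorem1 {s np nu nd ne ny N nψ : ℕ}
    (G : Plant s np nu nd ne ny) (F : IQCFilter N nψ nu)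
    (P : Set (Fin s → ℝ)) (hP : IsCompact P) (hG : G.IsContinuousOn P)
    (νlo νhi : Fin s → ℝ) (τmax r : ℝ) :
    Convex ℝ (feasibleSet G F P νlo νhi) ∧
    ∀ (R S : (Fin s → ℝ) → Matrix (Fin np ⊕ Fin nψ) (Fin np ⊕ Fin nψ) ℝ)
      (Xs : Fin N → (Fin s → ℝ) → Matrix (Fin nu) (Fin nu) ℝ)
      (X : (Fin s → ℝ) → Matrix (Fin nu) (Fin nu) ℝ) (γ : ℝ),
      (R, S, Xs, X, γ) ∈ feasibleSet G F P νlo νhi →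
      (∀ k τ ρ ρ', AdmissibleDelay τmax r τ → AdmissibleTraj P νlo νhi ρ ρ' →
        F.SatisfiesHardIQC k (fun t => (Xs k (ρ t))⁻¹) τ) →
      ∃ K : Controller s nu ny (Fin np ⊕ Fin nψ),
        K.IsContinuousOn P (Icc νlo νhi) ∧
        LoopSolvable K P νlo νhi τmax r ∧
        AsymptoticallyStable G F K P νlo νhi τmax r ∧
        L2GainLT G F K P νlo νhi τmax r γ := by
  refine ⟨convex_feasibleSet G F P νlo νhi, ?_⟩
  rintro R S Xs X γ ⟨hR, hS, hXs, -, hγ, h⟩ hiqc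
  have hpos : ∀ ρ ∈ P, ∀ k, (Xs k ρ).PosDef := fun ρ hρ => (h ρ hρ).2.2.1
  obtain ⟨K, hK, hneg⟩ := exists_continuous_gains G F R S Xs γ νlo νhi hG hR hS hXs hpos
    fun ρ hρ => exists_gains_at G F R S Xs X γ νlo νhi ρ (hpos ρ hρ) (h ρ hρ).2.2.2.1
      (h ρ hρ).2.2.2.2.1
  have hD : IsDesign G F P νlo νhi R S Xs γ K :=
    { isCompact := hP
      plant := hG
      c1R := hR
      c1S := hS
      continuousXs := hXs
      pos := hγ
      posR := fun ρ hρ => (h ρ hρ).1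
      posT := fun ρ hρ => posDef_sub_inv (h ρ hρ).1 (h ρ hρ).2.2.2.2.2
      posXs := hpos
      continuousK := hK
      neg := hneg }
  exact ⟨gainController G F R S K, hD.controller_isContinuousOn, hD.loopSolvable hiqc,
    hD.asymptoticallyStable hiqc, hD.l2GainLT hiqc⟩
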